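/- Let $p>0$, $\alpha=2/(1+p)$, $c(\theta)=\cos\theta|\cos\theta|^p$, $s(\theta)=\sin\theta|\sin\theta|^p$. Let $F_0$ be a probability distribution function on $\mathbb R$ with law $\mu_0$ and characteristic function $\phi_0$, and let $F(\cdot,t)$, $t\ge 0$, be probability distribution functions whose characteristic functions $\phi(\cdot,t)$ solve $$\partial_t\phi(\xi,t)=\frac1{2\pi}\int_0^{2\pi}\phi(\xi s(\theta),t)\,\phi(\xi c(\theta),t)\,d\theta-\phi(\xi,t)\quad(t>0),\qquad \phi(\cdot,0)=\phi_0 ,$$ with $t\mapsto\phi(\xi,t)$ continuous at $t=0$ for each $\xi$. For $a_0>0$ let $G_\alpha$ be the symmetric stable law with characteristic function $e^{-a_0|\xi|^\alpha}$, and put $\chi_\alpha(F,G)=\sup_{\xi\ne0}|\phi_F(\xi)-\phi_G(\xi)|/|\xi|^\alpha\in[0,\infty]$. *McKean's probability space.* Let $G(n)$ be the set of binary trees with $n$ leaves in which each node has either no child or a left and a right child; let $p_1=1$ on $G(1)$ and $p_n(g)=\frac1{n-1}\,p_k(g_l)\,p_{n-k}(g_r)$ if the left and right subtrees $g_l,g_r$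 of $g\in G(n)$, $n\ge2$, have $k$ and $n-k$ leaves. Under $P_t$ (with expectation $E_t$), $\nu_t$ is a positive integer, $\gamma_t\in G(\nu_t)$, $P_t\{\nu_t=n,\gamma_t=g\}=e^{-t}(1-e^{-t})^{n-1}p_n(g)$ for $g\in G(n)$, and, independently of $(\nu_t,\gamma_t)$ and of each other, $\theta_t=(\theta_{t,k})_{k}$ are i.i.d. uniform on $[0,2\pi)$ and $X_t=(X_{t,k})_k$ are i.i.d. with law $\mu_0$. The $\theta_{t,k}$ are attached to the internal nodes of $\gamma_t$ (in preorder), and the weight $\beta_{j,t}$ of the $j$-th leaf is the product, along the path from the root to the leaf, of factors $c(\theta_{t,k})$ for a step to the left and $s(\theta_{t,k})$ for a step to the right from the node carrying $\theta_{t,k}$ (so $\beta_{1,t}=1$ if $\nu_t=1$). Put $\beta_{(\nu_t)}=\max_{j\le\nu_t}|\beta_{j,t}|$. *Notation.* Define $v_0$ and $v_0^*$ by $v_0(0)=v_0^*(0)=0$ and, for $\xi\neq0$, $1-\phi_0(\xi)=(a_0+v_0(\xi))|\xi|^\alpha$, $1-\mathrm{Re}\,\phi_0(\xi)=(a_0+v_0^*(\xi))|\xi|^\alpha$.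 Put $\bar v_0^*(\xi)=\sup_{0\le x\le\xi}|v_0^*(x)|$, $M=a_0+\sup_{\xi\ge0}|v_0^*(\xi)|$, $d_1=(3/(8M))^{1/\alpha}$ and, for $\eta\in(0,a_0)$, $M_r=\max_{x\ge0}x^{r\alpha}e^{-(a_0-\eta)x^\alpha}$. Call $d\in(0,1)$ admissible for $\eta$ if $\frac45M^2|x|^\alpha+\bar v_0^*(|x|)\le\eta$ whenever $|x|\le(3d/(8M))^{1/\alpha}$, and put $$k^*=\bar v_0^*(d_1d^{1/\alpha})\bigl(1+2d_1^\alpha d^{1-\alpha}\bar v_0^*(d_1d^{1/\alpha})\bigr)+\tfrac45M^2d_1^\alpha d+\tfrac{32}{25}M^4d_1^{3\alpha}d^{3-\alpha}.$$ **Theorem.** Assume that $F_0$ belongs to the domain of normal attraction of $G_\alpha$, that is, for i.i.d. $Y_i$ with distribution function $F_0$ and some real constants $m_n$, $n^{-1/\alpha}\sum_{i=1}^nY_i-m_n$ converges in distribution to $G_\alpha$. Then $v_0^*$ is bounded and $v_0^*(\xi)\to0$ as $\xi\to0$; for every $\eta\in(0,a_0)$ there is an admissible $d$; and for every $\eta\in(0,a_0)$,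 every admissible $d$, every $c\in(0,1)$ and every $t\ge0$, $$\begin{aligned}\chi_\alpha(F(\cdot,t),G_\alpha)\le{}&E_t\bigl(\bar v_0^*(d_1\beta_{(\nu_t)}^c)\bigr)+2M_1E_t\bigl(\bar v_0^*(d_1\beta_{(\nu_t)}^c)^2\bigr)+\tfrac45M^2M_1E_t(\beta_{(\nu_t)}^\alpha)+\tfrac{32}{25}M_3M^4E_t(\beta_{(\nu_t)}^{2\alpha})\\&+\Bigl(k^*+\frac2{d\,d_1^\alpha}\Bigr)P_t\{\beta_{(\nu_t)}>d\wedge d^{1/(c\alpha)}\}+\frac2{d_1^\alpha}E_t(\beta_{(\nu_t)}^{\alpha(1-c)})+e^{-t}\sup_{\xi\in\mathbb R}|\mathrm{Im}\,v_0(\xi)|,\end{aligned}$$ where both sides may be $+\infty$. If $\sup_\xi|\mathrm{Im}\,v_0(\xi)|<\infty$, the right-hand side tends to $0$ as $t\to+\infty$. -/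

import Mathlib

open MeasureTheory ProbabilityTheory Filter Topology Set
open scoped ENNReal

noncomputable section

namespace InelasticKac

/-! ### The equation -/

/-- `c(θ) = cos θ |cos θ| ^ p`. -/
def cFun (p θ : ℝ) : ℝ := Real.cos θ * |Real.cos θ| ^ p

/-- `s(θ) = sin θ |sin θ| ^ p`. -/
def sFun (p θ : ℝ) : ℝ := Real.sin θ * |Real.sin θ| ^ p

/-- The family `μ t`, `t ≥ 0`, of probability measures solves the Cauchy problem for the inelastic
Kac equation in Fourier form: with `φ(ξ, t)` the characteristic function of `μ t`,
`∂φ/∂t (ξ, t) = (1 / 2π) ∫₀^{2π} φ(ξ s(θ), t) φ(ξ c(θ), t) dθ - φ(ξ, t)` for `t > 0`, and the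
initial datum `μ₀` is attained (continuously in time). -/
structure IsSolution (p : ℝ) (μ₀ : Measure ℝ) (μ : ℝ → Measure ℝ) : Prop where
  isProbabilityMeasure : ∀ t, 0 ≤ t → IsProbabilityMeasure (μ t)
  initial : μ 0 = μ₀
  continuous_zero : ∀ ξ : ℝ,
    ContinuousWithinAt (fun t => charFun (μ t) ξ) (Ici 0) 0
  equation : ∀ ξ t : ℝ, 0 < t →
    HasDerivAt (fun τ => charFun (μ τ) ξ)
      ((1 / (2 * Real.pi) : ℝ) *
          (∫ θ in (0 : ℝ)..(2 * Real.pi),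
            charFun (μ t) (ξ * sFun p θ) * charFun (μ t) (ξ * cFun p θ))
        - charFun (μ t) ξ) t

/-! ### Stable laws and normal attraction -/

/-- `G` is the symmetric stable law with characteristic function `exp (-a₀ |ξ| ^ α)`. -/
def IsSymmStable (α a₀ : ℝ) (G : Measure ℝ) : Prop :=
  ∀ ξ : ℝ, charFun G ξ = (Real.exp (-(a₀ * |ξ| ^ α)) : ℂ)

/-- `μ₀` belongs to the domain of normal attraction of `G`: for i.i.d. `X₀, X₁, …` with law `μ₀`
and suitable centering constants `m n`, the sums `(X₀ + ⋯ + X_{n-1}) / n ^ (1 / α) - m n`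
converge in distribution to `G`. -/
def InDomainOfNormalAttraction (α : ℝ) (μ₀ G : Measure ℝ)
    [IsProbabilityMeasure μ₀] [IsProbabilityMeasure G] : Prop :=
  ∃ m : ℕ → ℝ,
    TendstoInDistribution
      (fun (n : ℕ) (x : ℕ → ℝ) => (∑ i ∈ Finset.range n, x i) / (n : ℝ) ^ (1 / α) - m n)
      atTop (fun x : ℝ => x) (fun _ => Measure.infinitePi (fun _ : ℕ => μ₀)) G

/-- The weighted metric `χ_s(μ, ν) = sup_{ξ ≠ 0} |φ_μ(ξ) - φ_ν(ξ)| / |ξ| ^ s`, in `[0, ∞]`. -/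
def chiDist (s : ℝ) (μ ν : Measure ℝ) : ℝ≥0∞ :=
  ⨆ (ξ : ℝ) (_ : ξ ≠ 0), ENNReal.ofReal (‖charFun μ ξ - charFun ν ξ‖ / |ξ| ^ s)

/-! ### McKean's probability space

Elements of `BinaryTree Unit` are the binary trees in which each node has either zero children
(a leaf, `nil`) or a left and a right child. -/

/-- Trees carry the discrete σ-algebra. -/
instance instMeasurableSpaceTree : MeasurableSpace (BinaryTree Unit) := ⊤

/-- The probability `p_n(g)` of the tree `g` with `n` leaves: `1` for the tree with one leaf, and
`p_{k}(l) p_{n-k}(r) / (n - 1)` if the left subtree `l` has `k` leaves and the right subtree `r`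
has `n - k` leaves. -/
def treeProb : BinaryTree Unit → ℝ
  | .nil => 1
  | .node _ l r =>
      treeProb l * treeProb r / ((l.numLeaves : ℝ) + (r.numLeaves : ℝ) - 1)

/-- The weights of the leaves of a tree, from left to right. The nodes are numbered in preorder
starting from `k`, and the angle `θ i` is attached to the node with number `i`. The weight of a leaf
is the product along the path from the root of the factors `c(θ i)` (at each step to the left) and
`s(θ i)` (at each step to the right). -/
def leafWeights (p : ℝ) (θ : ℕ → ℝ) : ℕ → BinaryTree Unit → List ℝ
  | _, .nil => [1]
  | k, .node _ l r =>
      (leafWeights p θ (k + 1) l).map (fun b => cFun p (θ k) * b) ++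
        (leafWeights p θ (k + 1 + l.numNodes) r).map (fun b => sFun p (θ k) * b)

/-- The uniform law on `[0, 2π)`. -/
def angleLaw : Measure ℝ := ProbabilityTheory.cond volume (Ico 0 (2 * Real.pi))

/-- The sample space of `(ν_t, γ_t, θ_t, X_t)`. -/
abbrev McKeanSpace : Type := ℕ × BinaryTree Unit × (ℕ → ℝ) × (ℕ → ℝ)

/-- McKean's probability `P_t`: `P_t {ν = n, γ = g, θ ∈ A, X ∈ B}` equals
`e^{-t} (1 - e^{-t})^{n-1} p_n(g) u^{⊗ℕ}(A) μ₀^{⊗ℕ}(B)` if `g` has `n` leaves, and `0` otherwise. -/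
def mckeanMeasure (μ₀ : Measure ℝ) (t : ℝ) : Measure McKeanSpace :=
  Measure.sum fun g : BinaryTree Unit =>
    ENNReal.ofReal
        (Real.exp (-t) * (1 - Real.exp (-t)) ^ (g.numLeaves - 1) * treeProb g) •
      (Measure.dirac g.numLeaves).prod
        ((Measure.dirac g).prod
          ((Measure.infinitePi (fun _ : ℕ => angleLaw)).prod
            (Measure.infinitePi (fun _ : ℕ => μ₀))))

/-- `β_{(ν_t)}`, the largest absolute value of the weights of the leaves of `γ_t`. -/
def betaMax (p : ℝ) (ω : McKeanSpace) : ℝ :=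
  ((leafWeights p ω.2.2.1 0 ω.2.1).map (fun b => |b|)).foldr max 0

/-- The expectation `E_t` (in `[0, ∞]`) of the nonnegative function `f` of `β_{(ν_t)}`. -/
def expBeta (p : ℝ) (μ₀ : Measure ℝ) (t : ℝ) (f : ℝ → ℝ) : ℝ≥0∞ :=
  ∫⁻ ω, ENNReal.ofReal (f (betaMax p ω)) ∂(mckeanMeasure μ₀ t)

/-! ### The quantities in the bound -/

/-- `v₀`, defined by `1 - φ₀(ξ) = (a₀ + v₀(ξ)) |ξ| ^ α` for `ξ ≠ 0` and `v₀(0) = 0`. -/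
def v0 (α a₀ : ℝ) (μ₀ : Measure ℝ) (ξ : ℝ) : ℂ :=
  if ξ = 0 then 0 else (1 - charFun μ₀ ξ) / ((|ξ| ^ α : ℝ) : ℂ) - (a₀ : ℂ)

/-- `v₀*`, defined by `1 - Re φ₀(ξ) = (a₀ + v₀*(ξ)) |ξ| ^ α` for `ξ ≠ 0` and `v₀*(0) = 0`. -/
def v0Star (α a₀ : ℝ) (μ₀ : Measure ℝ) (ξ : ℝ) : ℝ :=
  if ξ = 0 then 0 else (1 - (charFun μ₀ ξ).re) / |ξ| ^ α - a₀

/-- `v̄(ξ) = sup_{0 ≤ x ≤ ξ} |v(x)|`. -/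
def vBar (v : ℝ → ℝ) (ξ : ℝ) : ℝ := sSup ((fun x => |v x|) '' Icc 0 ξ)

/-- `M = a₀ + sup_{ξ ≥ 0} |v(ξ)|`. -/
def bigM (a₀ : ℝ) (v : ℝ → ℝ) : ℝ := a₀ + sSup ((fun x => |v x|) '' Ici 0)

/-- `M_r = max_{x ≥ 0} x ^ (r α) exp (-(a₀ - η) x ^ α)`. -/
def maxM (α a₀ η r : ℝ) : ℝ :=
  sSup ((fun x : ℝ => x ^ (r * α) * Real.exp (-((a₀ - η) * x ^ α))) '' Ici 0)

/-- `d₁ = (3 / (8 M)) ^ (1 / α)`. -/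
def d1 (α a₀ : ℝ) (v : ℝ → ℝ) : ℝ := (3 / (8 * bigM a₀ v)) ^ (1 / α)

/-- The requirement on `d ∈ (0, 1)`: `(4/5) M² |x| ^ α + v̄(|x|) ≤ η` for all `x` with
`|x| ≤ (3 d / (8 M)) ^ (1 / α)`. -/
def Admissible (α a₀ : ℝ) (v : ℝ → ℝ) (η d : ℝ) : Prop :=
  d ∈ Ioo (0 : ℝ) 1 ∧
    ∀ x : ℝ, |x| ≤ (3 * d / (8 * bigM a₀ v)) ^ (1 / α) →
      4 / 5 * bigM a₀ v ^ 2 * |x| ^ α + vBar v |x| ≤ η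

/-- The constant `k*`. -/
def kStar (α a₀ : ℝ) (v : ℝ → ℝ) (d : ℝ) : ℝ :=
  vBar v (d1 α a₀ v * d ^ (1 / α)) *
      (1 + 2 * d1 α a₀ v ^ α * d ^ (1 - α) * vBar v (d1 α a₀ v * d ^ (1 / α)))
    + 4 / 5 * bigM a₀ v ^ 2 * d1 α a₀ v ^ α * d
    + 32 / 25 * bigM a₀ v ^ 4 * d1 α a₀ v ^ (3 * α) * d ^ (3 - α)

/-- The upper bound at time `t`, with values in `[0, ∞]`; here `α = 2 / (1 + p)`. -/
def chiBound (p a₀ : ℝ) (μ₀ : Measure ℝ) (η d c t : ℝ) : ℝ≥0∞ :=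
  let α : ℝ := 2 / (1 + p)
  let v : ℝ → ℝ := v0Star α a₀ μ₀
  let M : ℝ := bigM a₀ v
  let M₁ : ℝ := maxM α a₀ η 1
  let M₃ : ℝ := maxM α a₀ η 3
  let δ : ℝ := d1 α a₀ v
  expBeta p μ₀ t (fun β => vBar v (δ * β ^ c))
    + ENNReal.ofReal (2 * M₁) * expBeta p μ₀ t (fun β => vBar v (δ * β ^ c) ^ 2)
    + ENNReal.ofReal (4 / 5 * M ^ 2 * M₁) * expBeta p μ₀ t (fun β => β ^ α)
    + ENNReal.ofReal (32 / 25 * M₃ * M ^ 4) * expBeta p μ₀ t (fun β => β ^ (2 * α))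
    + ENNReal.ofReal (kStar α a₀ v d + 2 / (d * δ ^ α)) *
        mckeanMeasure μ₀ t {ω | min d (d ^ (1 / (c * α))) < betaMax p ω}
    + ENNReal.ofReal (2 / δ ^ α) * expBeta p μ₀ t (fun β => β ^ (α * (1 - c)))
    + ENNReal.ofReal (Real.exp (-t)) *
        ⨆ ξ : ℝ, ENNReal.ofReal |(v0 α a₀ μ₀ ξ).im|

end InelasticKac

end

noncomputable section

namespace InelasticKac

/-! ### The domain of normal attraction -/

/-! Initial datum. Absolute values of characteristic functions do not see the centering constants,
so normal attraction gives |φ₀(x)|^n → e^{-a₀} for n = ⌊x^{-α}⌋, x → 0+, hence 1 - |φ₀(x)|² ~ 2 a₀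
x^α. Since |φ₀|² is the characteristic function of the symmetrization X - X', the tails of X - X'
are O(r^{-α}), and X has finite absolute moments of every order γ < min(α, 1). Then |Im φ₀(x)| ≤ K
|x|^γ, and since α < 2 one can choose 2γ > α: the imaginary part is negligible in |φ₀|², and 1 - Re
φ₀(x) ~ a₀ x^α (`tendsto_one_sub_charFun_re_div`).

Solution. The equation itself forces φ(ξ, t) to be the Wild sum Σ e^{-t} (1 - e^{-t})^n q_n(ξ): the
remainder is estimated for an arbitrary solution (`norm_exp_mul_charFun_sub_le`). The coefficient
q_n averages E ∏ φ₀(ξ β_j) over random trees with n internal nodes (`integral_leafProd`). The law of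
(c(θ), s(θ)) is invariant under sign changes of either coordinate, so φ₀ may be replaced by Re φ₀ in
every tree except the single leaf (`treeCollision_node_evenPart`). That tree has probability e^{-t}
and produces the term with Im v₀.

Bound. Since cos² + sin² = 1, the weights satisfy Σ |β_j|^α = 1. Hence the logarithms of the factors
Re φ₀(ξ β_j) add up to -a₀ |ξ|^α plus an error controlled by the largest weight, as long as the
largest weight times |ξ| is small. For larger |ξ| the trivial bound 2 / |ξ|^α is used. Cutting at a
suitable |ξ| gives an estimate for each tree and each choice of angles (`abs_prod_sub_exp_div_le`),
and the bound is its expectation.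

Decay. The mean of Σ |β_j|^{2α} over trees with n nodes is 3/4 = E(cos⁴ + sin⁴) times the average of
its predecessors, so it tends to 0 (`tendsto_meanSq`). Since ν_t → ∞ in probability, so does the
largest weight to 0, and each term of the bound vanishes in the limit (`tendsto_expBeta`). -/

lemma norm_charFun_map_sum_div_sub (μ : Measure ℝ) [IsProbabilityMeasure μ] (n : ℕ) (r m ξ : ℝ) :
    ‖charFun ((Measure.infinitePi (fun _ : ℕ => μ)).map
      (fun x => (∑ i ∈ Finset.range n, x i) / r - m)) ξ‖ = ‖charFun μ (ξ / r)‖ ^ n := by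
  have hind : iIndepFun (fun (i : ℕ) (x : ℕ → ℝ) => x i) (Measure.infinitePi (fun _ : ℕ => μ)) :=
    iIndepFun_infinitePi (X := fun _ x => x) (fun _ => measurable_id)
  have hmeas : Measurable (fun x : ℕ → ℝ => ∑ i ∈ Finset.range n, x i) :=
    Finset.measurable_sum _ fun i _ => measurable_pi_apply i
  have hsum : charFun ((Measure.infinitePi (fun _ : ℕ => μ)).map
      (fun x => ∑ i ∈ Finset.range n, x i)) (r⁻¹ * ξ) = charFun μ (r⁻¹ * ξ) ^ n := by
    rw [(hind.restrict _).charFun_map_fun_finsetSum_eq_prod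
      (fun i _ => (measurable_pi_apply i).aemeasurable)]
    simp [Measure.infinitePi_map_eval]
  have h2 : (Measure.infinitePi (fun _ : ℕ => μ)).map
      (fun x => (∑ i ∈ Finset.range n, x i) / r - m) =
      ((Measure.infinitePi (fun _ : ℕ => μ)).map
      (fun x => r⁻¹ * ∑ i ∈ Finset.range n, x i)).map (fun y => y + (-m)) := by
    rw [Measure.map_map (by fun_prop) (by fun_prop)]
    congr 1
    ext x
    simp [div_eq_inv_mul, sub_eq_add_neg]
  rw [h2, charFun_map_add_const, norm_mul, charFun_map_mul_comp hmeas.aemeasurable, hsum, norm_pow,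
    div_eq_inv_mul]
  have : ‖Complex.exp (((inner ℝ (-m) ξ : ℝ) : ℂ) * Complex.I)‖ = 1 :=
    Complex.norm_exp_ofReal_mul_I _
  rw [this, mul_one]

lemma tendsto_floor_rpow_neg_mul_rpow {α : ℝ} (hα : 0 < α) :
    Tendsto (fun x : ℝ => (⌊x ^ (-α)⌋₊ : ℝ) * x ^ α) (𝓝[>] 0) (𝓝 1) := by
  have h1 : Tendsto (fun x : ℝ => x ^ (-α)) (𝓝[>] 0) atTop :=
    tendsto_rpow_neg_nhdsGT_zero (neg_lt_zero.2 hα)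
  refine ((tendsto_nat_floor_div_atTop (R := ℝ)).comp h1).congr' ?_
  filter_upwards [self_mem_nhdsWithin] with x hx
  simp only [Function.comp, Real.rpow_neg (le_of_lt hx), div_inv_eq_mul]

lemma tendstoInMeasure_const_of_tendsto {ι Ω : Type*} {l : Filter ι} {_ : MeasurableSpace Ω}
    (P : Measure Ω) {y : ι → ℝ} {c : ℝ} (h : Tendsto y l (𝓝 c)) :
    TendstoInMeasure P (fun i (_ : Ω) => y i) l (fun _ => c) := by
  rw [tendstoInMeasure_iff_norm]
  intro ε hε
  refine tendsto_const_nhds.congr' ?_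
  have := (tendsto_iff_norm_sub_tendsto_zero.1 h).eventually_lt_const hε
  filter_upwards [this] with i hi
  have : {x : Ω | ε ≤ ‖y i - c‖} = ∅ := by
    ext x
    simpa using hi
  rw [this, measure_empty]

lemma _root_.MeasureTheory.TendstoInDistribution.tendsto_charFun {ι Ω Ω' : Type*} {l : Filter ι}
    {_ : MeasurableSpace Ω} {_ : MeasurableSpace Ω'} {P : Measure Ω} [IsProbabilityMeasure P]
    {P' : Measure Ω'} [IsProbabilityMeasure P'] {X : ι → Ω → ℝ} {Z : Ω' → ℝ}
    (h : TendstoInDistribution X l Z (fun _ => P) P') (ξ : ℝ) :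
    Tendsto (fun i => charFun (P.map (X i)) ξ) l (𝓝 (charFun (P'.map Z) ξ)) := by
  have := (ProbabilityMeasure.tendsto_iff_forall_integral_rclike_tendsto ℂ).1 h.tendsto
    (BoundedContinuousFunction.innerProbChar ξ)
  simpa only [ProbabilityMeasure.coe_mk, ← charFun_eq_integral_innerProbChar] using this

/-- Convergence in law is only known along integers n, at frequencies ξ / n^{1/α}. The choice n =
⌊x^{-α}⌋ makes x n^{1/α} → 1. Multiplying the normalized sum by this deterministic factor leaves the
limit law unchanged (Slutsky) and makes the frequency exactly x. -/
lemma tendsto_norm_charFun_pow_floor {α : ℝ} (hα : 0 < α) {a₀ : ℝ} {μ₀ G : Measure ℝ}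
    [IsProbabilityMeasure μ₀] [IsProbabilityMeasure G] (hG : IsSymmStable α a₀ G)
    (h : InDomainOfNormalAttraction α μ₀ G) :
    Tendsto (fun x : ℝ => ‖charFun μ₀ x‖ ^ ⌊x ^ (-α)⌋₊) (𝓝[>] 0) (𝓝 (Real.exp (-a₀))) := by
  obtain ⟨m, hm⟩ := h
  have hn : Tendsto (fun x : ℝ => ⌊x ^ (-α)⌋₊) (𝓝[>] 0) atTop :=
    tendsto_nat_floor_atTop.comp (tendsto_rpow_neg_nhdsGT_zero (neg_lt_zero.2 hα))
  have hy : Tendsto (fun x : ℝ => x * (⌊x ^ (-α)⌋₊ : ℝ) ^ (1 / α)) (𝓝[>] 0) (𝓝 1) := by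
    have h1 := (tendsto_floor_rpow_neg_mul_rpow hα).rpow_const (p := 1 / α) (Or.inl one_ne_zero)
    rw [Real.one_rpow] at h1
    refine h1.congr' ?_
    filter_upwards [self_mem_nhdsWithin] with x hx
    have hx0 : (0 : ℝ) ≤ x := le_of_lt hx
    rw [Real.mul_rpow (by positivity) (by positivity), ← Real.rpow_mul hx0,
      mul_one_div_cancel hα.ne', Real.rpow_one, mul_comm]
  have hX : TendstoInDistribution
      (fun (x : ℝ) (w : ℕ → ℝ) => (∑ i ∈ Finset.range ⌊x ^ (-α)⌋₊, w i) /
        (⌊x ^ (-α)⌋₊ : ℝ) ^ (1 / α) - m ⌊x ^ (-α)⌋₊)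
      (𝓝[>] 0) (fun x : ℝ => x) (fun _ => Measure.infinitePi (fun _ : ℕ => μ₀)) G :=
    { forall_aemeasurable := fun x => hm.forall_aemeasurable _
      aemeasurable_limit := hm.aemeasurable_limit
      tendsto := hm.tendsto.comp hn }
  have hXY := hX.continuous_comp_prodMk_of_tendstoInMeasure_const
    (g := fun q : ℝ × ℝ => q.2 * q.1) (by fun_prop)
    (tendstoInMeasure_const_of_tendsto (Measure.infinitePi (fun _ : ℕ => μ₀)) hy)
    (fun _ => aemeasurable_const)
  have hc1 := (hXY.tendsto_charFun 1).norm
  have hlim : ‖charFun (G.map fun ω => 1 * ω) 1‖ = Real.exp (-a₀) := by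
    have : (fun ω : ℝ => 1 * ω) = id := by ext; simp
    rw [this, Measure.map_id, hG 1, Complex.norm_real, Real.norm_eq_abs, Real.abs_exp]
    simp
  simp only [hlim] at hc1
  refine hc1.congr' ?_
  filter_upwards [self_mem_nhdsWithin, hn.eventually_ge_atTop 1] with x hx hn1
  rw [charFun_map_mul_comp (hX.forall_aemeasurable x), norm_charFun_map_sum_div_sub]
  have : (0 : ℝ) < (⌊x ^ (-α)⌋₊ : ℝ) ^ (1 / α) := by
    apply Real.rpow_pos_of_pos
    exact_mod_cast hn1
  congr 3
  field_simp

lemma tendsto_one_sub_norm_charFun_sq_div {α : ℝ} (hα : 0 < α) {a₀ : ℝ} {μ₀ G : Measure ℝ}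
    [IsProbabilityMeasure μ₀] [IsProbabilityMeasure G] (hG : IsSymmStable α a₀ G)
    (h : InDomainOfNormalAttraction α μ₀ G) :
    Tendsto (fun x : ℝ => (1 - ‖charFun μ₀ x‖ ^ 2) / x ^ α) (𝓝[>] 0) (𝓝 (2 * a₀)) := by
  have h1 := (tendsto_norm_charFun_pow_floor hα hG h).log (Real.exp_pos _).ne'
  rw [Real.log_exp] at h1
  have h2 := h1.div (tendsto_floor_rpow_neg_mul_rpow hα) one_ne_zero
  have hn : Tendsto (fun x : ℝ => ⌊x ^ (-α)⌋₊) (𝓝[>] 0) atTop :=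
    tendsto_nat_floor_atTop.comp (tendsto_rpow_neg_nhdsGT_zero (neg_lt_zero.2 hα))
  have h3 : Tendsto (fun x : ℝ => -2 * (Real.log ‖charFun μ₀ x‖ / x ^ α)) (𝓝[>] 0)
      (𝓝 (2 * a₀)) := by
    have := (h2.const_mul (-2))
    have e : -2 * (-a₀ / 1) = 2 * a₀ := by ring
    rw [e] at this
    refine this.congr' ?_
    filter_upwards [hn.eventually_ge_atTop 1] with x hx
    have hx' : (⌊x ^ (-α)⌋₊ : ℝ) ≠ 0 := by
      have : 0 < ⌊x ^ (-α)⌋₊ := hx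
      positivity
    simp only [Pi.div_apply]
    rw [Real.log_pow, mul_div_mul_left _ _ hx']
  have hw : Tendsto (fun x : ℝ => ‖charFun μ₀ x‖ ^ 2) (𝓝[>] 0) (𝓝 1) := by
    have hc : Continuous (fun x : ℝ => ‖charFun μ₀ x‖ ^ 2) := by
      have := continuous_charFun (μ := μ₀)
      fun_prop
    have := hc.tendsto 0
    simp only [charFun_zero, probReal_univ] at this
    simpa using this.mono_left nhdsWithin_le_nhds
  have h4 := hw.mul h3
  rw [one_mul] at h4
  -- With w = |φ₀(x)|², the squeeze is -w log w ≤ 1 - w ≤ -log w, where w → 1.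
  refine tendsto_of_tendsto_of_tendsto_of_le_of_le' h4 h3 ?_ ?_
  · filter_upwards [hw.eventually_const_lt (show (0 : ℝ) < 1 by norm_num), self_mem_nhdsWithin]
      with x hx hx0
    have hxα : 0 < x ^ α := Real.rpow_pos_of_pos hx0 _
    have hl := Real.one_sub_inv_le_log_of_pos hx
    have e : ‖charFun μ₀ x‖ ^ 2 * (-2 * (Real.log ‖charFun μ₀ x‖ / x ^ α)) =
        (‖charFun μ₀ x‖ ^ 2 * -Real.log (‖charFun μ₀ x‖ ^ 2)) / x ^ α := by
      rw [Real.log_pow]; push_cast; ring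
    rw [e]
    gcongr
    have := mul_le_mul_of_nonneg_left hl hx.le
    rw [mul_sub, mul_inv_cancel₀ hx.ne'] at this
    linarith
  · filter_upwards [hw.eventually_const_lt (show (0 : ℝ) < 1 by norm_num), self_mem_nhdsWithin]
      with x hx hx0
    have hxα : 0 < x ^ α := Real.rpow_pos_of_pos hx0 _
    have hl := Real.log_le_sub_one_of_pos hx
    have e : (-2 * (Real.log ‖charFun μ₀ x‖ / x ^ α)) =
        (-Real.log (‖charFun μ₀ x‖ ^ 2)) / x ^ α := by
      rw [Real.log_pow]; push_cast; ring
    rw [e]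
    gcongr
    linarith

lemma norm_charFun_abs (μ : Measure ℝ) (x : ℝ) : ‖charFun μ |x|‖ = ‖charFun μ x‖ := by
  rcases abs_choice x with h | h <;> rw [h]
  rw [charFun_neg, RCLike.norm_conj]

lemma charFun_re_abs (μ : Measure ℝ) (x : ℝ) : (charFun μ |x|).re = (charFun μ x).re := by
  rcases abs_choice x with h | h <;> rw [h]
  rw [charFun_neg, Complex.conj_re]

/-- Near 0 the limit gives the bound; for |x| ≥ δ the left side is at most 1 ≤ |x|^α / δ^α. -/
lemma exists_one_sub_norm_charFun_sq_le {α : ℝ} (hα : 0 < α) {a : ℝ} {μ₀ : Measure ℝ}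
    (h : Tendsto (fun x : ℝ => (1 - ‖charFun μ₀ x‖ ^ 2) / x ^ α) (𝓝[>] 0) (𝓝 a)) :
    ∃ C, 0 ≤ C ∧ ∀ x : ℝ, x ≠ 0 → 1 - ‖charFun μ₀ x‖ ^ 2 ≤ C * |x| ^ α := by
  obtain ⟨δ, hδ, hδ'⟩ := mem_nhdsGT_iff_exists_Ioo_subset.1
    (h.eventually_le_const (show a < |a| + 1 by linarith [le_abs_self a]))
  refine ⟨|a| + 1 + 1 / δ ^ α, by have := hδ.out; positivity, fun x hx => ?_⟩
  rw [← norm_charFun_abs]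
  have hx0 : 0 < |x| := abs_pos.2 hx
  have hxα : 0 < |x| ^ α := Real.rpow_pos_of_pos hx0 _
  have hδα : 0 < δ ^ α := Real.rpow_pos_of_pos hδ _
  rw [add_mul]
  rcases lt_or_ge |x| δ with hlt | hge
  · have := hδ' ⟨hx0, hlt⟩
    simp only [mem_ofPred_eq, div_le_iff₀ hxα] at this
    have h2 : 0 ≤ 1 / δ ^ α * |x| ^ α := by positivity
    linarith
  · have : 1 ≤ 1 / δ ^ α * |x| ^ α := by
      rw [one_div_mul_eq_div, one_le_div hδα]
      exact Real.rpow_le_rpow hδ.out.le hge hα.le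
    have h2 : 0 ≤ (|a| + 1) * |x| ^ α := by positivity
    have h3 : 0 ≤ ‖charFun μ₀ |x|‖ ^ 2 := by positivity
    linarith

/-! ### Tails, fractional moments and the imaginary part -/

lemma measureReal_abs_gt_le_of_charFun_le {ν : Measure ℝ} [IsProbabilityMeasure ν] {α C : ℝ}
    (hα : 0 < α) (hC : 0 ≤ C) (h : ∀ x : ℝ, x ≠ 0 → ‖1 - charFun ν x‖ ≤ C * |x| ^ α) {r : ℝ}
    (hr : 0 < r) : ν.real {x | r < |x|} ≤ 2 * C * 2 ^ α * r ^ (-α) := by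
  refine (measureReal_abs_gt_le_integral_charFun hr).trans ?_
  have hb : ‖∫ t in (-2 * r⁻¹)..(2 * r⁻¹), 1 - charFun ν t‖
      ≤ C * (2 * r⁻¹) ^ α * |2 * r⁻¹ - -2 * r⁻¹| := by
    refine intervalIntegral.norm_integral_le_of_norm_le_const fun x hx => ?_
    have hr' : 0 < r⁻¹ := inv_pos.2 hr
    have hx' : |x| ≤ 2 * r⁻¹ := by
      rw [uIoc_of_le (by linarith)] at hx
      exact abs_le.2 ⟨by linarith [hx.1], hx.2⟩
    rcases eq_or_ne x 0 with rfl | hx0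
    · simp only [charFun_zero, probReal_univ, Complex.ofReal_one, sub_self, norm_zero]
      positivity
    · refine (h x hx0).trans ?_
      gcongr
  have e : |2 * r⁻¹ - -2 * r⁻¹| = 4 * r⁻¹ := by
    rw [show 2 * r⁻¹ - -2 * r⁻¹ = 4 * r⁻¹ by ring]
    exact abs_of_pos (by positivity)
  rw [e, Real.mul_rpow (by norm_num) (by positivity), Real.inv_rpow hr.le, ← Real.rpow_neg hr.le]
    at hb
  calc _ ≤ 2⁻¹ * r * (C * (2 ^ α * r ^ (-α)) * (4 * r⁻¹)) := by gcongr
    _ = _ := by field_simp; ring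

lemma lintegral_rpow_abs_lt_top {ν : Measure ℝ} [IsProbabilityMeasure ν] {α γ C : ℝ}
    (hγ : 0 < γ) (hγα : γ < α) (h : ∀ r : ℝ, 0 < r → ν.real {x | r < |x|} ≤ C * r ^ (-α)) :
    ∫⁻ x, ENNReal.ofReal (|x| ^ γ) ∂ν < ∞ := by
  rw [lintegral_rpow_eq_lintegral_meas_lt_mul ν (ae_of_all _ fun x => abs_nonneg x)
    (by fun_prop) hγ]
  refine ENNReal.mul_lt_top ENNReal.ofReal_lt_top ?_
  -- In the layer-cake integral of ν{|x| > t} t^{γ-1}, the tail is bounded by 1 on (0, 1], where γ >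
  -- 0 gives integrability, and by C t^{-α} beyond, where γ < α does.
  rw [← Ioc_union_Ioi_eq_Ioi (zero_le_one' ℝ)]
  refine (lintegral_union_le _ _ _).trans_lt (ENNReal.add_lt_top.2 ⟨?_, ?_⟩)
  · have hi : IntegrableOn (fun t : ℝ => t ^ (γ - 1)) (Ioc 0 1) :=
      (intervalIntegrable_iff_integrableOn_Ioc_of_le zero_le_one).1
        (intervalIntegral.intervalIntegrable_rpow' (by linarith))
    refine lt_of_le_of_lt ?_ hi.lintegral_lt_top
    refine lintegral_mono fun t => ?_
    calc _ ≤ 1 * ENNReal.ofReal (t ^ (γ - 1)) := by gcongr; exact prob_le_one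
      _ = _ := one_mul _
  · have hi : IntegrableOn (fun t : ℝ => C * t ^ (γ - 1 - α)) (Ioi 1) :=
      (integrableOn_Ioi_rpow_of_lt (by linarith) zero_lt_one).const_mul C
    refine lt_of_le_of_lt ?_ hi.lintegral_lt_top
    refine setLIntegral_mono (by fun_prop) fun t ht => ?_
    have ht0 : (0 : ℝ) < t := zero_lt_one.trans ht
    rw [← ofReal_measureReal, ← ENNReal.ofReal_mul measureReal_nonneg]
    apply ENNReal.ofReal_le_ofReal
    calc _ ≤ C * t ^ (-α) * t ^ (γ - 1) := by gcongr; exact h t ht0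
      _ = _ := by rw [mul_assoc, ← Real.rpow_add ht0]; ring_nf

lemma charFun_map_sub (μ : Measure ℝ) [IsProbabilityMeasure μ] (ξ : ℝ) :
    charFun ((μ.prod μ).map (fun q => q.1 - q.2)) ξ = ((‖charFun μ ξ‖ ^ 2 : ℝ) : ℂ) := by
  have hconv : (μ.prod μ).map (fun q => q.1 - q.2) = μ.conv (μ.map (fun x => (-1) * x)) := by
    rw [Measure.conv]
    nth_rw 3 [← Measure.map_id (μ := μ)]
    rw [Measure.map_prod_map _ _ (by fun_prop) (by fun_prop),
      Measure.map_map (by fun_prop) (by fun_prop)]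
    congr 1
    ext q
    simp [sub_eq_add_neg]
  have : IsProbabilityMeasure (μ.map (fun x => (-1) * x)) :=
    Measure.isProbabilityMeasure_map (by fun_prop)
  rw [hconv, charFun_conv, charFun_map_mul, neg_one_mul, charFun_neg, Complex.mul_conj,
    Complex.normSq_eq_norm_sq]

/-- By Fubini, E|X - y|^γ is finite for almost every y, hence for some y; as γ ≤ 1, |x|^γ ≤ |x -
y|^γ + |y|^γ. -/
lemma lintegral_rpow_abs_lt_top_of_symmetrization {μ : Measure ℝ} [IsProbabilityMeasure μ] {γ : ℝ}
    (hγ : 0 < γ) (hγ1 : γ ≤ 1)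
    (h : ∫⁻ x, ENNReal.ofReal (|x| ^ γ) ∂((μ.prod μ).map (fun q => q.1 - q.2)) < ∞) :
    ∫⁻ x, ENNReal.ofReal (|x| ^ γ) ∂μ < ∞ := by
  rw [lintegral_map (by fun_prop) (by fun_prop), lintegral_prod_symm _ (by fun_prop)] at h
  obtain ⟨y, hy⟩ := (ae_lt_top' (Measurable.aemeasurable (by fun_prop)) h.ne).exists
  calc _ ≤ ∫⁻ x, (ENNReal.ofReal (|x - y| ^ γ) + ENNReal.ofReal (|y| ^ γ)) ∂μ := by
        refine lintegral_mono fun x => ?_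
        rw [← ENNReal.ofReal_add (by positivity) (by positivity)]
        apply ENNReal.ofReal_le_ofReal
        refine le_trans ?_ (Real.rpow_add_le_add_rpow (abs_nonneg _) (abs_nonneg _) hγ.le hγ1)
        gcongr
        simpa using abs_add_le (x - y) y
    _ = _ := lintegral_add_right _ measurable_const
    _ < ∞ := by
        simp only [lintegral_const, measure_univ, mul_one]
        exact ENNReal.add_lt_top.2 ⟨hy, ENNReal.ofReal_lt_top⟩

lemma abs_sin_le_rpow {γ : ℝ} (hγ : 0 < γ) (hγ1 : γ ≤ 1) (y : ℝ) : |Real.sin y| ≤ |y| ^ γ := by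
  rcases le_total |y| 1 with h | h
  · exact Real.abs_sin_le_abs.trans (Real.self_le_rpow_of_le_one (abs_nonneg _) h hγ1)
  · exact (Real.abs_sin_le_one y).trans (Real.one_le_rpow h hγ.le)

lemma exists_abs_charFun_im_le {μ : Measure ℝ} [IsProbabilityMeasure μ] {γ : ℝ}
    (hγ : 0 < γ) (hγ1 : γ ≤ 1) (h : ∫⁻ x, ENNReal.ofReal (|x| ^ γ) ∂μ < ∞) :
    ∃ K, ∀ ξ : ℝ, |(charFun μ ξ).im| ≤ K * |ξ| ^ γ := by
  have hint : Integrable (fun x : ℝ => |x| ^ γ) μ :=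
    ⟨Measurable.aestronglyMeasurable (by fun_prop), by
      rw [hasFiniteIntegral_iff_ofReal (ae_of_all _ fun x => by positivity)]; exact h⟩
  refine ⟨∫ x, |x| ^ γ ∂μ, fun ξ => ?_⟩
  have hint2 : Integrable (fun x : ℝ => Complex.exp (ξ * x * Complex.I)) μ := by
    refine Integrable.of_bound (C := 1) (Continuous.aestronglyMeasurable (by fun_prop))
      (ae_of_all _ fun x => ?_)
    rw [← Complex.ofReal_mul, Complex.norm_exp_ofReal_mul_I]
  have him : (charFun μ ξ).im = ∫ x, Real.sin (ξ * x) ∂μ := by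
    rw [charFun_apply_real]
    have := integral_im hint2
    simp only [RCLike.im_to_complex] at this
    rw [← this]
    congr 1
    ext x
    rw [← Complex.ofReal_mul, Complex.exp_ofReal_mul_I_im]
  rw [him, mul_comm, ← integral_const_mul]
  refine (abs_integral_le_integral_abs).trans ?_
  refine integral_mono_of_nonneg (ae_of_all _ fun x => abs_nonneg _) (hint.const_mul _)
    (ae_of_all _ fun x => ?_)
  simp only
  rw [← Real.mul_rpow (abs_nonneg _) (abs_nonneg _), ← abs_mul]
  exact abs_sin_le_rpow hγ hγ1 _

lemma tendsto_one_sub_charFun_re_div {α : ℝ} (hα : 0 < α) (hα2 : α < 2) {a₀ : ℝ}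
    {μ₀ G : Measure ℝ} [IsProbabilityMeasure μ₀] [IsProbabilityMeasure G]
    (hG : IsSymmStable α a₀ G) (h : InDomainOfNormalAttraction α μ₀ G) :
    Tendsto (fun x : ℝ => (1 - (charFun μ₀ x).re) / x ^ α) (𝓝[>] 0) (𝓝 a₀) := by
  have hsq := tendsto_one_sub_norm_charFun_sq_div hα hG h
  obtain ⟨C, hC, hCx⟩ := exists_one_sub_norm_charFun_sq_le hα hsq
  have : IsProbabilityMeasure ((μ₀.prod μ₀).map (fun q => q.1 - q.2)) :=
    Measure.isProbabilityMeasure_map (by fun_prop)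
  -- The moment of order γ is finite because γ < α; γ ≤ 1 is needed for subadditivity and for |sin
  -- y| ≤ |y|^γ; 2γ > α makes (Im φ₀)² of smaller order than x^α. The interval is nonempty because 0
  -- < α < 2.
  obtain ⟨γ, hγα, hγ⟩ := exists_between (show α / 2 < min α 1 by
    rw [lt_min_iff]; constructor <;> linarith)
  rw [lt_min_iff] at hγ
  have hγ0 : 0 < γ := by linarith
  have htail := fun r hr => measureReal_abs_gt_le_of_charFun_le
    (ν := (μ₀.prod μ₀).map (fun q => q.1 - q.2)) hα hC (fun x hx => by
      rw [charFun_map_sub, ← Complex.ofReal_one, ← Complex.ofReal_sub, Complex.norm_real,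
        Real.norm_eq_abs, abs_of_nonneg]
      · exact hCx x hx
      · have := norm_charFun_le_one (μ := μ₀) x
        rw [sub_nonneg]
        exact pow_le_one₀ (norm_nonneg _) this) (r := r) hr
  obtain ⟨K, hK⟩ := exists_abs_charFun_im_le hγ0 hγ.2.le
    (lintegral_rpow_abs_lt_top_of_symmetrization hγ0 hγ.2.le
      (lintegral_rpow_abs_lt_top hγ0 hγ.1 htail))
  have him : Tendsto (fun x : ℝ => (charFun μ₀ x).im ^ 2 / x ^ α) (𝓝[>] 0) (𝓝 0) := by
    have hpow : Tendsto (fun x : ℝ => K ^ 2 * x ^ (2 * γ - α)) (𝓝[>] 0) (𝓝 0) := by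
      have : Tendsto (fun x : ℝ => x ^ (2 * γ - α)) (𝓝[>] 0) (𝓝 0) := by
        have h1 := (Real.continuousAt_rpow_const 0 (2 * γ - α)
          (Or.inr (by linarith))).tendsto.mono_left (nhdsWithin_le_nhds (s := Ioi 0))
        rwa [Real.zero_rpow (by linarith)] at h1
      simpa using this.const_mul (K ^ 2)
    refine squeeze_zero' ?_ ?_ hpow
    · filter_upwards [self_mem_nhdsWithin] with x hx
      have : (0 : ℝ) < x := hx
      positivity
    · filter_upwards [self_mem_nhdsWithin] with x hx
      have hx0 : (0 : ℝ) < x := hx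
      have h1 := hK x
      rw [abs_of_pos hx0] at h1
      rw [div_le_iff₀ (by positivity), mul_assoc, ← Real.rpow_add hx0, sub_add_cancel, two_mul,
        Real.rpow_add hx0, ← sq_abs]
      calc _ ≤ (K * x ^ γ) ^ 2 := by gcongr
        _ = _ := by ring
  have hre : Tendsto (fun x : ℝ => 1 + (charFun μ₀ x).re) (𝓝[>] 0) (𝓝 2) := by
    have hc : Continuous (fun x : ℝ => 1 + (charFun μ₀ x).re) := by
      have := continuous_charFun (μ := μ₀)
      fun_prop
    have := (hc.tendsto 0).mono_left (nhdsWithin_le_nhds (s := Ioi 0))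
    simp only [charFun_zero, probReal_univ, Complex.ofReal_one, Complex.one_re] at this
    convert this using 2
    norm_num
  -- Uses 1 - Re φ₀ = (1 - |φ₀|² + (Im φ₀)²) / (1 + Re φ₀).
  have h3 := (hsq.add him).div hre two_ne_zero
  have e : (2 * a₀ + 0) / 2 = a₀ := by ring
  rw [e] at h3
  refine h3.congr' ?_
  filter_upwards [hre.eventually_const_lt (show (0 : ℝ) < 2 by norm_num), self_mem_nhdsWithin]
    with x hx hx0
  have : (0 : ℝ) < x ^ α := Real.rpow_pos_of_pos hx0 _
  simp only [Pi.div_apply]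
  rw [← Complex.normSq_eq_norm_sq, Complex.normSq_apply]
  field_simp
  ring

lemma v0Star_abs (α a₀ : ℝ) (μ₀ : Measure ℝ) (x : ℝ) :
    v0Star α a₀ μ₀ |x| = v0Star α a₀ μ₀ x := by
  simp [v0Star, charFun_re_abs]

lemma tendsto_v0Star {α : ℝ} (hα : 0 < α) (hα2 : α < 2) {a₀ : ℝ}
    {μ₀ G : Measure ℝ} [IsProbabilityMeasure μ₀] [IsProbabilityMeasure G]
    (hG : IsSymmStable α a₀ G) (h : InDomainOfNormalAttraction α μ₀ G) :
    Tendsto (v0Star α a₀ μ₀) (𝓝 0) (𝓝 0) := by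
  have h1 : Tendsto (v0Star α a₀ μ₀) (𝓝[>] 0) (𝓝 0) := by
    have := (tendsto_one_sub_charFun_re_div hα hα2 hG h).sub_const a₀
    rw [sub_self] at this
    refine this.congr' ?_
    filter_upwards [self_mem_nhdsWithin] with x hx
    have hx0 : (0 : ℝ) < x := hx
    simp [v0Star, hx0.ne', abs_of_pos hx0]
  have h2 : Tendsto (v0Star α a₀ μ₀) (𝓝[≥] 0) (𝓝 0) := by
    -- The convention that v₀* is 0 at the origin turns the one-sided punctured limit into one that
    -- includes the origin; evenness then gives the full neighbourhood.
    rw [← Ioi_insert, nhdsWithin_insert, tendsto_sup]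
    refine ⟨?_, h1⟩
    have : v0Star α a₀ μ₀ 0 = 0 := by simp [v0Star]
    rw [tendsto_pure_left]
    intro s hs
    rw [this]
    exact mem_of_mem_nhds hs
  have h3 : Tendsto (fun x : ℝ => |x|) (𝓝 0) (𝓝[≥] 0) := by
    refine tendsto_nhdsWithin_iff.2 ⟨?_, Eventually.of_forall fun x => abs_nonneg x⟩
    simpa using (continuous_abs.tendsto (0 : ℝ))
  exact (h2.comp h3).congr fun x => v0Star_abs α a₀ μ₀ x

lemma bddAbove_range_abs_v0Star {α : ℝ} (hα : 0 < α) {a₀ : ℝ} {μ₀ : Measure ℝ}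
    [IsProbabilityMeasure μ₀] (h : Tendsto (v0Star α a₀ μ₀) (𝓝 0) (𝓝 0)) :
    BddAbove (range fun ξ => |v0Star α a₀ μ₀ ξ|) := by
  obtain ⟨δ, hδ, hb⟩ := Metric.eventually_nhds_iff.1
    (h.abs.eventually_le_const (show |(0 : ℝ)| < 1 by norm_num))
  refine ⟨1 + 2 / δ ^ α + |a₀|, ?_⟩
  rintro _ ⟨ξ, rfl⟩
  have hδα : 0 < δ ^ α := Real.rpow_pos_of_pos hδ _
  have h2 : 0 ≤ 2 / δ ^ α := by positivity
  have h3 := abs_nonneg a₀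
  simp only
  rcases lt_or_ge |ξ| δ with hlt | hge
  · have := hb (y := ξ) (by simpa using hlt)
    linarith
  · have hξ : ξ ≠ 0 := by
      rintro rfl
      simp only [abs_zero] at hge
      linarith
    have hξα : δ ^ α ≤ |ξ| ^ α := Real.rpow_le_rpow hδ.le hge hα.le
    have h4 : |1 - (charFun μ₀ ξ).re| ≤ 2 := by
      have := (Complex.abs_re_le_norm (charFun μ₀ ξ)).trans (norm_charFun_le_one ξ)
      rw [abs_le] at this ⊢
      constructor <;> linarith [this.1, this.2]
    rw [v0Star, if_neg hξ]
    refine (abs_sub _ _).trans ?_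
    rw [abs_div, abs_of_pos (hδα.trans_le hξα)]
    have : |1 - (charFun μ₀ ξ).re| / |ξ| ^ α ≤ 2 / δ ^ α := by gcongr
    linarith

/-! ### Admissible constants -/

lemma vBar_nonneg (v : ℝ → ℝ) (x : ℝ) : 0 ≤ vBar v x := by
  refine Real.sSup_nonneg ?_
  rintro _ ⟨y, -, rfl⟩
  exact abs_nonneg _

/-- Monotonicity holds on the whole line: for a negative argument the supremum is over the empty set
and equals 0. -/
lemma vBar_mono {v : ℝ → ℝ} (hv : BddAbove (range fun x => |v x|)) : Monotone (vBar v) := by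
  intro a b hab
  refine Real.sSup_le ?_ (vBar_nonneg v b)
  rintro _ ⟨y, hy, rfl⟩
  exact le_csSup (hv.mono (image_subset_range _ _)) ⟨y, ⟨hy.1, hy.2.trans hab⟩, rfl⟩

lemma abs_le_vBar {v : ℝ → ℝ} (hv : BddAbove (range fun x => |v x|)) {x : ℝ} (hx : 0 ≤ x) :
    |v x| ≤ vBar v x :=
  le_csSup (hv.mono (image_subset_range _ _)) ⟨x, ⟨hx, le_rfl⟩, rfl⟩

lemma add_abs_le_bigM {v : ℝ → ℝ} (hv : BddAbove (range fun x => |v x|)) (a₀ : ℝ) {x : ℝ}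
    (hx : 0 ≤ x) : a₀ + |v x| ≤ bigM a₀ v := by
  have : |v x| ≤ sSup ((fun x => |v x|) '' Ici 0) :=
    le_csSup (hv.mono (image_subset_range _ _)) ⟨x, hx, rfl⟩
  rw [bigM]
  linarith

lemma bigM_pos {v : ℝ → ℝ} {a₀ : ℝ} (ha₀ : 0 < a₀) : 0 < bigM a₀ v := by
  have : 0 ≤ sSup ((fun x => |v x|) '' Ici 0) := by
    refine Real.sSup_nonneg ?_
    rintro _ ⟨y, -, rfl⟩
    exact abs_nonneg _
  rw [bigM]
  linarith

lemma vBar_le_bigM {v : ℝ → ℝ} (hv : BddAbove (range fun x => |v x|)) {a₀ : ℝ} (ha₀ : 0 < a₀)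
    (x : ℝ) : vBar v x ≤ bigM a₀ v := by
  refine Real.sSup_le ?_ (bigM_pos ha₀).le
  rintro _ ⟨y, hy, rfl⟩
  have := add_abs_le_bigM hv a₀ hy.1
  simp only
  linarith

lemma tendsto_vBar {v : ℝ → ℝ} (h : Tendsto v (𝓝 0) (𝓝 0)) : Tendsto (vBar v) (𝓝 0) (𝓝 0) := by
  rw [Metric.tendsto_nhds]
  intro ε hε
  obtain ⟨δ, hδ, hb⟩ := Metric.eventually_nhds_iff.1
    (h.abs.eventually_lt_const (show |(0 : ℝ)| < ε / 2 by simpa using hε))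
  filter_upwards [Metric.ball_mem_nhds 0 hδ] with x hx
  rw [Real.dist_0_eq_abs, abs_of_nonneg (vBar_nonneg v x)]
  refine lt_of_le_of_lt (Real.sSup_le ?_ (half_pos hε).le) (half_lt_self hε)
  rintro _ ⟨y, hy, rfl⟩
  refine (hb (y := y) ?_).le
  rw [Metric.mem_ball, Real.dist_0_eq_abs] at hx
  rw [Real.dist_0_eq_abs, abs_of_nonneg hy.1]
  exact hy.2.trans_lt ((le_abs_self x).trans_lt hx)

lemma exists_admissible {α a₀ : ℝ} (hα : 0 < α) {v : ℝ → ℝ}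
    (h : Tendsto v (𝓝 0) (𝓝 0)) {η : ℝ} (hη : 0 < η) : ∃ d, Admissible α a₀ v η d := by
  have h1 : Tendsto (fun y : ℝ => 4 / 5 * bigM a₀ v ^ 2 * y ^ α + vBar v y) (𝓝 0) (𝓝 0) := by
    have h2 := (Real.continuousAt_rpow_const 0 α (Or.inr hα.le)).tendsto
    rw [Real.zero_rpow hα.ne'] at h2
    simpa using (h2.const_mul (4 / 5 * bigM a₀ v ^ 2)).add (tendsto_vBar h)
  obtain ⟨δ, hδ, hb⟩ := Metric.eventually_nhds_iff.1 (h1.eventually_le_const hη)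
  have h3 : Tendsto (fun d : ℝ => (3 * d / (8 * bigM a₀ v)) ^ (1 / α)) (𝓝[>] 0) (𝓝 0) := by
    have h4 : Continuous fun d : ℝ => (3 * d / (8 * bigM a₀ v)) ^ (1 / α) :=
      (by fun_prop : Continuous fun d : ℝ => 3 * d / (8 * bigM a₀ v)).rpow_const
        fun _ => Or.inr (by positivity)
    have h5 := (h4.tendsto 0).mono_left (nhdsWithin_le_nhds (s := Ioi 0))
    rwa [mul_zero, zero_div, Real.zero_rpow (by positivity)] at h5
  obtain ⟨d, hd, hd'⟩ := ((h3.eventually_lt_const hδ).and (Ioo_mem_nhdsGT one_pos)).exists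
  refine ⟨d, hd', fun x hx => hb ?_⟩
  rw [Real.dist_0_eq_abs, abs_abs]
  exact hx.trans_lt hd

lemma le_maxM_one {α a₀ η : ℝ} (hη : η < a₀) {x : ℝ} (hx : 0 ≤ x) :
    x ^ α * Real.exp (-((a₀ - η) * x ^ α)) ≤ maxM α a₀ η 1 := by
  -- With κ = a₀ - η and u = x^α, the set is bounded because κ u ≤ e^{κ u}, that is u e^{-κ u} ≤ 1 /
  -- κ.
  refine le_csSup ⟨1 / (a₀ - η), ?_⟩ ⟨x, hx, by simp only [one_mul]⟩
  rintro _ ⟨y, hy, rfl⟩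
  have hc : 0 < a₀ - η := sub_pos.2 hη
  have hy0 : (0 : ℝ) ≤ y := hy
  simp only [one_mul]
  rw [Real.exp_neg, ← div_eq_mul_inv, div_le_div_iff₀ (Real.exp_pos _) hc]
  linarith [Real.add_one_le_exp ((a₀ - η) * y ^ α)]

lemma maxM_nonneg (α a₀ η r : ℝ) : 0 ≤ maxM α a₀ η r := by
  refine Real.sSup_nonneg ?_
  rintro _ ⟨y, hy, rfl⟩
  have : (0 : ℝ) ≤ y := hy
  positivity

/-! ### Products of real parts of the initial characteristic function -/

/-- This is the origin of the constants 4/5 and 3/8: the derivative of log(1 - x) + x + (4/5) x² is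
x (3 - 8x) / (5 (1 - x)), which is nonnegative exactly up to x = 3/8 on [0, 1). -/
lemma abs_log_one_sub_add_le {u : ℝ} (h0 : 0 ≤ u) (h1 : u ≤ 3 / 8) :
    |Real.log (1 - u) + u| ≤ 4 / 5 * u ^ 2 := by
  have hup : Real.log (1 - u) + u ≤ 0 := by
    linarith [Real.log_le_sub_one_of_pos (show 0 < 1 - u by linarith)]
  have hlow : 0 ≤ Real.log (1 - u) + u + 4 / 5 * u ^ 2 := by
    have hd : ∀ x ∈ Icc (0 : ℝ) (3 / 8), HasDerivAt
        (fun x : ℝ => Real.log (1 - x) + x + 4 / 5 * x ^ 2) (-1 / (1 - x) + 1 + 8 / 5 * x) x := by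
      intro x hx
      have h2 : HasDerivAt (fun x : ℝ => 1 - x) (-1) x := by
        simpa using (hasDerivAt_id x).const_sub 1
      have h3 := ((h2.log (by linarith [hx.2])).add (hasDerivAt_id x)).add
        ((hasDerivAt_pow 2 x).const_mul (4 / 5))
      have e : -1 / (1 - x) + 1 + 8 / 5 * x =
          -1 / (1 - x) + 1 + 4 / 5 * (((2 : ℕ) : ℝ) * x ^ (2 - 1)) := by
        norm_num
        ring
      rw [e]
      exact h3
    have hm : MonotoneOn (fun x : ℝ => Real.log (1 - x) + x + 4 / 5 * x ^ 2) (Icc 0 (3 / 8)) := by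
      refine monotoneOn_of_deriv_nonneg (convex_Icc _ _)
        (fun x hx => (hd x hx).continuousAt.continuousWithinAt)
        (fun x hx => (hd x (interior_subset hx)).differentiableAt.differentiableWithinAt) ?_
      intro x hx
      have hx' := interior_subset hx
      rw [(hd x hx').deriv]
      have h4 : 0 < 1 - x := by linarith [hx'.2]
      have e : -1 / (1 - x) + 1 + 8 / 5 * x = x * (3 - 8 * x) / (5 * (1 - x)) := by
        field_simp
        ring
      rw [e]
      have h5 : 0 ≤ 3 - 8 * x := by linarith [hx'.2]
      have := hx'.1
      positivity
    simpa using hm ⟨le_rfl, by norm_num⟩ ⟨h0, h1⟩ h0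
  rw [abs_le]
  constructor <;> nlinarith [sq_nonneg u]

/-- With u = 1 - Re φ₀(x) = (a₀ + v₀*(x)) |x|^α ≤ M |x|^α ≤ 3/8, the error is z = (log(1 - u) + u) -
v₀*(x) |x|^α. The first part is quadratic in u, the second is controlled by `vBar`. -/
lemma charFun_re_eq_exp {α a₀ : ℝ} (hα : 0 < α) {μ₀ : Measure ℝ}
    [IsProbabilityMeasure μ₀] (hv : BddAbove (range fun x => |v0Star α a₀ μ₀ x|)) {x : ℝ}
    (hx : bigM a₀ (v0Star α a₀ μ₀) * |x| ^ α ≤ 3 / 8) :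
    ∃ z : ℝ, (charFun μ₀ x).re = Real.exp (-(a₀ * |x| ^ α) + z) ∧
      |z| ≤ (vBar (v0Star α a₀ μ₀) |x| + 4 / 5 * bigM a₀ (v0Star α a₀ μ₀) ^ 2 * |x| ^ α) *
        |x| ^ α := by
  rcases eq_or_ne x 0 with rfl | hx0
  · exact ⟨0, by simp [charFun_zero, Real.zero_rpow hα.ne'], by simp [Real.zero_rpow hα.ne']⟩
  set v := v0Star α a₀ μ₀ with hvdef
  have hxα : 0 < |x| ^ α := Real.rpow_pos_of_pos (abs_pos.2 hx0) _
  have hu : 1 - (charFun μ₀ x).re = (a₀ + v x) * |x| ^ α := by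
    rw [hvdef, v0Star, if_neg hx0]
    field_simp
    ring
  have hu0 : 0 ≤ 1 - (charFun μ₀ x).re := by
    have := (Complex.abs_re_le_norm (charFun μ₀ x)).trans (norm_charFun_le_one x)
    linarith [le_abs_self (charFun μ₀ x).re]
  have hvx : |v x| = |v (|x|)| := by rw [hvdef, v0Star_abs]
  have huM : 1 - (charFun μ₀ x).re ≤ bigM a₀ v * |x| ^ α := by
    rw [hu]
    gcongr
    have := add_abs_le_bigM hv a₀ (abs_nonneg x)
    linarith [le_abs_self (v x)]
  have hlog := abs_log_one_sub_add_le hu0 (huM.trans hx)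
  rw [sub_sub_cancel] at hlog
  refine ⟨Real.log (charFun μ₀ x).re + a₀ * |x| ^ α, ?_, ?_⟩
  · rw [neg_add_cancel_comm_assoc, Real.exp_log (by linarith)]
  · have e : Real.log (charFun μ₀ x).re + a₀ * |x| ^ α =
        (Real.log (charFun μ₀ x).re + (1 - (charFun μ₀ x).re)) + -(v x * |x| ^ α) := by
      rw [hu]; ring
    rw [e]
    refine (abs_add_le _ _).trans ?_
    rw [abs_neg, abs_mul, abs_of_pos hxα, hvx]
    have h1 : (1 - (charFun μ₀ x).re) ^ 2 ≤ (bigM a₀ v * |x| ^ α) ^ 2 := by gcongr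
    have h2 : |v (|x|)| * |x| ^ α ≤ vBar v |x| * |x| ^ α := by
      gcongr
      exact abs_le_vBar hv (abs_nonneg x)
    nlinarith

/-- Both bounds on the exponent are carried along: the one with K will be the small factor, the one
with η keeps e^{|Z|} below the Gaussian-like decay e^{-a |ξ|^α}. -/
lemma exists_prod_eq_exp {ψ w : ℝ → ℝ} {a K η : ℝ} (L : List ℝ)
    (h : ∀ b ∈ L, ∃ z, ψ b = Real.exp (-(a * w b) + z) ∧ |z| ≤ K * w b ∧ |z| ≤ η * w b) :
    ∃ Z, (L.map ψ).prod = Real.exp (-(a * (L.map w).sum) + Z) ∧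
      |Z| ≤ K * (L.map w).sum ∧ |Z| ≤ η * (L.map w).sum := by
  induction L with
  | nil => exact ⟨0, by simp⟩
  | cons b L ih =>
    obtain ⟨Z, hZ, hZ1, hZ2⟩ := ih fun b' hb' => h b' (List.mem_cons_of_mem _ hb')
    obtain ⟨z, hz, hz1, hz2⟩ := h b List.mem_cons_self
    refine ⟨z + Z, ?_, ?_, ?_⟩
    · rw [List.map_cons, List.prod_cons, hz, hZ, ← Real.exp_add, List.map_cons, List.sum_cons]
      ring_nf
    · rw [List.map_cons, List.sum_cons, mul_add]
      exact (abs_add_le _ _).trans (add_le_add hz1 hZ1)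
    · rw [List.map_cons, List.sum_cons, mul_add]
      exact (abs_add_le _ _).trans (add_le_add hz2 hZ2)

lemma abs_exp_sub_one_le_mul_exp (z : ℝ) : |Real.exp z - 1| ≤ |z| * Real.exp |z| := by
  have h1 := Real.add_one_le_exp z
  have h2 := Real.add_one_le_exp (-z)
  have h3 : Real.exp z * Real.exp (-z) = 1 := by rw [← Real.exp_add]; simp
  have h4 := Real.exp_pos z
  rcases le_total 0 z with hz | hz
  · rw [abs_of_nonneg hz, abs_of_nonneg (by linarith)]
    nlinarith
  · rw [abs_of_nonpos hz, abs_of_nonpos (by linarith [Real.exp_le_one_iff.2 hz])]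
    have : 1 ≤ Real.exp (-z) := Real.one_le_exp (by linarith)
    nlinarith

/-- The largest absolute value of the entries of a list. -/
def listMax (L : List ℝ) : ℝ := (L.map (fun b => |b|)).foldr max 0

/-! ### Lists of weights and their largest entry -/

lemma listMax_nonneg (L : List ℝ) : 0 ≤ listMax L := by
  induction L with
  | nil => simp [listMax]
  | cons b L ih => exact le_max_of_le_right ih

lemma abs_le_listMax {L : List ℝ} {b : ℝ} (hb : b ∈ L) : |b| ≤ listMax L := by
  induction L with
  | nil => simp at hb
  | cons b' L ih =>
    rcases List.mem_cons.1 hb with rfl | hb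
    · exact le_max_left _ _
    · exact (ih hb).trans (le_max_right _ _)

lemma listMax_append (L L' : List ℝ) : listMax (L ++ L') = max (listMax L) (listMax L') := by
  induction L with
  | nil =>
    have := listMax_nonneg L'
    simp only [List.nil_append]
    rw [max_eq_right]
    simpa [listMax] using this
  | cons b L ih =>
    change max |b| (listMax (L ++ L')) = max (max |b| (listMax L)) (listMax L')
    rw [ih, max_assoc]

lemma listMax_map_mul (a : ℝ) (L : List ℝ) :
    listMax (L.map fun b => a * b) = |a| * listMax L := by
  induction L with
  | nil => simp [listMax]
  | cons b L ih =>
    change max |a * b| (listMax (L.map fun b => a * b)) = |a| * max |b| (listMax L)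
    rw [ih, abs_mul, mul_max_of_nonneg _ _ (abs_nonneg a)]

lemma rpow_listMax_le {α : ℝ} (hα : 0 < α) (L : List ℝ) :
    listMax L ^ α ≤ (L.map fun b => |b| ^ α).sum := by
  induction L with
  | nil => simp [listMax, Real.zero_rpow hα.ne']
  | cons b L ih =>
    have h2 : 0 ≤ (L.map fun b => |b| ^ α).sum :=
      List.sum_nonneg (by simp only [List.mem_map]; rintro _ ⟨y, -, rfl⟩; positivity)
    have h1 : 0 ≤ |b| ^ α := by positivity
    rw [List.map_cons, List.sum_cons]
    rcases max_choice |b| (listMax L) with h | h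
    · change (max |b| (listMax L)) ^ α ≤ _
      rw [h]; linarith
    · change (max |b| (listMax L)) ^ α ≤ _
      rw [h]; linarith

lemma listMax_le_one {α : ℝ} (hα : 0 < α) {L : List ℝ} (hL : (L.map fun b => |b| ^ α).sum = 1) :
    listMax L ≤ 1 := by
  -- The normalization to 1 does not pass to the tail of the list, but the inequality does.
  have hbound : ∀ L : List ℝ, (L.map fun b => |b| ^ α).sum ≤ 1 → listMax L ≤ 1 := by
    intro L
    induction L with
    | nil => intro; simp [listMax]
    | cons b L ih =>
      intro h
      have h2 : 0 ≤ (L.map fun b => |b| ^ α).sum :=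
        List.sum_nonneg (by simp only [List.mem_map]; rintro _ ⟨y, -, rfl⟩; positivity)
      have h1 : 0 ≤ |b| ^ α := by positivity
      rw [List.map_cons, List.sum_cons] at h
      refine max_le ?_ (ih (by linarith))
      by_contra! hb
      linarith [Real.one_lt_rpow hb hα]
  exact hbound L hL.le

lemma listMax_pos {α : ℝ} (hα : 0 < α) {L : List ℝ} (hL : (L.map fun b => |b| ^ α).sum = 1) :
    0 < listMax L := by
  refine lt_of_le_of_ne (listMax_nonneg L) fun h => ?_
  have h0 : ∀ b ∈ L, |b| ^ α = 0 := fun b hb => by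
    have : |b| = 0 := le_antisymm ((abs_le_listMax hb).trans h.symm.le) (abs_nonneg b)
    rw [this, Real.zero_rpow hα.ne']
  rw [List.sum_eq_zero (by simp only [List.mem_map]; rintro _ ⟨b, hb, rfl⟩; exact h0 b hb)] at hL
  exact zero_ne_one hL

lemma sum_map_abs_mul_rpow (α ξ : ℝ) (L : List ℝ) :
    (L.map fun b => |ξ * b| ^ α).sum = |ξ| ^ α * (L.map fun b => |b| ^ α).sum := by
  rw [← List.sum_map_mul_left]
  congr 2
  ext b
  rw [abs_mul, Real.mul_rpow (abs_nonneg _) (abs_nonneg _)]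

lemma d1_pos {α a₀ : ℝ} {v : ℝ → ℝ} (ha₀ : 0 < a₀) : 0 < d1 α a₀ v := by
  have := bigM_pos (v := v) ha₀
  unfold d1
  positivity

lemma d1_mul_rpow {α a₀ d : ℝ} {v : ℝ → ℝ} (ha₀ : 0 < a₀) (hd : 0 < d) :
    d1 α a₀ v * d ^ (1 / α) = (3 * d / (8 * bigM a₀ v)) ^ (1 / α) := by
  have := bigM_pos (v := v) ha₀
  rw [d1, ← Real.mul_rpow (by positivity) hd.le, div_mul_eq_mul_div]

/-- Since Σ |ξ β_j|^α = |ξ|^α, the expansions of the factors combine into exp(-a₀ |ξ|^α + Z). In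
|e^Z - 1| ≤ |Z| e^{|Z|} the prefactor is bounded through the largest argument and the exponent
through admissibility of d, which costs η out of a₀. -/
lemma abs_prod_sub_exp_le {α a₀ η d : ℝ} (hα : 0 < α) (ha₀ : 0 < a₀) {μ₀ : Measure ℝ}
    [IsProbabilityMeasure μ₀] (hv : BddAbove (range fun x => |v0Star α a₀ μ₀ x|))
    (hd : Admissible α a₀ (v0Star α a₀ μ₀) η d) {L : List ℝ}
    (hL : (L.map fun b => |b| ^ α).sum = 1) {ξ : ℝ}
    (hξ : listMax L * |ξ| ≤ d1 α a₀ (v0Star α a₀ μ₀) * d ^ (1 / α)) :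
    |(L.map fun b => (charFun μ₀ (ξ * b)).re).prod - Real.exp (-(a₀ * |ξ| ^ α))| ≤
      (vBar (v0Star α a₀ μ₀) (listMax L * |ξ|) +
        4 / 5 * bigM a₀ (v0Star α a₀ μ₀) ^ 2 * (listMax L * |ξ|) ^ α) * |ξ| ^ α *
        Real.exp (-((a₀ - η) * |ξ| ^ α)) := by
  set v := v0Star α a₀ μ₀ with hvdef
  have hM := bigM_pos (v := v) ha₀
  have hd0 := hd.1.1
  obtain ⟨Z, hZ, hZ1, hZ2⟩ := exists_prod_eq_exp (ψ := fun b => (charFun μ₀ (ξ * b)).re)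
    (w := fun b => |ξ * b| ^ α) (a := a₀) (η := η)
    (K := vBar v (listMax L * |ξ|) + 4 / 5 * bigM a₀ v ^ 2 * (listMax L * |ξ|) ^ α) L (by
    intro b hb
    have hbL : |ξ * b| ≤ listMax L * |ξ| := by
      rw [abs_mul, mul_comm]
      exact mul_le_mul_of_nonneg_right (abs_le_listMax hb) (abs_nonneg ξ)
    have hx : |ξ * b| ≤ (3 * d / (8 * bigM a₀ v)) ^ (1 / α) := by
      rw [← d1_mul_rpow ha₀ hd0]
      exact hbL.trans hξ
    have hMx : bigM a₀ v * |ξ * b| ^ α ≤ 3 / 8 := by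
      have h1 : |ξ * b| ^ α ≤ 3 * d / (8 * bigM a₀ v) := by
        calc _ ≤ ((3 * d / (8 * bigM a₀ v)) ^ (1 / α)) ^ α := by gcongr
          _ = _ := by
            rw [← Real.rpow_mul (by positivity), one_div_mul_cancel hα.ne', Real.rpow_one]
      calc _ ≤ bigM a₀ v * (3 * d / (8 * bigM a₀ v)) := by gcongr
        _ = 3 / 8 * d := by field_simp
        _ ≤ _ := by linarith [hd.1.2]
    obtain ⟨z, hz, hz1⟩ := charFun_re_eq_exp hα hv hMx
    refine ⟨z, hz, hz1.trans ?_, hz1.trans ?_⟩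
    · gcongr
      exact vBar_mono hv hbL
    · gcongr
      rw [add_comm]
      exact hd.2 _ hx)
  rw [sum_map_abs_mul_rpow, hL, mul_one] at hZ hZ1 hZ2
  rw [hZ, Real.exp_add]
  have e : Real.exp (-(a₀ * |ξ| ^ α)) * Real.exp Z - Real.exp (-(a₀ * |ξ| ^ α)) =
      Real.exp (-(a₀ * |ξ| ^ α)) * (Real.exp Z - 1) := by ring
  rw [e, abs_mul, Real.abs_exp]
  calc _ ≤ Real.exp (-(a₀ * |ξ| ^ α)) * (|Z| * Real.exp |Z|) := by
        gcongr
        exact abs_exp_sub_one_le_mul_exp Z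
    _ ≤ Real.exp (-(a₀ * |ξ| ^ α)) * ((vBar v (listMax L * |ξ|) +
        4 / 5 * bigM a₀ v ^ 2 * (listMax L * |ξ|) ^ α) * |ξ| ^ α * Real.exp (η * |ξ| ^ α)) := by
        gcongr
        exact (abs_nonneg Z).trans hZ1
    _ = _ := by
        rw [mul_left_comm, ← Real.exp_add]
        ring_nf

lemma abs_prod_sub_exp_le_two {μ₀ : Measure ℝ} [IsProbabilityMeasure μ₀] (L : List ℝ) (ξ : ℝ)
    {y : ℝ} (hy : 0 ≤ y) :
    |(L.map fun b => (charFun μ₀ (ξ * b)).re).prod - Real.exp (-y)| ≤ 2 := by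
  have h1 : |(L.map fun b => (charFun μ₀ (ξ * b)).re).prod| ≤ 1 := by
    induction L with
    | nil => simp
    | cons b L ih =>
      rw [List.map_cons, List.prod_cons, abs_mul]
      exact mul_le_one₀ ((Complex.abs_re_le_norm _).trans (norm_charFun_le_one _)) (abs_nonneg _) ih
  have h2 : Real.exp (-y) ≤ 1 := Real.exp_le_one_iff.2 (by linarith)
  have h3 := Real.exp_pos (-y)
  rw [abs_le] at h1 ⊢
  constructor <;> linarith [h1.1, h1.2]

/-- The summands of k* that are left out are nonnegative; the estimate |e^Z - 1| ≤ |Z| e^{|Z|} does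
not need them. -/
lemma add_le_kStar {α a₀ d : ℝ} {v : ℝ → ℝ} (ha₀ : 0 < a₀) (hd : 0 < d) :
    vBar v (d1 α a₀ v * d ^ (1 / α)) + 4 / 5 * bigM a₀ v ^ 2 * d1 α a₀ v ^ α * d ≤
      kStar α a₀ v d := by
  have hM := bigM_pos (v := v) ha₀
  have hd1 := d1_pos (α := α) (v := v) ha₀
  have hvB := vBar_nonneg v (d1 α a₀ v * d ^ (1 / α))
  rw [kStar]
  have h1 : 0 ≤ 32 / 25 * bigM a₀ v ^ 4 * d1 α a₀ v ^ (3 * α) * d ^ (3 - α) := by positivity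
  have h2 : 0 ≤ vBar v (d1 α a₀ v * d ^ (1 / α)) *
    (2 * d1 α a₀ v ^ α * d ^ (1 - α) * vBar v (d1 α a₀ v * d ^ (1 / α))) := by positivity
  linarith

/-- The pointwise estimate from which the bound follows by taking expectations. -/
lemma abs_prod_sub_exp_div_le {α a₀ η d c : ℝ} (hα : 0 < α) (ha₀ : 0 < a₀) (hη : η < a₀)
    {μ₀ : Measure ℝ} [IsProbabilityMeasure μ₀]
    (hv : BddAbove (range fun x => |v0Star α a₀ μ₀ x|))
    (hd : Admissible α a₀ (v0Star α a₀ μ₀) η d) (hc : c ∈ Ioo (0 : ℝ) 1) {L : List ℝ}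
    (hL : (L.map fun b => |b| ^ α).sum = 1) {ξ : ℝ} (hξ : ξ ≠ 0) :
    |(L.map fun b => (charFun μ₀ (ξ * b)).re).prod - Real.exp (-(a₀ * |ξ| ^ α))| / |ξ| ^ α ≤
      vBar (v0Star α a₀ μ₀) (d1 α a₀ (v0Star α a₀ μ₀) * listMax L ^ c) +
        4 / 5 * bigM a₀ (v0Star α a₀ μ₀) ^ 2 * maxM α a₀ η 1 * listMax L ^ α +
        (if min d (d ^ (1 / (c * α))) < listMax L then
          kStar α a₀ (v0Star α a₀ μ₀) d + 2 / (d * d1 α a₀ (v0Star α a₀ μ₀) ^ α) else 0) +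
        2 / d1 α a₀ (v0Star α a₀ μ₀) ^ α * listMax L ^ (α * (1 - c)) := by
  set v := v0Star α a₀ μ₀ with hvdef
  have hM := bigM_pos (v := v) ha₀
  have hd1 := d1_pos (α := α) (v := v) ha₀
  have hd0 := hd.1.1
  have hβ := listMax_pos hα hL
  have hβ1 := listMax_le_one hα hL
  set β := listMax L with hβdef
  have hξ0 : 0 < |ξ| := abs_pos.2 hξ
  have hξα : 0 < |ξ| ^ α := Real.rpow_pos_of_pos hξ0 _
  have hη0 : 0 < a₀ - η := sub_pos.2 hη
  have hM1 := maxM_nonneg α a₀ η 1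
  have hk := add_le_kStar (α := α) (v := v) ha₀ hd0
  have hT1 : 0 ≤ vBar v (d1 α a₀ v * β ^ c) := vBar_nonneg _ _
  have hT2 : 0 ≤ 4 / 5 * bigM a₀ v ^ 2 * maxM α a₀ η 1 * β ^ α := by positivity
  have hT4 : 0 ≤ 2 / d1 α a₀ v ^ α * β ^ (α * (1 - c)) := by positivity
  have hvB := vBar_nonneg v (d1 α a₀ v * d ^ (1 / α))
  have hk2 : 0 ≤ 4 / 5 * bigM a₀ v ^ 2 * d1 α a₀ v ^ α * d := by positivity
  have htwo := abs_prod_sub_exp_le_two (μ₀ := μ₀) L ξ (y := a₀ * |ξ| ^ α) (by positivity)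
  have hexp : Real.exp (-((a₀ - η) * |ξ| ^ α)) ≤ 1 :=
    Real.exp_le_one_iff.2 (by rw [neg_nonpos]; positivity)
  -- A large weight: the cut is at |ξ| = d₁ d^{1/α}. Below it, the largest weight being at most 1
  -- keeps all arguments in the admissible range, which costs k*; above it, |ξ|^α ≥ d d₁^α and the
  -- trivial bound costs 2 / (d d₁^α).
  split_ifs with hbad
  · rcases le_or_gt |ξ| (d1 α a₀ v * d ^ (1 / α)) with hle | hgt
    · have hle' : β * |ξ| ≤ d1 α a₀ v * d ^ (1 / α) :=
        (mul_le_of_le_one_left hξ0.le hβ1).trans hle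
      have h1 := abs_prod_sub_exp_le hα ha₀ hv hd hL hle'
      have h2 : |(L.map fun b => (charFun μ₀ (ξ * b)).re).prod - Real.exp (-(a₀ * |ξ| ^ α))| /
          |ξ| ^ α ≤ kStar α a₀ v d := by
        rw [div_le_iff₀ hξα]
        refine h1.trans ?_
        have hmon := vBar_mono hv hle'
        have hpow : (β * |ξ|) ^ α ≤ d1 α a₀ v ^ α * d := by
          calc _ ≤ (d1 α a₀ v * d ^ (1 / α)) ^ α := by gcongr
            _ = _ := by
              rw [Real.mul_rpow hd1.le (by positivity), ← Real.rpow_mul hd0.le,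
                one_div_mul_cancel hα.ne', Real.rpow_one]
        calc _ ≤ (vBar v (d1 α a₀ v * d ^ (1 / α)) +
              4 / 5 * bigM a₀ v ^ 2 * (d1 α a₀ v ^ α * d)) * |ξ| ^ α * 1 := by gcongr
          _ ≤ _ := by
            rw [mul_one]
            gcongr
            linarith
      have h3 : 0 ≤ 2 / (d * d1 α a₀ v ^ α) := by positivity
      linarith
    · have h2 : |(L.map fun b => (charFun μ₀ (ξ * b)).re).prod - Real.exp (-(a₀ * |ξ| ^ α))| /
          |ξ| ^ α ≤ 2 / (d * d1 α a₀ v ^ α) := by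
        gcongr
        calc _ = (d1 α a₀ v * d ^ (1 / α)) ^ α := by
              rw [Real.mul_rpow hd1.le (by positivity), ← Real.rpow_mul hd0.le,
                one_div_mul_cancel hα.ne', Real.rpow_one, mul_comm]
          _ ≤ _ := by gcongr
      linarith
  -- All weights small: only β ≤ d^{1/(cα)} is used, and it gives β^c ≤ d^{1/α}.
  · have hgood : β ≤ d ^ (1 / (c * α)) := (not_lt.1 hbad).trans (min_le_right _ _)
    have hβc : β ^ c ≤ d ^ (1 / α) := by
      calc _ ≤ (d ^ (1 / (c * α))) ^ c := by have := hc.1; gcongr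
        _ = _ := by
          rw [← Real.rpow_mul hd0.le]
          congr 1
          have := hc.1
          field_simp
    -- The cut is where β |ξ| = d₁ β^c: below it all arguments are at most d₁ β^c ≤ d₁ d^{1/α};
    -- above it the trivial bound is (2 / d₁^α) β^{α(1-c)}.
    rcases le_or_gt |ξ| (d1 α a₀ v * β ^ (c - 1)) with hle | hgt
    · have hle1 : β * |ξ| ≤ d1 α a₀ v * β ^ c := by
        calc _ ≤ β * (d1 α a₀ v * β ^ (c - 1)) := by gcongr
          _ = _ := by
            rw [Real.rpow_sub_one hβ.ne']
            field_simp
      have hle' : β * |ξ| ≤ d1 α a₀ v * d ^ (1 / α) := hle1.trans (by gcongr)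
      have h1 := abs_prod_sub_exp_le hα ha₀ hv hd hL hle'
      have h2 : |(L.map fun b => (charFun μ₀ (ξ * b)).re).prod - Real.exp (-(a₀ * |ξ| ^ α))| /
          |ξ| ^ α ≤ vBar v (d1 α a₀ v * β ^ c) +
            4 / 5 * bigM a₀ v ^ 2 * maxM α a₀ η 1 * β ^ α := by
        rw [div_le_iff₀ hξα]
        refine h1.trans ?_
        have hmon := vBar_mono hv hle1
        have hmax := le_maxM_one (α := α) hη hξ0.le
        rw [Real.mul_rpow hβ.le hξ0.le]
        calc _ = (vBar v (β * |ξ|) * Real.exp (-((a₀ - η) * |ξ| ^ α)) +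
              4 / 5 * bigM a₀ v ^ 2 * (|ξ| ^ α * Real.exp (-((a₀ - η) * |ξ| ^ α))) * β ^ α) *
              |ξ| ^ α := by ring
          _ ≤ (vBar v (d1 α a₀ v * β ^ c) * 1 +
              4 / 5 * bigM a₀ v ^ 2 * maxM α a₀ η 1 * β ^ α) * |ξ| ^ α := by gcongr
          _ = _ := by rw [mul_one]
      linarith
    · have h2 : |(L.map fun b => (charFun μ₀ (ξ * b)).re).prod - Real.exp (-(a₀ * |ξ| ^ α))| /
          |ξ| ^ α ≤ 2 / d1 α a₀ v ^ α * β ^ (α * (1 - c)) := by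
        calc _ ≤ 2 / (d1 α a₀ v * β ^ (c - 1)) ^ α := by gcongr
          _ = _ := by
            rw [Real.mul_rpow hd1.le (by positivity), ← Real.rpow_mul hβ.le,
              show (c - 1) * α = -(α * (1 - c)) by ring, Real.rpow_neg hβ.le]
            field_simp
      linarith

/-! ### Angles -/

lemma angleLaw_eq : angleLaw =
    ENNReal.ofReal (2 * Real.pi)⁻¹ • (volume : Measure ℝ).restrict (Ioc 0 (2 * Real.pi)) := by
  rw [angleLaw, ProbabilityTheory.cond, Real.volume_Ico, sub_zero,
    ENNReal.ofReal_inv_of_pos (by positivity), restrict_Ico_eq_restrict_Ioc]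

instance : IsProbabilityMeasure angleLaw := by
  refine ProbabilityTheory.cond_isProbabilityMeasure_of_finite ?_ ?_ <;>
    rw [Real.volume_Ico, sub_zero]
  · rw [ne_eq, ENNReal.ofReal_eq_zero, not_le]; positivity
  · exact ENNReal.ofReal_ne_top

lemma integral_angleLaw {E : Type*} [NormedAddCommGroup E] [NormedSpace ℝ E] (f : ℝ → E) :
    ∫ θ, f θ ∂angleLaw = (2 * Real.pi)⁻¹ • ∫ θ in (0 : ℝ)..(2 * Real.pi), f θ := by
  rw [angleLaw_eq, integral_smul_measure, intervalIntegral.integral_of_le (by positivity),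
    ENNReal.toReal_ofReal (by positivity)]

lemma continuous_cFun {p : ℝ} (hp : 0 ≤ p) : Continuous (cFun p) := by
  unfold cFun
  exact Real.continuous_cos.mul (Real.continuous_cos.abs.rpow_const fun _ => Or.inr hp)

lemma continuous_sFun {p : ℝ} (hp : 0 ≤ p) : Continuous (sFun p) := by
  unfold sFun
  exact Real.continuous_sin.mul (Real.continuous_sin.abs.rpow_const fun _ => Or.inr hp)

lemma abs_cFun_rpow {p : ℝ} (hp : 0 < p) (θ : ℝ) :
    |cFun p θ| ^ (2 / (1 + p)) = Real.cos θ ^ 2 := by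
  have h := abs_nonneg (Real.cos θ)
  have e : |cFun p θ| = |Real.cos θ| ^ (1 + p) := by
    rw [cFun, abs_mul, abs_of_nonneg (Real.rpow_nonneg h p),
      Real.rpow_one_add' h (by positivity)]
  rw [e, ← Real.rpow_mul h, mul_div_cancel₀ _ (by positivity), Real.rpow_two, sq_abs]

lemma abs_sFun_rpow {p : ℝ} (hp : 0 < p) (θ : ℝ) :
    |sFun p θ| ^ (2 / (1 + p)) = Real.sin θ ^ 2 := by
  have h := abs_nonneg (Real.sin θ)
  have e : |sFun p θ| = |Real.sin θ| ^ (1 + p) := by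
    rw [sFun, abs_mul, abs_of_nonneg (Real.rpow_nonneg h p),
      Real.rpow_one_add' h (by positivity)]
  rw [e, ← Real.rpow_mul h, mul_div_cancel₀ _ (by positivity), Real.rpow_two, sq_abs]

lemma integral_angleLaw_cos_pow_four : ∫ θ, (Real.cos θ ^ 2) ^ 2 ∂angleLaw = 3 / 8 := by
  rw [integral_angleLaw]
  have : ∀ θ : ℝ, (Real.cos θ ^ 2) ^ 2 = Real.cos θ ^ (2 + 2) := fun θ => by ring
  simp only [this]
  rw [integral_cos_pow, integral_cos_sq]
  simp
  field_simp
  norm_num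

lemma integral_angleLaw_sin_pow_four : ∫ θ, (Real.sin θ ^ 2) ^ 2 ∂angleLaw = 3 / 8 := by
  rw [integral_angleLaw]
  have : ∀ θ : ℝ, (Real.sin θ ^ 2) ^ 2 = Real.sin θ ^ (2 + 2) := fun θ => by ring
  simp only [this]
  rw [integral_sin_pow, integral_sin_sq]
  simp
  field_simp
  norm_num

/-- Substitution θ ↦ -θ and periodicity; the sign of c is flipped in the same way by θ ↦ π - θ. -/
lemma integral_angleLaw_cFun_neg_sFun (p : ℝ) (h : ℝ → ℝ → ℂ) :
    ∫ θ, h (cFun p θ) (-sFun p θ) ∂angleLaw = ∫ θ, h (cFun p θ) (sFun p θ) ∂angleLaw := by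
  rw [integral_angleLaw, integral_angleLaw]
  congr 1
  have hper : Function.Periodic (fun θ => h (cFun p θ) (sFun p θ)) (2 * Real.pi) := fun θ => by
    simp [cFun, sFun]
  have e : ∀ θ, h (cFun p θ) (-sFun p θ) =
      (fun θ => h (cFun p θ) (sFun p θ)) (0 - θ) := fun θ => by
    simp [cFun, sFun]
  simp only [e]
  rw [intervalIntegral.integral_comp_sub_left (fun θ => h (cFun p θ) (sFun p θ)) 0]
  have := hper.intervalIntegral_add_eq (0 - 2 * Real.pi) 0
  rw [sub_add_cancel, zero_add] at this
  rw [sub_zero, this]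

lemma integral_angleLaw_neg_cFun_sFun (p : ℝ) (h : ℝ → ℝ → ℂ) :
    ∫ θ, h (-cFun p θ) (sFun p θ) ∂angleLaw = ∫ θ, h (cFun p θ) (sFun p θ) ∂angleLaw := by
  rw [integral_angleLaw, integral_angleLaw]
  congr 1
  have hper : Function.Periodic (fun θ => h (cFun p θ) (sFun p θ)) (2 * Real.pi) := fun θ => by
    simp [cFun, sFun]
  have e : ∀ θ, h (-cFun p θ) (sFun p θ) =
      (fun θ => h (cFun p θ) (sFun p θ)) (Real.pi - θ) := fun θ => by
    simp [cFun, sFun]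
  simp only [e]
  rw [intervalIntegral.integral_comp_sub_left (fun θ => h (cFun p θ) (sFun p θ)) Real.pi]
  have := hper.intervalIntegral_add_eq (Real.pi - 2 * Real.pi) 0
  rw [sub_add_cancel, zero_add] at this
  rw [sub_zero, this]

/-! ### The collision operator -/

/-- The bilinear operator `(1 / 2π) ∫ f (ξ c(θ)) g (ξ s(θ)) dθ`. -/
def collision (p : ℝ) (f g : ℝ → ℂ) (ξ : ℝ) : ℂ :=
  ∫ θ, f (ξ * cFun p θ) * g (ξ * sFun p θ) ∂angleLaw

lemma integrable_angleLaw_of_continuous {h : ℝ → ℂ} (hh : Continuous h) :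
    Integrable h angleLaw := by
  rw [angleLaw_eq]
  refine Integrable.smul_measure ?_ ENNReal.ofReal_ne_top
  exact (hh.integrableOn_Icc (a := 0) (b := 2 * Real.pi)).mono_set Ioc_subset_Icc_self

variable {p : ℝ}

lemma integrable_collision (hp : 0 ≤ p) {f g : ℝ → ℂ} (hf : Continuous f) (hg : Continuous g)
    (ξ : ℝ) : Integrable (fun θ => f (ξ * cFun p θ) * g (ξ * sFun p θ)) angleLaw := by
  have h1 := continuous_cFun hp
  have h2 := continuous_sFun hp
  exact integrable_angleLaw_of_continuous (by fun_prop)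

lemma norm_collision_le {f g : ℝ → ℂ} {A B : ℝ} (hf : ∀ ξ, ‖f ξ‖ ≤ A) (hg : ∀ ξ, ‖g ξ‖ ≤ B)
    (ξ : ℝ) : ‖collision p f g ξ‖ ≤ A * B := by
  have := norm_integral_le_of_norm_le_const (μ := angleLaw)
    (f := fun θ => f (ξ * cFun p θ) * g (ξ * sFun p θ)) (C := A * B) (ae_of_all _ fun θ => by
      rw [norm_mul]
      exact mul_le_mul (hf _) (hg _) (norm_nonneg _) ((norm_nonneg _).trans (hf 0)))
  simpa [collision] using this

lemma continuous_collision (hp : 0 ≤ p) {f g : ℝ → ℂ} (hf : Continuous f) (hg : Continuous g)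
    {A B : ℝ} (hfA : ∀ ξ, ‖f ξ‖ ≤ A) (hgB : ∀ ξ, ‖g ξ‖ ≤ B) : Continuous (collision p f g) := by
  refine continuous_of_dominated (bound := fun _ => A * B)
    (fun ξ => (integrable_collision hp hf hg ξ).aestronglyMeasurable)
    (fun ξ => ae_of_all _ fun θ => ?_) (integrable_const _) (ae_of_all _ fun θ => by fun_prop)
  rw [norm_mul]
  exact mul_le_mul (hfA _) (hgB _) (norm_nonneg _) ((norm_nonneg _).trans (hfA 0))

lemma collision_sub_left (hp : 0 ≤ p) {f f' g : ℝ → ℂ} (hf : Continuous f) (hf' : Continuous f')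
    (hg : Continuous g) (ξ : ℝ) :
    collision p (fun x => f x - f' x) g ξ = collision p f g ξ - collision p f' g ξ := by
  rw [collision, collision, collision,
    ← integral_sub (integrable_collision hp hf hg ξ) (integrable_collision hp hf' hg ξ)]
  simp only [sub_mul]

lemma collision_sub_right (hp : 0 ≤ p) {f g g' : ℝ → ℂ} (hf : Continuous f) (hg : Continuous g)
    (hg' : Continuous g') (ξ : ℝ) :
    collision p f (fun x => g x - g' x) ξ = collision p f g ξ - collision p f g' ξ := by
  rw [collision, collision, collision,
    ← integral_sub (integrable_collision hp hf hg ξ) (integrable_collision hp hf hg' ξ)]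
  simp only [mul_sub]

lemma collision_sum_left (hp : 0 ≤ p) {ι : Type*} (s : Finset ι) {c : ι → ℂ} {f : ι → ℝ → ℂ}
    {g : ℝ → ℂ} (hf : ∀ i, Continuous (f i)) (hg : Continuous g) (ξ : ℝ) :
    collision p (fun x => ∑ i ∈ s, c i * f i x) g ξ = ∑ i ∈ s, c i * collision p (f i) g ξ := by
  simp only [collision, Finset.sum_mul, mul_assoc]
  rw [integral_finsetSum _ fun i _ => (integrable_collision hp (hf i) hg ξ).const_mul _]
  simp only [integral_const_mul]

lemma collision_sum_right (hp : 0 ≤ p) {ι : Type*} (s : Finset ι) {c : ι → ℂ} {g : ι → ℝ → ℂ}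
    {f : ℝ → ℂ} (hf : Continuous f) (hg : ∀ i, Continuous (g i)) (ξ : ℝ) :
    collision p f (fun x => ∑ i ∈ s, c i * g i x) ξ = ∑ i ∈ s, c i * collision p f (g i) ξ := by
  simp only [collision, Finset.mul_sum, mul_left_comm _ (c _)]
  rw [integral_finsetSum _ fun i _ => (integrable_collision hp hf (hg i) ξ).const_mul _]
  simp only [integral_const_mul]

/-- The even part of a function. -/
def evenPart (f : ℝ → ℂ) (x : ℝ) : ℂ := (f x + f (-x)) / 2

lemma collision_evenPart_right (hp : 0 ≤ p) {f g : ℝ → ℂ} (hf : Continuous f)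
    (hg : Continuous g) : collision p f (evenPart g) = collision p f g := by
  ext ξ
  have h1 : ∫ θ, f (ξ * cFun p θ) * g (-(ξ * sFun p θ)) ∂angleLaw = collision p f g ξ := by
    simpa only [mul_neg, collision] using
      integral_angleLaw_cFun_neg_sFun p fun a b => f (ξ * a) * g (ξ * b)
  have e : ∀ θ, f (ξ * cFun p θ) * evenPart g (ξ * sFun p θ) =
      (f (ξ * cFun p θ) * g (ξ * sFun p θ) + f (ξ * cFun p θ) * g (-(ξ * sFun p θ))) / 2 :=
    fun θ => by rw [evenPart]; ring
  rw [collision]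
  simp only [e]
  rw [integral_div, integral_add (integrable_collision hp hf hg ξ)
    (integrable_collision hp hf (g := fun x => g (-x)) (by fun_prop) ξ), h1, collision]
  ring

lemma collision_evenPart_left (hp : 0 ≤ p) {f g : ℝ → ℂ} (hf : Continuous f)
    (hg : Continuous g) : collision p (evenPart f) g = collision p f g := by
  ext ξ
  have h1 : ∫ θ, f (-(ξ * cFun p θ)) * g (ξ * sFun p θ) ∂angleLaw = collision p f g ξ := by
    simpa only [mul_neg, collision] using
      integral_angleLaw_neg_cFun_sFun p fun a b => f (ξ * a) * g (ξ * b)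
  have e : ∀ θ, evenPart f (ξ * cFun p θ) * g (ξ * sFun p θ) =
      (f (ξ * cFun p θ) * g (ξ * sFun p θ) + f (-(ξ * cFun p θ)) * g (ξ * sFun p θ)) / 2 :=
    fun θ => by rw [evenPart]; ring
  rw [collision]
  simp only [e]
  rw [integral_div, integral_add (integrable_collision hp hf hg ξ)
    (integrable_collision hp (f := fun x => f (-x)) (by fun_prop) hg ξ), h1, collision]
  ring

lemma collision_neg (f g : ℝ → ℂ) (ξ : ℝ) : collision p f g (-ξ) = collision p f g ξ := by
  have h1 := integral_angleLaw_neg_cFun_sFun p fun a b => f (ξ * a) * g (ξ * b)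
  have h2 := integral_angleLaw_cFun_neg_sFun p fun a b => f (ξ * -a) * g (ξ * b)
  rw [collision, collision, ← h1, ← h2]
  simp only [neg_mul, mul_neg]

lemma evenPart_collision (f g : ℝ → ℂ) : evenPart (collision p f g) = collision p f g := by
  ext ξ
  rw [evenPart, collision_neg]
  ring

/-- The characteristic function of `∑ β_j X_j` for a given tree, when `f` is the characteristic
function of the `X_j`. -/
def treeCollision (p : ℝ) (f : ℝ → ℂ) : BinaryTree Unit → ℝ → ℂ
  | .nil => f
  | .node _ l r => collision p (treeCollision p f l) (treeCollision p f r)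

lemma norm_treeCollision_le {f : ℝ → ℂ} (hf : ∀ ξ, ‖f ξ‖ ≤ 1) (g : BinaryTree Unit) (ξ : ℝ) :
    ‖treeCollision p f g ξ‖ ≤ 1 := by
  induction g generalizing ξ with
  | nil => exact hf ξ
  | node _ l r hl hr => simpa [treeCollision] using norm_collision_le (p := p) hl hr ξ

lemma continuous_treeCollision (hp : 0 ≤ p) {f : ℝ → ℂ} (hfc : Continuous f)
    (hf : ∀ ξ, ‖f ξ‖ ≤ 1) (g : BinaryTree Unit) : Continuous (treeCollision p f g) := by
  induction g with
  | nil => exact hfc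
  | node _ l r hl hr =>
    exact continuous_collision hp hl hr (norm_treeCollision_le hf l) (norm_treeCollision_le hf r)

lemma continuous_evenPart {f : ℝ → ℂ} (hf : Continuous f) : Continuous (evenPart f) := by
  unfold evenPart
  fun_prop

lemma evenPart_treeCollision (hp : 0 ≤ p) {f : ℝ → ℂ} (hfc : Continuous f)
    (hf : ∀ ξ, ‖f ξ‖ ≤ 1) (g : BinaryTree Unit) :
    evenPart (treeCollision p f g) = treeCollision p (evenPart f) g := by
  induction g with
  | nil => rfl
  | node _ l r hl hr =>
    have cl := continuous_treeCollision hp hfc hf l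
    have cr := continuous_treeCollision hp hfc hf r
    rw [treeCollision, treeCollision, evenPart_collision, ← hl, ← hr,
      collision_evenPart_left hp cl (continuous_evenPart cr), collision_evenPart_right hp cl cr]

/-- The collision at the root already produces an even function, and taking even parts commutes with
the tree down to the leaves. -/
lemma treeCollision_node_evenPart (hp : 0 ≤ p) {f : ℝ → ℂ} (hfc : Continuous f)
    (hf : ∀ ξ, ‖f ξ‖ ≤ 1) {g : BinaryTree Unit} (hg : g ≠ .nil) :
    treeCollision p f g = treeCollision p (evenPart f) g := by
  rw [← evenPart_treeCollision hp hfc hf]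
  cases g with
  | nil => exact absurd rfl hg
  | node _ l r => rw [treeCollision, evenPart_collision]

lemma evenPart_charFun (μ : Measure ℝ) (ξ : ℝ) :
    evenPart (charFun μ) ξ = ((charFun μ ξ).re : ℂ) := by
  rw [evenPart, charFun_neg, Complex.add_conj]
  simp

/-! ### The Wild sum -/

lemma sum_treesOfNumNodesEq_succ {A : Type*} [AddCommMonoid A] (n : ℕ) (F : BinaryTree Unit → A) :
    ∑ g ∈ BinaryTree.treesOfNumNodesEq (n + 1), F g =
      ∑ ij ∈ Finset.HasAntidiagonal.antidiagonal n, ∑ l ∈ BinaryTree.treesOfNumNodesEq ij.1,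
        ∑ r ∈ BinaryTree.treesOfNumNodesEq ij.2, F (.node () l r) := by
  rw [BinaryTree.treesOfNumNodesEq_succ, Finset.sum_biUnion]
  · refine Finset.sum_congr rfl fun ij _ => ?_
    rw [Finset.sum_map, Finset.sum_product]
    rfl
  · simp_rw [Set.PairwiseDisjoint, Set.Pairwise, Finset.disjoint_left]
    aesop

lemma treeProb_nonneg (g : BinaryTree Unit) : 0 ≤ treeProb g := by
  induction g with
  | nil => simp [treeProb]
  | node _ l r hl hr =>
    have h1 : (1 : ℝ) ≤ l.numLeaves := by exact_mod_cast l.numLeaves_pos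
    have h2 : (1 : ℝ) ≤ r.numLeaves := by exact_mod_cast r.numLeaves_pos
    rw [treeProb]
    exact div_nonneg (mul_nonneg hl hr) (by linarith)

/-- Trees are indexed by internal nodes: n + 1 nodes mean n + 2 leaves, so the denominator (number
of leaves minus one) is n + 1, the number of ways to split n nodes between the subtrees. -/
lemma treeProb_node {n : ℕ} {ij : ℕ × ℕ} (h : ij ∈ Finset.HasAntidiagonal.antidiagonal n)
    {l r : BinaryTree Unit}
    (hl : l ∈ BinaryTree.treesOfNumNodesEq ij.1) (hr : r ∈ BinaryTree.treesOfNumNodesEq ij.2) :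
    treeProb (.node () l r) = (n + 1 : ℝ)⁻¹ * (treeProb l * treeProb r) := by
  rw [BinaryTree.mem_treesOfNumNodesEq] at hl hr
  rw [Finset.HasAntidiagonal.mem_antidiagonal] at h
  rw [treeProb, BinaryTree.numLeaves_eq_numNodes_succ, BinaryTree.numLeaves_eq_numNodes_succ, hl,
    hr, ← h]
  push_cast
  rw [div_eq_inv_mul]
  congr 2
  ring

lemma sum_treeProb (n : ℕ) : ∑ g ∈ BinaryTree.treesOfNumNodesEq n, treeProb g = 1 := by
  induction n using Nat.strong_induction_on with
  | _ n ih =>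
    cases n with
    | zero => simp [treeProb]
    | succ n =>
      rw [sum_treesOfNumNodesEq_succ]
      have : ∀ ij ∈ Finset.HasAntidiagonal.antidiagonal n, ∑ l ∈ BinaryTree.treesOfNumNodesEq ij.1,
          ∑ r ∈ BinaryTree.treesOfNumNodesEq ij.2, treeProb (.node () l r) = (n + 1 : ℝ)⁻¹ := by
        intro ij h
        rw [Finset.sum_congr rfl fun l hl => Finset.sum_congr rfl fun r hr => treeProb_node h hl hr]
        have hij := Finset.HasAntidiagonal.mem_antidiagonal.1 h
        simp only [← Finset.mul_sum]
        rw [ih ij.2 (by lia)]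
        simp only [mul_one]
        rw [ih ij.1 (by lia), mul_one]
      rw [Finset.sum_congr rfl this]
      simp
      field_simp

/-- The coefficients of the Wild sum. -/
def wild (p : ℝ) (f : ℝ → ℂ) (n : ℕ) (ξ : ℝ) : ℂ :=
  ∑ g ∈ BinaryTree.treesOfNumNodesEq n, (treeProb g : ℂ) * treeCollision p f g ξ

lemma wild_zero (f : ℝ → ℂ) : wild p f 0 = f := by
  ext ξ
  simp [wild, treeProb, treeCollision]

lemma norm_wild_le {f : ℝ → ℂ} (hf : ∀ ξ, ‖f ξ‖ ≤ 1) (n : ℕ) (ξ : ℝ) : ‖wild p f n ξ‖ ≤ 1 := by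
  rw [← sum_treeProb n]
  refine norm_sum_le_of_le _ fun g _ => ?_
  rw [norm_mul, Complex.norm_real, Real.norm_of_nonneg (treeProb_nonneg g)]
  exact mul_le_of_le_one_right (treeProb_nonneg g) (norm_treeCollision_le hf g ξ)

lemma continuous_wild (hp : 0 ≤ p) {f : ℝ → ℂ} (hfc : Continuous f) (hf : ∀ ξ, ‖f ξ‖ ≤ 1)
    (n : ℕ) : Continuous (wild p f n) :=
  continuous_finsetSum _ fun g _ => continuous_const.mul (continuous_treeCollision hp hfc hf g)

/-- Splitting at the root gives the recursion satisfied by the coefficients of a power series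
solution in 1 - e^{-t}. -/
lemma wild_succ (hp : 0 ≤ p) {f : ℝ → ℂ} (hfc : Continuous f) (hf : ∀ ξ, ‖f ξ‖ ≤ 1)
    (n : ℕ) (ξ : ℝ) : (n + 1 : ℂ) * wild p f (n + 1) ξ =
      ∑ ij ∈ Finset.HasAntidiagonal.antidiagonal n,
        collision p (wild p f ij.1) (wild p f ij.2) ξ := by
  rw [wild, sum_treesOfNumNodesEq_succ, Finset.mul_sum]
  refine Finset.sum_congr rfl fun ij h => ?_
  have hn : (n + 1 : ℂ) ≠ 0 := by exact_mod_cast n.succ_ne_zero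
  have e1 : collision p (wild p f ij.1) (wild p f ij.2) ξ =
      ∑ l ∈ BinaryTree.treesOfNumNodesEq ij.1, (treeProb l : ℂ) *
        collision p (treeCollision p f l) (wild p f ij.2) ξ :=
    collision_sum_left hp _ (fun l => continuous_treeCollision hp hfc hf l)
      (continuous_wild hp hfc hf _) ξ
  rw [e1, Finset.mul_sum]
  refine Finset.sum_congr rfl fun l hl => ?_
  have e2 : collision p (treeCollision p f l) (wild p f ij.2) ξ =
      ∑ r ∈ BinaryTree.treesOfNumNodesEq ij.2, (treeProb r : ℂ) *
        collision p (treeCollision p f l) (treeCollision p f r) ξ :=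
    collision_sum_right hp _ (continuous_treeCollision hp hfc hf l)
      (fun r => continuous_treeCollision hp hfc hf r) ξ
  rw [e2, Finset.mul_sum, Finset.mul_sum]
  refine Finset.sum_congr rfl fun r hr => ?_
  rw [treeProb_node h hl hr, treeCollision]
  push_cast
  field_simp

/-- Write S_N for the partial sums Σ_{n<N} z^n q_n and Q for the collision. As Q(f, f) is compared
with the terms of total degree below N, bilinearity gives Q(f - S_N, f) + Σ_{i<N} z^i Q(q_i, f -
S_{N-i}). Only remainders of order at most N occur, which is what the induction for the Wild sum
requires. -/
lemma collision_self_sub_eq (hp : 0 ≤ p) {f : ℝ → ℂ} {q : ℕ → ℝ → ℂ} (hf : Continuous f)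
    (hq : ∀ n, Continuous (q n)) (z : ℂ) (N : ℕ) (ξ : ℝ) :
    collision p f f ξ - ∑ m ∈ Finset.range N, z ^ m *
        ∑ ij ∈ Finset.HasAntidiagonal.antidiagonal m, collision p (q ij.1) (q ij.2) ξ =
      collision p (fun x => f x - ∑ n ∈ Finset.range N, z ^ n * q n x) f ξ +
      ∑ i ∈ Finset.range N, z ^ i *
        collision p (q i) (fun x => f x - ∑ n ∈ Finset.range (N - i), z ^ n * q n x) ξ := by
  have hS : ∀ N, Continuous fun x => ∑ n ∈ Finset.range N, z ^ n * q n x := fun N =>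
    continuous_finsetSum _ fun n _ => continuous_const.mul (hq n)
  rw [collision_sub_left hp hf (hS N) hf, collision_sum_left hp _ hq hf]
  have h1 : ∀ i, collision p (q i) (fun x => f x - ∑ n ∈ Finset.range (N - i), z ^ n * q n x) ξ =
      collision p (q i) f ξ - ∑ j ∈ Finset.range (N - i), z ^ j * collision p (q i) (q j) ξ := by
    intro i
    rw [collision_sub_right hp (hq i) hf (hS _), collision_sum_right hp _ (hq i) hq]
  simp only [h1, mul_sub, Finset.sum_sub_distrib]
  have h2 : ∑ m ∈ Finset.range N, z ^ m *
        ∑ ij ∈ Finset.HasAntidiagonal.antidiagonal m, collision p (q ij.1) (q ij.2) ξ =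
      ∑ i ∈ Finset.range N, z ^ i * ∑ j ∈ Finset.range (N - i), z ^ j *
        collision p (q i) (q j) ξ := by
    have := Finset.sum_range_diag_flip N fun i j => z ^ i * (z ^ j * collision p (q i) (q j) ξ)
    simp only [Finset.mul_sum]
    rw [← this]
    refine Finset.sum_congr rfl fun m _ => ?_
    rw [Finset.Nat.sum_antidiagonal_eq_sum_range_succ
      (fun i j => z ^ m * collision p (q i) (q j) ξ)]
    refine Finset.sum_congr rfl fun i hi => ?_
    rw [← mul_assoc, ← pow_add, Nat.add_sub_cancel' (by rw [Finset.mem_range] at hi; lia)]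
  rw [h2]
  ring

/-- The derivative is known for t > 0 only, so the mean value inequality is applied on [ε, t] and ε
→ 0, using continuity at 0. -/
lemma norm_le_of_norm_deriv_le {D D' : ℝ → ℂ} {B B' : ℝ → ℝ}
    (hD : ∀ t, 0 < t → HasDerivAt D (D' t) t) (hD0 : ContinuousWithinAt D (Ici 0) 0)
    (h0 : D 0 = 0) (hB : ∀ t, HasDerivAt B (B' t) t) (hB0 : B 0 = 0)
    (h : ∀ t, 0 < t → ‖D' t‖ ≤ B' t) {t : ℝ} (ht : 0 ≤ t) : ‖D t‖ ≤ B t := by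
  rcases ht.eq_or_lt with rfl | ht
  · simp [h0, hB0]
  have hε : ∀ ε ∈ Ioo 0 t, ‖D t‖ ≤ B t - B ε + ‖D ε‖ := by
    intro ε hε
    refine image_norm_le_of_norm_deriv_right_le_deriv_boundary (a := ε) (b := t) (f := D)
      (f' := D') (B := fun s => B s - B ε + ‖D ε‖) (B' := B')
      (fun s hs => (hD s (hε.1.trans_le hs.1)).continuousAt.continuousWithinAt)
      (fun s hs => (hD s (hε.1.trans_le hs.1)).hasDerivWithinAt) (by simp)
      (fun s => ((hB s).sub_const _).add_const _) (fun s hs => h s (hε.1.trans_le hs.1))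
      ⟨hε.2.le, le_rfl⟩
  have hlim : Tendsto (fun ε => B t - B ε + ‖D ε‖) (𝓝[>] 0) (𝓝 (B t)) := by
    have h1 : Tendsto D (𝓝[>] 0) (𝓝 0) := by
      have := hD0.tendsto.mono_left (nhdsWithin_mono 0 Ioi_subset_Ici_self)
      rwa [h0] at this
    have h2 : Tendsto B (𝓝[>] 0) (𝓝 0) := by
      have := (hB 0).continuousAt.tendsto.mono_left (nhdsWithin_le_nhds (s := Ioi 0))
      rwa [hB0] at this
    simpa using (tendsto_const_nhds.sub h2).add h1.norm
  refine ge_of_tendsto hlim ?_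
  filter_upwards [Ioo_mem_nhdsGT ht] with ε h using hε ε h

/-- The remainder of the Wild sum of a solution. -/
lemma norm_exp_mul_charFun_sub_le (hp : 0 ≤ p) {μ₀ : Measure ℝ} [IsProbabilityMeasure μ₀]
    {μ : ℝ → Measure ℝ} (hμ : IsSolution p μ₀ μ) (N : ℕ) {t : ℝ} (ht : 0 ≤ t) (ξ : ℝ) :
    ‖(Real.exp t : ℂ) * charFun (μ t) ξ -
      ∑ n ∈ Finset.range N, ((1 - Real.exp (-t) : ℝ) : ℂ) ^ n * wild p (charFun μ₀) n ξ‖ ≤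
      Real.exp t * (1 - Real.exp (-t)) ^ N := by
  have hfc : Continuous (charFun μ₀) := continuous_charFun
  have hf : ∀ ξ, ‖charFun μ₀ ξ‖ ≤ 1 := norm_charFun_le_one
  induction N using Nat.strong_induction_on generalizing t ξ with
  | _ N ih =>
  cases N with
  | zero =>
    have := hμ.isProbabilityMeasure t ht
    have h1 := norm_charFun_le_one (μ := μ t) ξ
    simp only [Finset.range_zero, Finset.sum_empty, sub_zero, norm_mul, Complex.norm_real,
      Real.norm_of_nonneg (Real.exp_pos t).le, pow_zero]
    gcongr
  | succ N =>
    set q := wild p (charFun μ₀) with hqdef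
    have hqc : ∀ n, Continuous (q n) := continuous_wild hp hfc hf
    have hz : ∀ t : ℝ, HasDerivAt (fun t : ℝ => 1 - Real.exp (-t)) (Real.exp (-t)) t := fun t => by
      simpa using ((hasDerivAt_neg t).exp).const_sub 1
    -- With z = 1 - e^{-t}, the equation gives (e^t φ)' = e^{-t} Q(e^t φ, e^t φ), and (z^n)' = n
    -- z^{n-1} e^{-t} matches the recursion of the q_n. The derivative of e^t z^{N+1} is z^N (e^t z
    -- + N + 1) = z^N (e^t + N), exactly what the induction hypothesis yields for the remainder.
    refine norm_le_of_norm_deriv_le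
      (D := fun t => (Real.exp t : ℂ) * charFun (μ t) ξ -
        ∑ n ∈ Finset.range (N + 1), ((1 - Real.exp (-t) : ℝ) : ℂ) ^ n * q n ξ)
      (D' := fun t => (Real.exp (-t) : ℂ) * (collision p (fun x => Real.exp t * charFun (μ t) x)
          (fun x => Real.exp t * charFun (μ t) x) ξ -
        ∑ m ∈ Finset.range N, ((1 - Real.exp (-t) : ℝ) : ℂ) ^ m *
          ∑ ij ∈ Finset.HasAntidiagonal.antidiagonal m, collision p (q ij.1) (q ij.2) ξ))
      (B := fun t => Real.exp t * (1 - Real.exp (-t)) ^ (N + 1))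
      (B' := fun t => (1 - Real.exp (-t)) ^ N * (Real.exp t + N)) ?_ ?_ ?_ ?_ ?_ ?_ ht
    · intro t ht
      have h1 := hμ.equation ξ t ht
      have e : ((1 / (2 * Real.pi) : ℝ) : ℂ) * (∫ θ in (0 : ℝ)..(2 * Real.pi),
          charFun (μ t) (ξ * sFun p θ) * charFun (μ t) (ξ * cFun p θ)) =
          collision p (charFun (μ t)) (charFun (μ t)) ξ := by
        rw [collision, integral_angleLaw, Complex.real_smul, one_div]
        simp only [mul_comm]
      rw [e] at h1
      have h2 := ((Real.hasDerivAt_exp t).ofReal_comp).mul h1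
      have h3 : HasDerivAt (fun t : ℝ => ∑ n ∈ Finset.range (N + 1),
          ((1 - Real.exp (-t) : ℝ) : ℂ) ^ n * q n ξ)
          (∑ n ∈ Finset.range (N + 1), ((n : ℂ) * ((1 - Real.exp (-t) : ℝ) : ℂ) ^ (n - 1) *
            (Real.exp (-t) : ℂ)) * q n ξ) t :=
        HasDerivAt.fun_sum fun n _ => (((hz t).ofReal_comp).pow n).mul_const _
      refine (h2.sub h3).congr_deriv (Eq.symm ?_)
      have e1 : collision p (fun x => Real.exp t * charFun (μ t) x)
          (fun x => Real.exp t * charFun (μ t) x) ξ =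
          (Real.exp t : ℂ) * (Real.exp t * collision p (charFun (μ t)) (charFun (μ t)) ξ) := by
        simp only [collision, ← integral_const_mul]
        congr 1
        ext θ
        ring
      have e2 : (Real.exp (-t) : ℂ) * Real.exp t = 1 := by
        rw [← Complex.ofReal_mul, ← Real.exp_add]
        simp
      rw [mul_sub, e1, ← mul_assoc _ (Real.exp t : ℂ), e2, one_mul, Finset.sum_range_succ']
      have hw : ∀ m : ℕ, ∑ ij ∈ Finset.HasAntidiagonal.antidiagonal m,
          collision p (q ij.1) (q ij.2) ξ = (m + 1 : ℂ) * q (m + 1) ξ :=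
        fun m => (wild_succ hp hfc hf m ξ).symm
      simp only [hw, Nat.cast_zero, zero_mul, add_zero, Finset.mul_sum, Nat.add_sub_cancel]
      congr 1
      · ring
      · refine Finset.sum_congr rfl fun m _ => ?_
        push_cast
        ring
    · refine ContinuousWithinAt.sub ?_ ?_
      · exact (Continuous.continuousWithinAt (by fun_prop)).mul (hμ.continuous_zero ξ)
      · exact Continuous.continuousWithinAt (by fun_prop)
    · simp only [Finset.sum_range_succ', neg_zero, Real.exp_zero, sub_self, Complex.ofReal_zero,
        hμ.initial, hqdef, wild_zero]
      simp
    · intro t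
      refine ((Real.hasDerivAt_exp t).mul ((hz t).pow (N + 1))).congr_deriv (Eq.symm ?_)
      have e2 : Real.exp t * Real.exp (-t) = 1 := by
        rw [← Real.exp_add]
        simp
      simp only [Nat.add_sub_cancel, Pi.pow_apply, pow_succ]
      push_cast
      linear_combination (-(1 - Real.exp (-t)) ^ N * N) * e2
    · simp
    · intro t ht
      have hpr := hμ.isProbabilityMeasure t ht.le
      have hφc : Continuous (fun x => (Real.exp t : ℂ) * charFun (μ t) x) :=
        continuous_const.mul continuous_charFun
      have hz0 : 0 ≤ 1 - Real.exp (-t) := by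
        rw [sub_nonneg]
        exact Real.exp_le_one_iff.2 (by linarith)
      have hφ : ∀ x, ‖(Real.exp t : ℂ) * charFun (μ t) x‖ ≤ Real.exp t := fun x => by
        rw [norm_mul, Complex.norm_real, Real.norm_of_nonneg (Real.exp_pos t).le]
        exact mul_le_of_le_one_right (Real.exp_pos t).le (norm_charFun_le_one x)
      rw [collision_self_sub_eq hp hφc hqc, norm_mul, Complex.norm_real,
        Real.norm_of_nonneg (Real.exp_pos _).le]
      -- The first term uses the remainder of order N. In the i-th summand the factor z^i completes
      -- the remainder of order N - i to z^N, so each contributes at most e^t z^N.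
      have b1 := norm_collision_le (p := p) (fun x => ih N N.lt_succ_self ht.le x) hφ ξ
      have b2 : ∀ i ∈ Finset.range N, ‖((1 - Real.exp (-t) : ℝ) : ℂ) ^ i *
          collision p (q i) (fun x => (Real.exp t : ℂ) * charFun (μ t) x -
            ∑ n ∈ Finset.range (N - i), ((1 - Real.exp (-t) : ℝ) : ℂ) ^ n * q n x) ξ‖ ≤
          Real.exp t * (1 - Real.exp (-t)) ^ N := by
        intro i hi
        rw [Finset.mem_range] at hi
        have b3 := norm_collision_le (p := p) (fun x => norm_wild_le (p := p) hf i x)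
          (fun x => ih (N - i) (by lia) ht.le x) ξ
        rw [norm_mul, norm_pow, Complex.norm_real, Real.norm_of_nonneg hz0]
        calc _ ≤ (1 - Real.exp (-t)) ^ i * (1 * (Real.exp t * (1 - Real.exp (-t)) ^ (N - i))) := by
              gcongr
          _ = Real.exp t * ((1 - Real.exp (-t)) ^ i * (1 - Real.exp (-t)) ^ (N - i)) := by ring
          _ = _ := by rw [← pow_add, Nat.add_sub_cancel' hi.le]
      have b4 := norm_sum_le_of_le _ b2
      rw [Finset.sum_const, Finset.card_range, nsmul_eq_mul] at b4
      have e2 : Real.exp (-t) * Real.exp t = 1 := by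
        rw [← Real.exp_add]
        simp
      calc _ ≤ Real.exp (-t) * (Real.exp t * (1 - Real.exp (-t)) ^ N * Real.exp t +
            N * (Real.exp t * (1 - Real.exp (-t)) ^ N)) := by
            gcongr
            exact (norm_add_le _ _).trans (add_le_add b1 b4)
        _ = _ := by
          linear_combination ((1 - Real.exp (-t)) ^ N * (Real.exp t + N)) * e2

/-! ### Independence of the angles -/

/-- The law of an i.i.d. sequence of uniform angles. -/
abbrev anglesLaw : Measure (ℕ → ℝ) := Measure.infinitePi (fun _ : ℕ => angleLaw)

open Classical in
/-- The sequence which agrees with `a` on `A` and with `b` off `A`. -/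
def splice (A : Set ℕ) (q : (ℕ → ℝ) × (ℕ → ℝ)) (i : ℕ) : ℝ := if i ∈ A then q.1 i else q.2 i

lemma measurable_splice (A : Set ℕ) : Measurable (splice A) := by
  refine measurable_pi_lambda _ fun i => ?_
  by_cases h : i ∈ A
  · simp only [splice, h, if_true]
    fun_prop
  · simp only [splice, h, if_false]
    fun_prop

/-- Two independent sequences spliced along A again form an i.i.d. sequence. This expresses
independence of the angles in A from the others and replaces explicit product decompositions of the
sequence space. -/
lemma map_splice (A : Set ℕ) : (anglesLaw.prod anglesLaw).map (splice A) = anglesLaw := by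
  classical
  refine Measure.eq_infinitePi _ fun s t ht => ?_
  rw [Measure.map_apply (measurable_splice A)
    (MeasurableSet.pi s.countable_toSet fun i _ => ht i)]
  have : splice A ⁻¹' (Set.pi s t) =
      (Set.pi ((s.filter (· ∈ A) : Finset ℕ) : Set ℕ) t) ×ˢ
        (Set.pi ((s.filter (¬ · ∈ A) : Finset ℕ) : Set ℕ) t) := by
    ext q
    simp only [mem_preimage, Set.mem_pi, mem_prod, Finset.mem_coe, Finset.mem_filter]
    constructor
    · intro h
      refine ⟨fun i hi => ?_, fun i hi => ?_⟩
      · simpa [splice, hi.2] using h i hi.1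
      · simpa [splice, hi.2] using h i hi.1
    · rintro ⟨h1, h2⟩ i hi
      by_cases hA : i ∈ A
      · simpa [splice, hA] using h1 i ⟨hi, hA⟩
      · simpa [splice, hA] using h2 i ⟨hi, hA⟩
  rw [this, Measure.prod_prod, Measure.infinitePi_pi _ fun i _ => ht i,
    Measure.infinitePi_pi _ fun i _ => ht i, Finset.prod_filter_mul_prod_filter_not]

lemma integral_anglesLaw_eq_splice {E : Type*} [NormedAddCommGroup E] [NormedSpace ℝ E]
    (A : Set ℕ) {F : (ℕ → ℝ) → E} (hF : StronglyMeasurable F) :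
    ∫ θ, F θ ∂anglesLaw = ∫ q, F (splice A q) ∂(anglesLaw.prod anglesLaw) := by
  conv_lhs => rw [← map_splice A]
  exact integral_map (measurable_splice A).aemeasurable hF.aestronglyMeasurable

lemma integral_mul_anglesLaw (m : ℕ) {F F' : (ℕ → ℝ) → ℂ} (hF : StronglyMeasurable F)
    (hF' : StronglyMeasurable F') (h : ∀ θ θ' : ℕ → ℝ, (∀ i < m, θ i = θ' i) → F θ = F θ')
    (h' : ∀ θ θ' : ℕ → ℝ, (∀ i, m ≤ i → θ i = θ' i) → F' θ = F' θ') :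
    ∫ θ, F θ * F' θ ∂anglesLaw = (∫ θ, F θ ∂anglesLaw) * ∫ θ, F' θ ∂anglesLaw := by
  rw [integral_anglesLaw_eq_splice (Iio m) (F := fun θ => F θ * F' θ) (hF.mul hF'),
    ← integral_prod_mul]
  congr 1
  ext q
  rw [h (splice (Iio m) q) q.1 fun i hi => by simp [splice, hi],
    h' (splice (Iio m) q) q.2 fun i hi => by simp [splice, hi]]

/-- The k-th angle is integrated separately; the hypothesis on H says that it enters only through
the first argument. -/
lemma integral_eval_anglesLaw {E : Type*} [NormedAddCommGroup E] [NormedSpace ℝ E] (k : ℕ)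
    {H : ℝ × (ℕ → ℝ) → E} (hH : StronglyMeasurable H) {C : ℝ} (hC : ∀ q, ‖H q‖ ≤ C)
    (h : ∀ x, ∀ θ θ' : ℕ → ℝ, (∀ i, i ≠ k → θ i = θ' i) → H (x, θ) = H (x, θ')) :
    ∫ θ, H (θ k, θ) ∂anglesLaw = ∫ x, ∫ θ, H (x, θ) ∂anglesLaw ∂angleLaw := by
  have hF : StronglyMeasurable fun θ : ℕ → ℝ => H (θ k, θ) :=
    hH.comp_measurable ((measurable_pi_apply k).prodMk measurable_id)
  rw [integral_anglesLaw_eq_splice {k} hF]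
  have e : ∀ q : (ℕ → ℝ) × (ℕ → ℝ), H (splice {k} q k, splice {k} q) = H (q.1 k, q.2) := by
    intro q
    have : splice {k} q k = q.1 k := by simp [splice]
    rw [this]
    exact h _ _ _ fun i hi => by simp [splice, hi]
  simp only [e]
  have hm : Measurable fun q : (ℕ → ℝ) × (ℕ → ℝ) => (q.1 k, q.2) := by fun_prop
  rw [integral_prod (fun q : (ℕ → ℝ) × (ℕ → ℝ) => H (q.1 k, q.2))
    (Integrable.of_bound (hH.comp_measurable hm).aestronglyMeasurable C
      (ae_of_all _ fun q => hC _))]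
  have hmap : anglesLaw.map (fun θ => θ k) = angleLaw := Measure.infinitePi_map_eval _ k
  have := integral_map (μ := anglesLaw) (φ := fun θ : ℕ → ℝ => θ k)
    (f := fun x => ∫ θ, H (x, θ) ∂anglesLaw) (measurable_pi_apply k).aemeasurable
    hH.integral_prod_right'.aestronglyMeasurable
  rw [hmap] at this
  exact this.symm

/-! ### The weights of the leaves -/

/-- Preorder numbering gives each subtree a block of consecutive angles, so the root angle and the
two subtrees use disjoint sets of angles. -/
lemma leafWeights_congr {θ θ' : ℕ → ℝ} (g : BinaryTree Unit) (k : ℕ)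
    (h : ∀ i, k ≤ i → i < k + g.numNodes → θ i = θ' i) :
    leafWeights p θ k g = leafWeights p θ' k g := by
  induction g generalizing k with
  | nil => rfl
  | node _ l r hl hr =>
    simp only [BinaryTree.numNodes] at h
    rw [leafWeights, leafWeights, h k le_rfl (by lia),
      hl (k + 1) fun i h1 h2 => h i (by lia) (by lia),
      hr (k + 1 + l.numNodes) fun i h1 h2 => h i (by lia) (by lia)]

lemma sum_leafWeights (hp : 0 < p) (θ : ℕ → ℝ) (k : ℕ) (g : BinaryTree Unit) :
    ((leafWeights p θ k g).map fun b => |b| ^ (2 / (1 + p))).sum = 1 := by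
  induction g generalizing k with
  | nil => simp [leafWeights]
  | node _ l r hl hr =>
    rw [leafWeights, List.map_append, List.sum_append, List.map_map, List.map_map]
    simp only [Function.comp_def]
    rw [sum_map_abs_mul_rpow, sum_map_abs_mul_rpow, hl, hr, abs_cFun_rpow hp, abs_sFun_rpow hp,
      mul_one, mul_one, Real.cos_sq_add_sin_sq]

/-- The product of `f (ξ β)` over the weights `β` of the leaves. -/
def leafProd (p : ℝ) (f : ℝ → ℂ) (k : ℕ) (g : BinaryTree Unit) (q : ℝ × (ℕ → ℝ)) : ℂ :=
  ((leafWeights p q.2 k g).map fun b => f (q.1 * b)).prod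

lemma leafProd_node (f : ℝ → ℂ) (k : ℕ) (l r : BinaryTree Unit) (ξ : ℝ) (θ : ℕ → ℝ) :
    leafProd p f k (.node () l r) (ξ, θ) =
      leafProd p f (k + 1) l (ξ * cFun p (θ k), θ) *
        leafProd p f (k + 1 + l.numNodes) r (ξ * sFun p (θ k), θ) := by
  simp only [leafProd, leafWeights, List.map_append, List.prod_append, List.map_map,
    Function.comp_def, mul_assoc]

lemma measurable_leafProd (hp : 0 ≤ p) {f : ℝ → ℂ} (hf : Measurable f) (k : ℕ)
    (g : BinaryTree Unit) : Measurable (leafProd p f k g) := by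
  induction g generalizing k with
  | nil =>
    have e : leafProd p f k .nil = fun q => f q.1 := by
      ext q
      simp [leafProd, leafWeights]
    rw [e]
    fun_prop
  | node _ l r hl hr =>
    have h1 := (continuous_cFun hp).measurable
    have h2 := (continuous_sFun hp).measurable
    have e : leafProd p f k (.node () l r) = fun q =>
        leafProd p f (k + 1) l (q.1 * cFun p (q.2 k), q.2) *
        leafProd p f (k + 1 + l.numNodes) r (q.1 * sFun p (q.2 k), q.2) := by
      ext q
      exact leafProd_node f k l r q.1 q.2
    rw [e]
    exact ((hl (k + 1)).comp (by fun_prop)).mul ((hr (k + 1 + l.numNodes)).comp (by fun_prop))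

lemma norm_leafProd_le {f : ℝ → ℂ} (hf : ∀ ξ, ‖f ξ‖ ≤ 1) (k : ℕ) (g : BinaryTree Unit)
    (q : ℝ × (ℕ → ℝ)) : ‖leafProd p f k g q‖ ≤ 1 := by
  rw [leafProd]
  induction leafWeights p q.2 k g with
  | nil => simp
  | cons b L ih =>
    rw [List.map_cons, List.prod_cons, norm_mul]
    exact mul_le_one₀ (hf _) (norm_nonneg _) ih

lemma leafProd_congr {f : ℝ → ℂ} {θ θ' : ℕ → ℝ} (g : BinaryTree Unit) (k : ℕ) (ξ : ℝ)
    (h : ∀ i, k ≤ i → i < k + g.numNodes → θ i = θ' i) :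
    leafProd p f k g (ξ, θ) = leafProd p f k g (ξ, θ') := by
  simp only [leafProd, leafWeights_congr g k h]

/-- With the root angle fixed, the products over the two subtrees depend on angles before and from
index k + 1 + `l.numNodes`, respectively, so their expectations multiply; averaging over the root
angle is a collision. -/
lemma integral_leafProd (hp : 0 ≤ p) {f : ℝ → ℂ} (hfm : Measurable f) (hf : ∀ ξ, ‖f ξ‖ ≤ 1)
    (g : BinaryTree Unit) (k : ℕ) (ξ : ℝ) :
    ∫ θ, leafProd p f k g (ξ, θ) ∂anglesLaw = treeCollision p f g ξ := by
  induction g generalizing k ξ with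
  | nil => simp [leafProd, leafWeights, treeCollision]
  | node _ l r hl hr =>
    have h1 := (continuous_cFun hp).measurable
    have h2 := (continuous_sFun hp).measurable
    have ml := measurable_leafProd hp hfm (k + 1) l
    have mr := measurable_leafProd hp hfm (k + 1 + l.numNodes) r
    have key := integral_eval_anglesLaw k
      (H := fun q => leafProd p f (k + 1) l (ξ * cFun p q.1, q.2) *
        leafProd p f (k + 1 + l.numNodes) r (ξ * sFun p q.1, q.2)) (C := 1)
      (((ml.comp (by fun_prop)).mul (mr.comp (by fun_prop))).stronglyMeasurable)
      (fun q => by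
        rw [norm_mul]
        exact mul_le_one₀ (norm_leafProd_le hf _ _ _) (norm_nonneg _) (norm_leafProd_le hf _ _ _))
      (fun x θ θ' h => by
        simp only
        rw [leafProd_congr l (k + 1) _ fun i hi _ => h i (by lia),
          leafProd_congr r (k + 1 + l.numNodes) _ fun i hi _ => h i (by lia)])
    have e : ∀ θ, leafProd p f k (.node () l r) (ξ, θ) =
      leafProd p f (k + 1) l (ξ * cFun p (θ k), θ) *
        leafProd p f (k + 1 + l.numNodes) r (ξ * sFun p (θ k), θ) :=
      fun θ => leafProd_node f k l r ξ θ
    simp only [e]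
    refine key.trans ?_
    rw [treeCollision, collision]
    congr 1
    ext x
    rw [integral_mul_anglesLaw (k + 1 + l.numNodes)
      (F := fun θ => leafProd p f (k + 1) l (ξ * cFun p x, θ))
      (F' := fun θ => leafProd p f (k + 1 + l.numNodes) r (ξ * sFun p x, θ))
      (ml.comp (by fun_prop)).stronglyMeasurable (mr.comp (by fun_prop)).stronglyMeasurable
      (fun θ θ' h => leafProd_congr l (k + 1) _ fun i _ hi => h i hi)
      (fun θ θ' h => leafProd_congr r _ _ fun i hi _ => h i hi), hl, hr]

/-- The sum of the squares of `|β| ^ α` over the weights `β` of the leaves. -/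
def leafSqSum (p : ℝ) (k : ℕ) (g : BinaryTree Unit) (θ : ℕ → ℝ) : ℝ :=
  ((leafWeights p θ k g).map fun b => (|b| ^ (2 / (1 + p))) ^ 2).sum

lemma leafSqSum_node (hp : 0 < p) (k : ℕ) (l r : BinaryTree Unit) (θ : ℕ → ℝ) :
    leafSqSum p k (.node () l r) θ =
      (Real.cos (θ k) ^ 2) ^ 2 * leafSqSum p (k + 1) l θ +
        (Real.sin (θ k) ^ 2) ^ 2 * leafSqSum p (k + 1 + l.numNodes) r θ := by
  simp only [leafSqSum, leafWeights, List.map_append, List.sum_append, List.map_map,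
    Function.comp_def, abs_mul, Real.mul_rpow (abs_nonneg _) (abs_nonneg _), mul_pow,
    List.sum_map_mul_left, abs_cFun_rpow hp, abs_sFun_rpow hp]

lemma measurable_leafSqSum (hp : 0 < p) (k : ℕ) (g : BinaryTree Unit) :
    Measurable (leafSqSum p k g) := by
  induction g generalizing k with
  | nil =>
    have e : leafSqSum p k .nil = fun _ => 1 := by
      ext q
      simp [leafSqSum, leafWeights]
    rw [e]
    fun_prop
  | node _ l r hl hr =>
    have h1 := hl (k + 1)
    have h2 := hr (k + 1 + l.numNodes)
    rw [funext (leafSqSum_node hp k l r)]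
    fun_prop

lemma leafSqSum_nonneg (k : ℕ) (g : BinaryTree Unit) (θ : ℕ → ℝ) : 0 ≤ leafSqSum p k g θ :=
  List.sum_nonneg (by simp only [List.mem_map]; rintro _ ⟨y, -, rfl⟩; positivity)

lemma leafSqSum_le_one (hp : 0 < p) (k : ℕ) (g : BinaryTree Unit) (θ : ℕ → ℝ) :
    leafSqSum p k g θ ≤ 1 := by
  induction g generalizing k with
  | nil => simp [leafSqSum, leafWeights]
  | node _ l r hl hr =>
    rw [leafSqSum_node hp]
    have h1 := hl (k + 1)
    have h2 := hr (k + 1 + l.numNodes)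
    have h3 := Real.cos_sq_add_sin_sq (θ k)
    have h4 := sq_nonneg (Real.cos (θ k))
    have h5 := sq_nonneg (Real.sin (θ k))
    calc _ ≤ (Real.cos (θ k) ^ 2) ^ 2 * 1 + (Real.sin (θ k) ^ 2) ^ 2 * 1 := by gcongr
      _ ≤ _ := by nlinarith

/-- The expectation of `leafSqSum`. -/
def treeSq : BinaryTree Unit → ℝ
  | .nil => 1
  | .node _ l r => 3 / 8 * (treeSq l + treeSq r)

lemma integral_leafSqSum (hp : 0 < p) (g : BinaryTree Unit) (k : ℕ) :
    ∫ θ, leafSqSum p k g θ ∂anglesLaw = treeSq g := by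
  induction g generalizing k with
  | nil => simp [leafSqSum, leafWeights, treeSq]
  | node _ l r hl hr =>
    -- Angles attached below the root have index larger than k, so a function of the root angle
    -- factors out; with fourth powers of cos and sin each subtree gets the factor 3/8.
    have hprod : ∀ (u : ℝ → ℝ), Continuous u → (∀ x, |u x| ≤ 1) → ∀ (g : BinaryTree Unit) (j : ℕ),
        k < j → ∫ θ, u (θ k) * leafSqSum p j g θ ∂anglesLaw =
          (∫ x, u x ∂angleLaw) * ∫ θ, leafSqSum p j g θ ∂anglesLaw := by
      intro u hu hu1 g j hj
      have mg := measurable_leafSqSum hp j g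
      have key := integral_eval_anglesLaw k (H := fun q => u q.1 * leafSqSum p j g q.2) (C := 1)
        (Measurable.stronglyMeasurable (by fun_prop)) (fun q => by
          rw [norm_mul, Real.norm_eq_abs, Real.norm_of_nonneg (leafSqSum_nonneg _ _ _)]
          exact mul_le_one₀ (hu1 _) (leafSqSum_nonneg _ _ _) (leafSqSum_le_one hp _ _ _))
        (fun x θ θ' h => by
          simp only [leafSqSum]
          rw [leafWeights_congr g j fun i hi _ => h i (by lia)])
      refine key.trans ?_
      simp only [integral_const_mul, integral_mul_const]
    have hint : ∀ (u : ℝ → ℝ), Continuous u → (∀ x, |u x| ≤ 1) → ∀ (g : BinaryTree Unit) (j : ℕ),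
        Integrable (fun θ : ℕ → ℝ => u (θ k) * leafSqSum p j g θ) anglesLaw := by
      intro u hu hu1 g j
      have mg := measurable_leafSqSum hp j g
      refine Integrable.of_bound (Measurable.aestronglyMeasurable (by fun_prop)) 1
        (ae_of_all _ fun θ => ?_)
      rw [norm_mul, Real.norm_eq_abs, Real.norm_of_nonneg (leafSqSum_nonneg _ _ _)]
      exact mul_le_one₀ (hu1 _) (leafSqSum_nonneg _ _ _) (leafSqSum_le_one hp _ _ _)
    have hc : ∀ x : ℝ, |(Real.cos x ^ 2) ^ 2| ≤ 1 := fun x => by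
      rw [abs_of_nonneg (by positivity)]
      exact pow_le_one₀ (by positivity) (Real.cos_sq_le_one x)
    have hs : ∀ x : ℝ, |(Real.sin x ^ 2) ^ 2| ≤ 1 := fun x => by
      rw [abs_of_nonneg (by positivity)]
      exact pow_le_one₀ (by positivity) (Real.sin_sq_le_one x)
    have e := leafSqSum_node hp k l r
    simp only [e]
    rw [integral_add (hint (fun x => (Real.cos x ^ 2) ^ 2) (by fun_prop) hc l _)
      (hint (fun x => (Real.sin x ^ 2) ^ 2) (by fun_prop) hs r _),
      hprod (fun x => (Real.cos x ^ 2) ^ 2) (by fun_prop) hc l _ (by lia),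
      hprod (fun x => (Real.sin x ^ 2) ^ 2) (by fun_prop) hs r _ (by lia), hl, hr,
      integral_angleLaw_cos_pow_four, integral_angleLaw_sin_pow_four, treeSq]
    ring

/-! ### Expectations on McKean's probability space -/

instance : Countable (BinaryTree Unit) := by
  have : (univ : Set (BinaryTree Unit)) =
      ⋃ n, ((BinaryTree.treesOfNumNodesEq n : Finset (BinaryTree Unit)) : Set _) := by
    ext g
    simp
  rw [← countable_univ_iff, this]
  exact countable_iUnion fun n => Finset.countable_toSet _

instance : MeasurableSingletonClass (BinaryTree Unit) := ⟨fun _ => trivial⟩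

/-- The weight of a tree under `P_t`. -/
def treeWeight (t : ℝ) (g : BinaryTree Unit) : ℝ :=
  Real.exp (-t) * (1 - Real.exp (-t)) ^ (g.numLeaves - 1) * treeProb g

lemma lintegral_mckeanMeasure (μ₀ : Measure ℝ) [IsProbabilityMeasure μ₀] (t : ℝ)
    {H : BinaryTree Unit → (ℕ → ℝ) → ℝ≥0∞} (hH : ∀ g, Measurable (H g)) :
    ∫⁻ ω, H ω.2.1 ω.2.2.1 ∂(mckeanMeasure μ₀ t) =
      ∑' g, ENNReal.ofReal (treeWeight t g) * ∫⁻ θ, H g θ ∂anglesLaw := by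
  have hm : Measurable fun q : BinaryTree Unit × (ℕ → ℝ) => H q.1 q.2 :=
    measurable_from_prod_countable_right hH
  have hm1 : Measurable fun q : BinaryTree Unit × (ℕ → ℝ) × (ℕ → ℝ) => H q.1 q.2.1 :=
    hm.comp (measurable_fst.prodMk (measurable_fst.comp measurable_snd))
  have hm2 : Measurable fun q : McKeanSpace => H q.2.1 q.2.2.1 := hm1.comp measurable_snd
  rw [mckeanMeasure, lintegral_sum_measure]
  refine tsum_congr fun g => ?_
  rw [lintegral_smul_measure, lintegral_prod _ hm2.aemeasurable, lintegral_dirac,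
    lintegral_prod _ hm1.aemeasurable, lintegral_dirac]
  have h : ∫⁻ y, H g y.1 ∂(anglesLaw.prod (Measure.infinitePi fun _ : ℕ => μ₀)) =
      ∫⁻ θ, H g θ ∂anglesLaw := by
    rw [lintegral_prod (fun y => H g y.1) ((hH g).comp measurable_fst).aemeasurable]
    simp
  rw [smul_eq_mul, ← h]
  rfl

/-- Trees are grouped by the number n = ν - 1 of internal nodes, so the geometric weight has
exponent n. -/
lemma tsum_treeWeight_mul (t : ℝ) (ht : 0 ≤ t) (F : BinaryTree Unit → ℝ≥0∞) :
    ∑' g, ENNReal.ofReal (treeWeight t g) * F g =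
      ∑' n : ℕ, ENNReal.ofReal (Real.exp (-t) * (1 - Real.exp (-t)) ^ n) *
        ∑ g ∈ BinaryTree.treesOfNumNodesEq n, ENNReal.ofReal (treeProb g) * F g := by
  have hz0 : 0 ≤ 1 - Real.exp (-t) := by
    rw [sub_nonneg]
    exact Real.exp_le_one_iff.2 (by linarith)
  rw [← ENNReal.tsum_fiberwise _ BinaryTree.numNodes]
  refine tsum_congr fun n => ?_
  have e : (BinaryTree.numNodes ⁻¹' {n} : Set (BinaryTree Unit)) =
      ((BinaryTree.treesOfNumNodesEq n : Finset (BinaryTree Unit)) : Set _) := by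
    ext g
    simp
  rw [e, Finset.tsum_subtype' (BinaryTree.treesOfNumNodesEq n)
    (fun g => ENNReal.ofReal (treeWeight t g) * F g), Finset.mul_sum]
  refine Finset.sum_congr rfl fun g hg => ?_
  rw [BinaryTree.mem_treesOfNumNodesEq] at hg
  rw [treeWeight, BinaryTree.numLeaves_eq_numNodes_succ, hg, Nat.add_sub_cancel,
    ENNReal.ofReal_mul (by positivity), mul_assoc]

lemma measurable_listMax_leafWeights (hp : 0 ≤ p) (k : ℕ) (g : BinaryTree Unit) :
    Measurable fun θ => listMax (leafWeights p θ k g) := by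
  induction g generalizing k with
  | nil => simp [leafWeights]
  | node _ l r hl hr =>
    simp only [leafWeights, listMax_append, listMax_map_mul]
    have h1 := (continuous_cFun hp).measurable
    have h2 := (continuous_sFun hp).measurable
    have h3 := hl (k + 1)
    have h4 := hr (k + 1 + l.numNodes)
    have h5 : Measurable fun θ : ℕ → ℝ => |cFun p (θ k)| :=
      (h1.comp (measurable_pi_apply k)).abs
    have h6 : Measurable fun θ : ℕ → ℝ => |sFun p (θ k)| :=
      (h2.comp (measurable_pi_apply k)).abs
    exact (h5.mul h3).max (h6.mul h4)

lemma betaMax_eq (ω : McKeanSpace) : betaMax p ω = listMax (leafWeights p ω.2.2.1 0 ω.2.1) := rfl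

lemma measurable_betaMax (hp : 0 ≤ p) : Measurable (betaMax p) := by
  have h : Measurable fun q : BinaryTree Unit × (ℕ → ℝ) => listMax (leafWeights p q.2 0 q.1) :=
    measurable_from_prod_countable_right fun g => measurable_listMax_leafWeights hp 0 g
  exact h.comp (g := fun q : BinaryTree Unit × (ℕ → ℝ) => listMax (leafWeights p q.2 0 q.1))
    (f := fun ω : McKeanSpace => (ω.2.1, ω.2.2.1)) (by fun_prop)

lemma betaMax_pos (hp : 0 < p) (ω : McKeanSpace) : 0 < betaMax p ω :=
  listMax_pos (show 0 < 2 / (1 + p) by positivity) (sum_leafWeights hp _ _ _)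

lemma betaMax_le_one (hp : 0 < p) (ω : McKeanSpace) : betaMax p ω ≤ 1 :=
  listMax_le_one (show 0 < 2 / (1 + p) by positivity) (sum_leafWeights hp _ _ _)

lemma tsum_ofReal_exp_mul_pow {t : ℝ} (ht : 0 ≤ t) :
    ∑' n : ℕ, ENNReal.ofReal (Real.exp (-t) * (1 - Real.exp (-t)) ^ n) = 1 := by
  have hz0 : 0 ≤ 1 - Real.exp (-t) := by
    rw [sub_nonneg]
    exact Real.exp_le_one_iff.2 (by linarith)
  have hz1 : 1 - Real.exp (-t) < 1 := by linarith [Real.exp_pos (-t)]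
  have hs := (hasSum_geometric_of_lt_one hz0 hz1).mul_left (Real.exp (-t))
  rw [← ENNReal.ofReal_tsum_of_nonneg (fun n => by positivity) hs.summable, hs.tsum_eq,
    sub_sub_cancel, mul_inv_cancel₀ (Real.exp_pos _).ne', ENNReal.ofReal_one]

lemma mckeanMeasure_univ (μ₀ : Measure ℝ) [IsProbabilityMeasure μ₀] {t : ℝ} (ht : 0 ≤ t) :
    mckeanMeasure μ₀ t univ = 1 := by
  have h := lintegral_mckeanMeasure μ₀ t (H := fun _ _ => 1) (fun _ => measurable_const)
  rw [lintegral_one] at h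
  rw [h, tsum_treeWeight_mul t ht]
  refine Eq.trans ?_ (tsum_ofReal_exp_mul_pow ht)
  refine tsum_congr fun n => ?_
  simp only [lintegral_one, measure_univ, mul_one]
  rw [← ENNReal.ofReal_sum_of_nonneg fun g _ => treeProb_nonneg g, sum_treeProb,
    ENNReal.ofReal_one, mul_one]

/-! ### The bound -/

lemma treeCollision_sub_le (hp : 0 ≤ p) {μ₀ : Measure ℝ} [IsProbabilityMeasure μ₀]
    (g : BinaryTree Unit) (ξ e : ℝ) :
    ENNReal.ofReal ‖treeCollision p (evenPart (charFun μ₀)) g ξ - (e : ℂ)‖ ≤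
      ∫⁻ θ, ENNReal.ofReal |((leafWeights p θ 0 g).map
        fun b => (charFun μ₀ (ξ * b)).re).prod - e| ∂anglesLaw := by
  have hm : Measurable (evenPart (charFun μ₀)) :=
    (continuous_evenPart continuous_charFun).measurable
  have hb : ∀ x, ‖evenPart (charFun μ₀) x‖ ≤ 1 := fun x => by
    rw [evenPart_charFun, Complex.norm_real]
    exact (Complex.abs_re_le_norm _).trans (norm_charFun_le_one x)
  have hint : Integrable (fun θ => leafProd p (evenPart (charFun μ₀)) 0 g (ξ, θ)) anglesLaw :=
    Integrable.of_bound ((measurable_leafProd hp hm 0 g).comp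
      (measurable_const.prodMk measurable_id)).aestronglyMeasurable 1
      (ae_of_all _ fun θ => norm_leafProd_le hb _ _ _)
  have e1 : treeCollision p (evenPart (charFun μ₀)) g ξ - (e : ℂ) =
      ∫ θ, (leafProd p (evenPart (charFun μ₀)) 0 g (ξ, θ) - (e : ℂ)) ∂anglesLaw := by
    rw [integral_sub hint (integrable_const _), integral_leafProd hp hm hb]
    simp
  rw [e1, ofReal_norm]
  refine (enorm_integral_le_lintegral_enorm _).trans (le_of_eq ?_)
  refine lintegral_congr fun θ => ?_
  have e2 : leafProd p (evenPart (charFun μ₀)) 0 g (ξ, θ) =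
      ((((leafWeights p θ 0 g).map fun b => (charFun μ₀ (ξ * b)).re).prod : ℝ) : ℂ) := by
    rw [leafProd]
    induction leafWeights p θ 0 g with
    | nil => simp
    | cons b L ih =>
      simp only [List.map_cons, List.prod_cons] at ih ⊢
      rw [ih, evenPart_charFun, Complex.ofReal_mul]
  rw [e2, ← Complex.ofReal_sub, ← ofReal_norm, Complex.norm_real, Real.norm_eq_abs]

lemma norm_treeCollision_sub_le (hp : 0 ≤ p) {μ₀ : Measure ℝ} [IsProbabilityMeasure μ₀]
    (g : BinaryTree Unit) (ξ e : ℝ) :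
    ‖treeCollision p (charFun μ₀) g ξ - (e : ℂ)‖ ≤
      ‖treeCollision p (evenPart (charFun μ₀)) g ξ - (e : ℂ)‖ +
        if g = .nil then |(charFun μ₀ ξ).im| else 0 := by
  split_ifs with hg
  · subst hg
    rw [treeCollision, treeCollision, evenPart_charFun]
    have : charFun μ₀ ξ - (e : ℂ) =
        (((charFun μ₀ ξ).re : ℂ) - e) + ((charFun μ₀ ξ).im : ℂ) * Complex.I := by
      conv_lhs => rw [← Complex.re_add_im (charFun μ₀ ξ)]
      ring
    rw [this]
    refine (norm_add_le _ _).trans (le_of_eq ?_)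
    simp
  · rw [treeCollision_node_evenPart hp continuous_charFun norm_charFun_le_one hg, add_zero]

lemma norm_charFun_sub_le_sum (hp : 0 ≤ p) {μ₀ : Measure ℝ} [IsProbabilityMeasure μ₀]
    {μ : ℝ → Measure ℝ} (hμ : IsSolution p μ₀ μ) {t : ℝ} (ht : 0 ≤ t) (ξ : ℝ) {e : ℝ}
    (he0 : 0 ≤ e) (he1 : e ≤ 1) (N : ℕ) :
    ‖charFun (μ t) ξ - (e : ℂ)‖ ≤
      ∑ n ∈ Finset.range (N + 1), Real.exp (-t) * (1 - Real.exp (-t)) ^ n *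
        ∑ g ∈ BinaryTree.treesOfNumNodesEq n, treeProb g *
          ‖treeCollision p (evenPart (charFun μ₀)) g ξ - (e : ℂ)‖ +
      Real.exp (-t) * |(charFun μ₀ ξ).im| + 2 * (1 - Real.exp (-t)) ^ (N + 1) := by
  set z := 1 - Real.exp (-t) with hz
  have hz0 : 0 ≤ z := by
    rw [hz, sub_nonneg]
    exact Real.exp_le_one_iff.2 (by linarith)
  have hE := Real.exp_pos (-t)
  have hEE : Real.exp (-t) * Real.exp t = 1 := by rw [← Real.exp_add]; simp
  have hEE' : (Real.exp (-t) : ℂ) * (Real.exp t : ℂ) = 1 := by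
    rw [← Complex.ofReal_mul, hEE, Complex.ofReal_one]
  have hrem := norm_exp_mul_charFun_sub_le hp hμ (N + 1) ht ξ
  rw [← hz] at hrem
  set W : ℂ := ∑ n ∈ Finset.range (N + 1), (z : ℂ) ^ n * wild p (charFun μ₀) n ξ with hW
  have h1 : ‖charFun (μ t) ξ - (Real.exp (-t) : ℂ) * W‖ ≤ z ^ (N + 1) := by
    have e1 : charFun (μ t) ξ - (Real.exp (-t) : ℂ) * W =
        (Real.exp (-t) : ℂ) * ((Real.exp t : ℂ) * charFun (μ t) ξ - W) := by
      rw [mul_sub, ← mul_assoc, hEE', one_mul]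
    rw [e1, norm_mul, Complex.norm_real, Real.norm_of_nonneg hE.le]
    calc _ ≤ Real.exp (-t) * (Real.exp t * z ^ (N + 1)) := by gcongr
      _ = _ := by rw [← mul_assoc, hEE, one_mul]
  have hgeom : Real.exp (-t) * ∑ n ∈ Finset.range (N + 1), z ^ n = 1 - z ^ (N + 1) := by
    rw [show Real.exp (-t) = 1 - z by rw [hz]; ring, mul_neg_geom_sum]
  -- The constant e is expanded with the same geometric weights, so that it can be subtracted tree
  -- by tree; its tail and the tail of the Wild sum give the factor 2 in the remainder.
  have h3 : ‖(e : ℂ) - (Real.exp (-t) : ℂ) * ∑ n ∈ Finset.range (N + 1), (z : ℂ) ^ n * e‖ ≤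
      z ^ (N + 1) := by
    have e1 : (e : ℂ) - (Real.exp (-t) : ℂ) * ∑ n ∈ Finset.range (N + 1), (z : ℂ) ^ n * e =
        ((z ^ (N + 1) * e : ℝ) : ℂ) := by
      rw [← Finset.sum_mul, ← mul_assoc]
      have : (Real.exp (-t) : ℂ) * ∑ n ∈ Finset.range (N + 1), (z : ℂ) ^ n =
          ((1 - z ^ (N + 1) : ℝ) : ℂ) := by
        rw [← hgeom]
        push_cast
        rfl
      rw [this]
      push_cast
      ring
    rw [e1, Complex.norm_real, Real.norm_of_nonneg (by positivity)]
    exact mul_le_of_le_one_right (by positivity) he1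
  have h2 : ‖(Real.exp (-t) : ℂ) * W - (Real.exp (-t) : ℂ) *
      ∑ n ∈ Finset.range (N + 1), (z : ℂ) ^ n * e‖ ≤
      ∑ n ∈ Finset.range (N + 1), Real.exp (-t) * z ^ n *
        ∑ g ∈ BinaryTree.treesOfNumNodesEq n, treeProb g *
          ‖treeCollision p (evenPart (charFun μ₀)) g ξ - (e : ℂ)‖ +
      Real.exp (-t) * |(charFun μ₀ ξ).im| := by
    have hterm : ∀ n, ‖wild p (charFun μ₀) n ξ - (e : ℂ)‖ ≤
        ∑ g ∈ BinaryTree.treesOfNumNodesEq n, treeProb g *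
          ‖treeCollision p (evenPart (charFun μ₀)) g ξ - (e : ℂ)‖ +
        if n = 0 then |(charFun μ₀ ξ).im| else 0 := by
      intro n
      have e1 : wild p (charFun μ₀) n ξ - (e : ℂ) =
          ∑ g ∈ BinaryTree.treesOfNumNodesEq n, (treeProb g : ℂ) *
            (treeCollision p (charFun μ₀) g ξ - (e : ℂ)) := by
        simp only [mul_sub, Finset.sum_sub_distrib, ← Finset.sum_mul, ← Complex.ofReal_sum,
          sum_treeProb, Complex.ofReal_one, one_mul, wild]
      rw [e1]
      have e2 : ∀ g ∈ BinaryTree.treesOfNumNodesEq n, ‖(treeProb g : ℂ) *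
            (treeCollision p (charFun μ₀) g ξ - (e : ℂ))‖ ≤ treeProb g *
          ‖treeCollision p (evenPart (charFun μ₀)) g ξ - (e : ℂ)‖ +
          treeProb g * (if n = 0 then |(charFun μ₀ ξ).im| else 0) := by
        intro g hg
        rw [BinaryTree.mem_treesOfNumNodesEq] at hg
        rw [norm_mul, Complex.norm_real, Real.norm_of_nonneg (treeProb_nonneg g), ← mul_add]
        refine mul_le_mul_of_nonneg_left ?_ (treeProb_nonneg g)
        have := norm_treeCollision_sub_le hp (μ₀ := μ₀) g ξ e
        -- The single leaf is the only tree without internal nodes, so the imaginary part enters in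
        -- the term n = 0 only.
        have hiff : g = .nil ↔ n = 0 := by
          rw [← hg]
          cases g <;> simp
        simpa only [hiff] using this
      refine (norm_sum_le_of_le _ e2).trans (le_of_eq ?_)
      rw [Finset.sum_add_distrib, ← Finset.sum_mul, sum_treeProb, one_mul]
    rw [hW, ← mul_sub, ← Finset.sum_sub_distrib, norm_mul, Complex.norm_real,
      Real.norm_of_nonneg hE.le]
    have hsum : ‖∑ n ∈ Finset.range (N + 1), ((z : ℂ) ^ n * wild p (charFun μ₀) n ξ -
        (z : ℂ) ^ n * e)‖ ≤ ∑ n ∈ Finset.range (N + 1), z ^ n *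
        (∑ g ∈ BinaryTree.treesOfNumNodesEq n, treeProb g *
          ‖treeCollision p (evenPart (charFun μ₀)) g ξ - (e : ℂ)‖ +
        if n = 0 then |(charFun μ₀ ξ).im| else 0) := by
      refine norm_sum_le_of_le _ fun n _ => ?_
      rw [← mul_sub, norm_mul, norm_pow, Complex.norm_real, Real.norm_of_nonneg hz0]
      exact mul_le_mul_of_nonneg_left (hterm n) (by positivity)
    refine (mul_le_mul_of_nonneg_left hsum hE.le).trans (le_of_eq ?_)
    simp only [mul_add, Finset.sum_add_distrib, mul_ite, mul_zero, Finset.sum_ite_eq',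
      Finset.mem_range, Nat.succ_pos, if_true, pow_zero, one_mul]
    congr 1
    rw [Finset.mul_sum]
    simp only [mul_assoc]
  have e3 : charFun (μ t) ξ - (e : ℂ) = (charFun (μ t) ξ - (Real.exp (-t) : ℂ) * W) +
      ((Real.exp (-t) : ℂ) * W - (Real.exp (-t) : ℂ) *
        ∑ n ∈ Finset.range (N + 1), (z : ℂ) ^ n * e) -
      ((e : ℂ) - (Real.exp (-t) : ℂ) * ∑ n ∈ Finset.range (N + 1), (z : ℂ) ^ n * e) := by ring
  rw [e3]
  refine (norm_sub_le _ _).trans ?_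
  have := norm_add_le (charFun (μ t) ξ - (Real.exp (-t) : ℂ) * W)
    ((Real.exp (-t) : ℂ) * W - (Real.exp (-t) : ℂ) *
        ∑ n ∈ Finset.range (N + 1), (z : ℂ) ^ n * e)
  linarith

lemma ofReal_norm_charFun_sub_le (hp : 0 ≤ p) {μ₀ : Measure ℝ} [IsProbabilityMeasure μ₀]
    {μ : ℝ → Measure ℝ} (hμ : IsSolution p μ₀ μ) {t : ℝ} (ht : 0 ≤ t) (ξ : ℝ) {e : ℝ}
    (he0 : 0 ≤ e) (he1 : e ≤ 1) :
    ENNReal.ofReal ‖charFun (μ t) ξ - (e : ℂ)‖ ≤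
      ∫⁻ ω, ENNReal.ofReal |((leafWeights p ω.2.2.1 0 ω.2.1).map
        fun b => (charFun μ₀ (ξ * b)).re).prod - e| ∂(mckeanMeasure μ₀ t) +
      ENNReal.ofReal (Real.exp (-t) * |(charFun μ₀ ξ).im|) := by
  have hz0 : 0 ≤ 1 - Real.exp (-t) := by
    rw [sub_nonneg]
    exact Real.exp_le_one_iff.2 (by linarith)
  have hz1 : 1 - Real.exp (-t) < 1 := by linarith [Real.exp_pos (-t)]
  have hmeas : ∀ g : BinaryTree Unit, Measurable fun θ : ℕ → ℝ => ENNReal.ofReal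
      |((leafWeights p θ 0 g).map fun b => (charFun μ₀ (ξ * b)).re).prod - e| := by
    intro g
    have h1 := (measurable_leafProd hp (f := fun x => ((charFun μ₀ x).re : ℂ))
      (by have := measurable_charFun (μ := μ₀); fun_prop) 0 g).comp
      (measurable_const (a := ξ) |>.prodMk measurable_id)
    have h2 : (fun θ : ℕ → ℝ => ((leafWeights p θ 0 g).map
        fun b => (charFun μ₀ (ξ * b)).re).prod) = fun θ =>
        (leafProd p (fun x => ((charFun μ₀ x).re : ℂ)) 0 g (ξ, θ)).re := by
      ext θ
      rw [leafProd]
      have : ∀ L : List ℝ, (L.map fun b => ((charFun μ₀ (ξ * b)).re : ℂ)).prod =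
          (((L.map fun b => (charFun μ₀ (ξ * b)).re).prod : ℝ) : ℂ) := by
        intro L
        induction L with
        | nil => simp
        | cons b L ih => simp [ih]
      rw [this, Complex.ofReal_re]
    have h3 : Measurable (fun θ : ℕ → ℝ => ((leafWeights p θ 0 g).map
        fun b => (charFun μ₀ (ξ * b)).re).prod) := by
      rw [h2]
      exact Complex.measurable_re.comp h1
    exact ((h3.sub_const e).abs).ennreal_ofReal
  rw [lintegral_mckeanMeasure μ₀ t (H := fun g θ => ENNReal.ofReal
      |((leafWeights p θ 0 g).map fun b => (charFun μ₀ (ξ * b)).re).prod - e|) hmeas,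
    tsum_treeWeight_mul t ht]
  set X := ∑' n : ℕ, ENNReal.ofReal (Real.exp (-t) * (1 - Real.exp (-t)) ^ n) *
    ∑ g ∈ BinaryTree.treesOfNumNodesEq n, ENNReal.ofReal (treeProb g) * ∫⁻ θ, ENNReal.ofReal
      |((leafWeights p θ 0 g).map fun b => (charFun μ₀ (ξ * b)).re).prod - e| ∂anglesLaw with hX
  have hN : ∀ N : ℕ, ENNReal.ofReal ‖charFun (μ t) ξ - (e : ℂ)‖ ≤
      X + ENNReal.ofReal (Real.exp (-t) * |(charFun μ₀ ξ).im|) +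
        ENNReal.ofReal (2 * (1 - Real.exp (-t)) ^ (N + 1)) := by
    intro N
    have hnn : ∀ n : ℕ, 0 ≤ ∑ g ∈ BinaryTree.treesOfNumNodesEq n, treeProb g *
          ‖treeCollision p (evenPart (charFun μ₀)) g ξ - (e : ℂ)‖ := fun n =>
      Finset.sum_nonneg fun g _ => mul_nonneg (treeProb_nonneg g) (norm_nonneg _)
    refine (ENNReal.ofReal_le_ofReal
      (norm_charFun_sub_le_sum hp hμ ht ξ he0 he1 N)).trans ?_
    rw [ENNReal.ofReal_add (add_nonneg (Finset.sum_nonneg fun n _ => mul_nonneg (by positivity)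
      (hnn n)) (by positivity)) (by positivity),
      ENNReal.ofReal_add (Finset.sum_nonneg fun n _ => mul_nonneg (by positivity)
      (hnn n)) (by positivity)]
    gcongr
    rw [ENNReal.ofReal_sum_of_nonneg fun n _ => mul_nonneg (by positivity) (hnn n)]
    refine le_trans ?_ (ENNReal.sum_le_tsum (Finset.range (N + 1)))
    refine Finset.sum_le_sum fun n _ => ?_
    rw [ENNReal.ofReal_mul (by positivity), ENNReal.ofReal_sum_of_nonneg fun g _ =>
      mul_nonneg (treeProb_nonneg g) (norm_nonneg _)]
    gcongr with g hg
    rw [ENNReal.ofReal_mul (treeProb_nonneg g)]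
    gcongr
    exact treeCollision_sub_le hp g ξ e
  have hlim : Tendsto (fun N : ℕ => X + ENNReal.ofReal (Real.exp (-t) * |(charFun μ₀ ξ).im|) +
        ENNReal.ofReal (2 * (1 - Real.exp (-t)) ^ (N + 1))) atTop
      (𝓝 (X + ENNReal.ofReal (Real.exp (-t) * |(charFun μ₀ ξ).im|))) := by
    have h1 : Tendsto (fun N : ℕ => 2 * (1 - Real.exp (-t)) ^ (N + 1)) atTop (𝓝 0) := by
      simpa using ((tendsto_pow_atTop_nhds_zero_of_lt_one hz0 hz1).comp
        (tendsto_add_atTop_nat 1)).const_mul 2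
    have h2 := ENNReal.tendsto_ofReal h1
    rw [ENNReal.ofReal_zero] at h2
    simpa using h2.const_add (X + ENNReal.ofReal (Real.exp (-t) * |(charFun μ₀ ξ).im|))
  exact ge_of_tendsto' hlim hN

lemma abs_v0_im {α a₀ : ℝ} {μ₀ : Measure ℝ} {ξ : ℝ} (hξ : ξ ≠ 0) :
    |(v0 α a₀ μ₀ ξ).im| = |(charFun μ₀ ξ).im| / |ξ| ^ α := by
  have hξα : 0 < |ξ| ^ α := Real.rpow_pos_of_pos (abs_pos.2 hξ) _
  rw [v0, if_neg hξ, Complex.sub_im, Complex.div_ofReal_im, Complex.ofReal_im, sub_zero, abs_div,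
    abs_of_pos hξα, Complex.sub_im, Complex.one_im, zero_sub, abs_neg]

lemma chiDist_le_chiBound {a₀ : ℝ} (hp : 0 < p) (ha₀ : 0 < a₀) {μ₀ G : Measure ℝ}
    [IsProbabilityMeasure μ₀] (hG : IsSymmStable (2 / (1 + p)) a₀ G)
    (hv : BddAbove (range fun ξ => |v0Star (2 / (1 + p)) a₀ μ₀ ξ|))
    {μ : ℝ → Measure ℝ} (hμ : IsSolution p μ₀ μ) {η d c t : ℝ} (hη : η < a₀)
    (hd : Admissible (2 / (1 + p)) a₀ (v0Star (2 / (1 + p)) a₀ μ₀) η d)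
    (hc : c ∈ Ioo (0 : ℝ) 1) (ht : 0 ≤ t) :
    chiDist (2 / (1 + p)) (μ t) G ≤ chiBound p a₀ μ₀ η d c t := by
  refine iSup₂_le fun ξ hξ => ?_
  simp only [chiBound]
  set α : ℝ := 2 / (1 + p) with hαdef
  have hα : 0 < α := by positivity
  set v := v0Star α a₀ μ₀ with hvdef
  have hd0 := hd.1.1
  have hM := bigM_pos (v := v) ha₀
  have hd1 := d1_pos (α := α) (v := v) ha₀
  have hM1 := maxM_nonneg α a₀ η 1
  have hβm := measurable_betaMax hp.le
  have hξα : 0 < |ξ| ^ α := Real.rpow_pos_of_pos (abs_pos.2 hξ) _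
  have hkey := ofReal_norm_charFun_sub_le hp.le hμ ht ξ (Real.exp_pos (-(a₀ * |ξ| ^ α))).le
    (Real.exp_le_one_iff.2 (by rw [neg_nonpos]; positivity))
  rw [hG ξ, div_eq_mul_inv, ENNReal.ofReal_mul (norm_nonneg _)]
  refine (mul_le_mul_left hkey _).trans ?_
  rw [add_mul, ← lintegral_mul_const' _ _ ENNReal.ofReal_ne_top,
    ← ENNReal.ofReal_mul (by positivity)]
  have hlast : ENNReal.ofReal (Real.exp (-t) * |(charFun μ₀ ξ).im| * (|ξ| ^ α)⁻¹) ≤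
      ENNReal.ofReal (Real.exp (-t)) * ⨆ ξ : ℝ, ENNReal.ofReal |(v0 α a₀ μ₀ ξ).im| := by
    rw [mul_assoc, ← div_eq_mul_inv, ← abs_v0_im (a₀ := a₀) hξ,
      ENNReal.ofReal_mul (Real.exp_pos _).le]
    gcongr
    exact le_iSup (fun ξ => ENNReal.ofReal |(v0 α a₀ μ₀ ξ).im|) ξ
  refine add_le_add ?_ hlast
  set K := kStar α a₀ v d + 2 / (d * d1 α a₀ v ^ α) with hK
  have hK0 : 0 ≤ K := by
    have h1 := add_le_kStar (α := α) (v := v) ha₀ hd0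
    have h2 := vBar_nonneg v (d1 α a₀ v * d ^ (1 / α))
    have h3 : 0 ≤ 4 / 5 * bigM a₀ v ^ 2 * d1 α a₀ v ^ α * d := by positivity
    have h4 : 0 ≤ 2 / (d * d1 α a₀ v ^ α) := by positivity
    linarith
  set bad : Set McKeanSpace := {ω | min d (d ^ (1 / (c * α))) < betaMax p ω} with hbad
  have hbadm : MeasurableSet bad := measurableSet_lt measurable_const hβm
  have hpt : ∀ ω : McKeanSpace, ENNReal.ofReal |((leafWeights p ω.2.2.1 0 ω.2.1).map
        fun b => (charFun μ₀ (ξ * b)).re).prod - Real.exp (-(a₀ * |ξ| ^ α))| *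
        ENNReal.ofReal (|ξ| ^ α)⁻¹ ≤
      ENNReal.ofReal (vBar v (d1 α a₀ v * betaMax p ω ^ c)) +
      ENNReal.ofReal (4 / 5 * bigM a₀ v ^ 2 * maxM α a₀ η 1) *
        ENNReal.ofReal (betaMax p ω ^ α) +
      bad.indicator (fun _ => ENNReal.ofReal K) ω +
      ENNReal.ofReal (2 / d1 α a₀ v ^ α) * ENNReal.ofReal (betaMax p ω ^ (α * (1 - c))) := by
    intro ω
    have hβ := betaMax_pos hp ω
    have h := abs_prod_sub_exp_div_le hα ha₀ hη hv hd hc (sum_leafWeights hp ω.2.2.1 0 ω.2.1) hξ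
    rw [← betaMax_eq, ← hvdef] at h
    rw [← ENNReal.ofReal_mul (abs_nonneg _), ← div_eq_mul_inv]
    refine (ENNReal.ofReal_le_ofReal h).trans (le_of_eq ?_)
    have e : bad.indicator (fun _ => ENNReal.ofReal K) ω =
        ENNReal.ofReal (if min d (d ^ (1 / (c * α))) < betaMax p ω then K else 0) := by
      by_cases hω : min d (d ^ (1 / (c * α))) < betaMax p ω
      · rw [indicator_of_mem (show ω ∈ bad from hω), if_pos hω]
      · rw [indicator_of_notMem (show ω ∉ bad from hω), if_neg hω, ENNReal.ofReal_zero]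
    have hite : 0 ≤ if min d (d ^ (1 / (c * α))) < betaMax p ω then K else 0 := by
      split_ifs
      exacts [hK0, le_rfl]
    have hvB := vBar_nonneg v (d1 α a₀ v * betaMax p ω ^ c)
    rw [e, ENNReal.ofReal_add (by positivity) (by positivity),
      ENNReal.ofReal_add (by positivity) hite, ENNReal.ofReal_add hvB (by positivity),
      ENNReal.ofReal_mul (p := 4 / 5 * bigM a₀ v ^ 2 * maxM α a₀ η 1) (by positivity),
      ENNReal.ofReal_mul (p := 2 / d1 α a₀ v ^ α) (by positivity)]
  have m2 : Measurable fun ω => ENNReal.ofReal (4 / 5 * bigM a₀ v ^ 2 * maxM α a₀ η 1) *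
        ENNReal.ofReal (betaMax p ω ^ α) := ((hβm.pow_const α).ennreal_ofReal).const_mul _
  have m3 : Measurable (bad.indicator fun _ => ENNReal.ofReal K) :=
    measurable_const.indicator hbadm
  have m4 : Measurable fun ω => ENNReal.ofReal (2 / d1 α a₀ v ^ α) *
      ENNReal.ofReal (betaMax p ω ^ (α * (1 - c))) := ((hβm.pow_const _).ennreal_ofReal).const_mul _
  refine (lintegral_mono hpt).trans ?_
  -- The integral is split off from the right, so that no measurability of the term with `vBar` is
  -- needed.
  rw [lintegral_add_right _ m4, lintegral_add_right _ m3, lintegral_add_right _ m2,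
    lintegral_const_mul _ ((hβm.pow_const α).ennreal_ofReal),
    lintegral_const_mul _ ((hβm.pow_const _).ennreal_ofReal), lintegral_indicator_const hbadm]
  simp only [expBeta]
  -- The pointwise estimate has no counterpart of the terms with 2 M₁ and with M₃; being
  -- nonnegative, they are simply added.
  refine add_le_add ?_ le_rfl
  refine add_le_add ?_ le_rfl
  refine le_trans ?_ le_self_add
  refine add_le_add ?_ le_rfl
  exact le_self_add

/-! ### Decay of the largest weight -/

/-- The expectation of `∑ |β_j| ^ (2 α)` for a random tree with `n` nodes. -/
def meanSq (n : ℕ) : ℝ := ∑ g ∈ BinaryTree.treesOfNumNodesEq n, treeProb g * treeSq g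

lemma treeSq_nonneg (g : BinaryTree Unit) : 0 ≤ treeSq g := by
  induction g with
  | nil => simp [treeSq]
  | node _ l r hl hr => rw [treeSq]; positivity

lemma meanSq_nonneg (n : ℕ) : 0 ≤ meanSq n :=
  Finset.sum_nonneg fun g _ => mul_nonneg (treeProb_nonneg g) (treeSq_nonneg g)

lemma meanSq_zero : meanSq 0 = 1 := by simp [meanSq, treeProb, treeSq]

/-- Both subtrees run through all sizes 0, …, n with equal weight, so the two factors 3/8 add up to
3/4. -/
lemma meanSq_succ (n : ℕ) :
    meanSq (n + 1) = 3 / 4 * (((n + 1 : ℕ) : ℝ)⁻¹ * ∑ i ∈ Finset.range (n + 1), meanSq i) := by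
  rw [meanSq, sum_treesOfNumNodesEq_succ]
  have h : ∀ ij ∈ Finset.HasAntidiagonal.antidiagonal n,
      ∑ l ∈ BinaryTree.treesOfNumNodesEq ij.1, ∑ r ∈ BinaryTree.treesOfNumNodesEq ij.2,
        treeProb (.node () l r) * treeSq (.node () l r) =
      (n + 1 : ℝ)⁻¹ * (3 / 8) * (meanSq ij.1 + meanSq ij.2) := by
    intro ij hij
    have h1 : ∀ l ∈ BinaryTree.treesOfNumNodesEq ij.1, ∀ r ∈ BinaryTree.treesOfNumNodesEq ij.2,
        treeProb (.node () l r) * treeSq (.node () l r) = (n + 1 : ℝ)⁻¹ * (3 / 8) *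
          (treeProb l * treeSq l * treeProb r + treeProb l * (treeProb r * treeSq r)) := by
      intro l hl r hr
      rw [treeProb_node hij hl hr, treeSq]
      ring
    rw [Finset.sum_congr rfl fun l hl => Finset.sum_congr rfl fun r hr => h1 l hl r hr]
    simp only [← Finset.mul_sum, Finset.sum_add_distrib, ← Finset.sum_mul, sum_treeProb, mul_one,
      one_mul, meanSq]
  rw [Finset.sum_congr rfl h, ← Finset.mul_sum, Finset.sum_add_distrib,
    Finset.Nat.sum_antidiagonal_eq_sum_range_succ (fun i _ => meanSq i),
    Finset.Nat.sum_antidiagonal_eq_sum_range_succ (fun _ j => meanSq j)]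
  have hr := Finset.sum_range_reflect meanSq (n + 1)
  simp only [Nat.add_sub_cancel] at hr
  rw [hr]
  push_cast
  ring

lemma antitone_meanSq : Antitone meanSq := by
  refine antitone_nat_of_succ_le fun n => ?_
  have h0 := meanSq_nonneg n
  cases n with
  | zero =>
    rw [meanSq_succ]
    simp [meanSq_zero]
    norm_num
  | succ n =>
    have h1 := meanSq_succ n
    rw [meanSq_succ, Finset.sum_range_succ]
    -- The recursion is solved for the partial sum; the next term is then (n + 7/4) / (n + 2) times
    -- the present one.
    have e : ∑ i ∈ Finset.range (n + 1), meanSq i = 4 / 3 * ((n + 1 : ℕ) : ℝ) * meanSq (n + 1) := by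
      rw [h1]
      field_simp
    rw [e]
    have h2 : (0 : ℝ) < ((n + 1 + 1 : ℕ) : ℝ) := by positivity
    rw [mul_left_comm, inv_mul_le_iff₀ h2]
    push_cast
    nlinarith

/-- The monotone limit L exists and equals the limit of the Cesàro means, so L = (3/4) L. -/
lemma tendsto_meanSq : Tendsto meanSq atTop (𝓝 0) := by
  have hb : BddBelow (range meanSq) := ⟨0, by rintro _ ⟨n, rfl⟩; exact meanSq_nonneg n⟩
  have h := tendsto_atTop_ciInf antitone_meanSq hb
  have h1 := (h.cesaro.comp (tendsto_add_atTop_nat 1)).const_mul (3 / 4)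
  have h2 := h.comp (tendsto_add_atTop_nat 1)
  have e : (fun n => 3 / 4 * ((fun n : ℕ => (n : ℝ)⁻¹ * ∑ i ∈ Finset.range n, meanSq i) ∘
      fun a => a + 1) n) = meanSq ∘ fun a => a + 1 := by
    ext n
    exact (meanSq_succ n).symm
  rw [e] at h1
  have h3 := tendsto_nhds_unique h1 h2
  have h4 : ⨅ n, meanSq n = 0 := by linarith
  rwa [h4] at h

lemma lintegral_leafSqSum (hp : 0 < p) (μ₀ : Measure ℝ) [IsProbabilityMeasure μ₀] {t : ℝ}
    (ht : 0 ≤ t) :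
    ∫⁻ ω, ENNReal.ofReal (leafSqSum p 0 ω.2.1 ω.2.2.1) ∂(mckeanMeasure μ₀ t) =
      ∑' n : ℕ, ENNReal.ofReal (Real.exp (-t) * (1 - Real.exp (-t)) ^ n) *
        ENNReal.ofReal (meanSq n) := by
  rw [lintegral_mckeanMeasure μ₀ t (H := fun g θ => ENNReal.ofReal (leafSqSum p 0 g θ))
    (fun g => (measurable_leafSqSum hp 0 g).ennreal_ofReal), tsum_treeWeight_mul t ht]
  refine tsum_congr fun n => ?_
  rw [meanSq, ENNReal.ofReal_sum_of_nonneg fun g _ =>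
    mul_nonneg (treeProb_nonneg g) (treeSq_nonneg g)]
  congr 1
  refine Finset.sum_congr rfl fun g _ => ?_
  rw [ENNReal.ofReal_mul (treeProb_nonneg g), ← integral_leafSqSum hp g 0,
    ofReal_integral_eq_lintegral_ofReal]
  · exact Integrable.of_bound (measurable_leafSqSum hp 0 g).aestronglyMeasurable 1
      (ae_of_all _ fun θ => by
        rw [Real.norm_of_nonneg (leafSqSum_nonneg _ _ _)]
        exact leafSqSum_le_one hp _ _ _)
  · exact ae_of_all _ fun θ => leafSqSum_nonneg _ _ _

lemma tendsto_lintegral_leafSqSum (hp : 0 < p) (μ₀ : Measure ℝ) [IsProbabilityMeasure μ₀] :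
    Tendsto (fun t => ∫⁻ ω, ENNReal.ofReal (leafSqSum p 0 ω.2.1 ω.2.2.1) ∂(mckeanMeasure μ₀ t))
      atTop (𝓝 0) := by
  have hexp : Tendsto (fun t : ℝ => ENNReal.ofReal (Real.exp (-t))) atTop (𝓝 0) := by
    have := ENNReal.tendsto_ofReal (Real.tendsto_exp_neg_atTop_nhds_zero)
    rwa [ENNReal.ofReal_zero] at this
  refine ENNReal.tendsto_nhds_zero.2 fun ε hε => ?_
  obtain ⟨N, hN⟩ := eventually_atTop.1 ((ENNReal.tendsto_nhds_zero.1
    (by simpa using ENNReal.tendsto_ofReal tendsto_meanSq)) (ε / 2) (ENNReal.half_pos hε.ne'))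
  have hsmall : ∀ᶠ t : ℝ in atTop, (N : ℝ≥0∞) * ENNReal.ofReal (Real.exp (-t)) ≤ ε / 2 := by
    have := ENNReal.Tendsto.const_mul hexp (Or.inr (ENNReal.natCast_ne_top N))
    rw [mul_zero] at this
    exact ENNReal.tendsto_nhds_zero.1 this _ (ENNReal.half_pos hε.ne')
  filter_upwards [hsmall, eventually_ge_atTop 0] with t hs ht
  have hz0 : 0 ≤ 1 - Real.exp (-t) := by
    rw [sub_nonneg]
    exact Real.exp_le_one_iff.2 (by linarith)
  have hz1 : 1 - Real.exp (-t) ≤ 1 := by linarith [Real.exp_pos (-t)]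
  rw [lintegral_leafSqSum hp μ₀ ht]
  -- Trees with fewer than N nodes have total probability at most N e^{-t}, and on them the mean is
  -- at most 1; on larger trees it is at most ε / 2.
  calc _ ≤ ∑' n : ℕ, ((if n ∈ Finset.range N then ENNReal.ofReal (Real.exp (-t)) else 0) +
        ENNReal.ofReal (Real.exp (-t) * (1 - Real.exp (-t)) ^ n) * (ε / 2)) := by
        refine ENNReal.tsum_le_tsum fun n => ?_
        split_ifs with hn
        · refine le_trans ?_ le_self_add
          rw [← ENNReal.ofReal_mul (by positivity)]
          apply ENNReal.ofReal_le_ofReal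
          have h1 : meanSq n ≤ 1 := by
            rw [← meanSq_zero]
            exact antitone_meanSq (Nat.zero_le n)
          have h2 : (1 - Real.exp (-t)) ^ n ≤ 1 := pow_le_one₀ hz0 hz1
          calc _ ≤ Real.exp (-t) * 1 * 1 := by
                have := meanSq_nonneg n
                gcongr
            _ = _ := by ring
        · rw [zero_add]
          gcongr
          exact hN n (by simpa using hn)
    _ = N * ENNReal.ofReal (Real.exp (-t)) + ε / 2 := by
        rw [ENNReal.tsum_add, ENNReal.tsum_mul_right, tsum_ofReal_exp_mul_pow ht, one_mul,
          tsum_eq_sum (s := Finset.range N) (fun n hn => if_neg hn), Finset.sum_ite_mem,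
          Finset.inter_self, Finset.sum_const, Finset.card_range, nsmul_eq_mul]
    _ ≤ ε / 2 + ε / 2 := by gcongr
    _ = ε := ENNReal.add_halves ε

lemma rpow_betaMax_sq_le (hp : 0 < p) (ω : McKeanSpace) :
    (betaMax p ω ^ (2 / (1 + p))) ^ 2 ≤ leafSqSum p 0 ω.2.1 ω.2.2.1 := by
  have hα : 0 < 2 / (1 + p) := by positivity
  have h := rpow_listMax_le (mul_pos hα two_pos) (leafWeights p ω.2.2.1 0 ω.2.1)
  rw [← betaMax_eq] at h
  have e : ∀ x : ℝ, 0 ≤ x → (x ^ (2 / (1 + p))) ^ 2 = x ^ (2 / (1 + p) * 2) := fun x hx => by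
    rw [Real.rpow_mul hx, Real.rpow_two]
  rw [e _ (betaMax_pos hp ω).le, leafSqSum]
  simp only [e _ (abs_nonneg _)]
  exact h

/-- A Markov argument: f is small where the largest weight β is below δ, and elsewhere f ≤ |C|
(β^α)² / (δ^α)², whose expectation is dominated by that of `leafSqSum`. An upper bound on f suffices
because `ENNReal.ofReal` discards negative values, and f need not be measurable. -/
lemma tendsto_expBeta (hp : 0 < p) (μ₀ : Measure ℝ) [IsProbabilityMeasure μ₀] {f : ℝ → ℝ} {C : ℝ}
    (hC : ∀ β, 0 < β → β ≤ 1 → f β ≤ C) (hf : Tendsto f (𝓝[>] 0) (𝓝 0)) :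
    Tendsto (fun t => expBeta p μ₀ t f) atTop (𝓝 0) := by
  refine ENNReal.tendsto_nhds_zero.2 fun ε hε => ?_
  have hf' : Tendsto (fun β => ENNReal.ofReal (f β)) (𝓝[>] 0) (𝓝 0) := by
    simpa using ENNReal.tendsto_ofReal hf
  obtain ⟨δ, hδ, hδ'⟩ := mem_nhdsGT_iff_exists_Ioo_subset.1
    (ENNReal.tendsto_nhds_zero.1 hf' (ε / 2) (ENNReal.half_pos hε.ne'))
  have hδ0 : (0 : ℝ) < δ := hδ
  set α : ℝ := 2 / (1 + p) with hα
  have hα0 : 0 < α := by positivity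
  set K := |C| / (δ ^ α) ^ 2 with hK
  have hsmall : ∀ᶠ t : ℝ in atTop, ENNReal.ofReal K *
      ∫⁻ ω, ENNReal.ofReal (leafSqSum p 0 ω.2.1 ω.2.2.1) ∂(mckeanMeasure μ₀ t) ≤ ε / 2 := by
    have := ENNReal.Tendsto.const_mul (tendsto_lintegral_leafSqSum hp μ₀)
      (Or.inr (ENNReal.ofReal_ne_top (r := K)))
    rw [mul_zero] at this
    exact ENNReal.tendsto_nhds_zero.1 this _ (ENNReal.half_pos hε.ne')
  filter_upwards [hsmall, eventually_ge_atTop 0] with t hs ht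
  calc expBeta p μ₀ t f ≤ ∫⁻ ω, (ε / 2 + ENNReal.ofReal K *
        ENNReal.ofReal (leafSqSum p 0 ω.2.1 ω.2.2.1)) ∂(mckeanMeasure μ₀ t) := by
        refine lintegral_mono fun ω => ?_
        have hβ := betaMax_pos hp ω
        rcases lt_or_ge (betaMax p ω) δ with hlt | hge
        · exact le_trans (hδ' ⟨hβ, hlt⟩) le_self_add
        · refine le_trans ?_ le_add_self
          rw [← ENNReal.ofReal_mul (by positivity)]
          apply ENNReal.ofReal_le_ofReal
          refine (hC _ hβ (betaMax_le_one hp ω)).trans ((le_abs_self C).trans ?_)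
          rw [hK, div_mul_eq_mul_div, le_div_iff₀ (by positivity)]
          gcongr
          refine le_trans ?_ (rpow_betaMax_sq_le hp ω)
          gcongr
    _ = ε / 2 + ENNReal.ofReal K *
        ∫⁻ ω, ENNReal.ofReal (leafSqSum p 0 ω.2.1 ω.2.2.1) ∂(mckeanMeasure μ₀ t) := by
        rw [lintegral_add_left measurable_const, lintegral_const, mckeanMeasure_univ μ₀ ht, mul_one,
          lintegral_const_mul' _ _ ENNReal.ofReal_ne_top]
    _ ≤ ε / 2 + ε / 2 := by gcongr
    _ = ε := ENNReal.add_halves ε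

lemma tendsto_mckeanMeasure_lt_betaMax (hp : 0 < p) (μ₀ : Measure ℝ) [IsProbabilityMeasure μ₀]
    {m : ℝ} (hm : 0 < m) :
    Tendsto (fun t => mckeanMeasure μ₀ t {ω | m < betaMax p ω}) atTop (𝓝 0) := by
  have h := tendsto_expBeta hp μ₀ (f := fun β => if m < β then 1 else 0) (C := 1)
    (fun β _ _ => by split_ifs <;> norm_num) (by
      refine tendsto_const_nhds.congr' ?_
      filter_upwards [Ioo_mem_nhdsGT hm] with β hβ
      rw [if_neg (not_lt.2 hβ.2.le)])
  refine h.congr fun t => ?_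
  have hb : MeasurableSet {ω : McKeanSpace | m < betaMax p ω} :=
    measurableSet_lt measurable_const (measurable_betaMax hp.le)
  rw [expBeta, ← lintegral_indicator_one hb]
  refine lintegral_congr fun ω => ?_
  by_cases hω : m < betaMax p ω
  · rw [if_pos hω, indicator_of_mem (show ω ∈ {ω | m < betaMax p ω} from hω)]
    simp
  · rw [if_neg hω, indicator_of_notMem (show ω ∉ {ω | m < betaMax p ω} from hω)]
    simp

lemma tendsto_rpow_nhdsGT_zero {r : ℝ} (hr : 0 < r) :
    Tendsto (fun β : ℝ => β ^ r) (𝓝[>] 0) (𝓝 0) := by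
  have := (Real.continuousAt_rpow_const 0 r (Or.inr hr.le)).tendsto.mono_left
    (nhdsWithin_le_nhds (s := Ioi 0))
  rwa [Real.zero_rpow hr.ne'] at this

lemma tendsto_chiBound {a₀ : ℝ} (hp : 0 < p) (ha₀ : 0 < a₀) {μ₀ : Measure ℝ}
    [IsProbabilityMeasure μ₀]
    (hv : BddAbove (range fun ξ => |v0Star (2 / (1 + p)) a₀ μ₀ ξ|))
    (hv0 : Tendsto (v0Star (2 / (1 + p)) a₀ μ₀) (𝓝 0) (𝓝 0)) {η d c : ℝ} (hd : 0 < d)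
    (hc : c ∈ Ioo (0 : ℝ) 1)
    (him : (⨆ ξ : ℝ, ENNReal.ofReal |(v0 (2 / (1 + p)) a₀ μ₀ ξ).im|) ≠ ⊤) :
    Tendsto (fun t => chiBound p a₀ μ₀ η d c t) atTop (𝓝 0) := by
  simp only [chiBound]
  set α : ℝ := 2 / (1 + p) with hαdef
  have hα : 0 < α := by positivity
  set v := v0Star α a₀ μ₀ with hvdef
  have hpow : ∀ r : ℝ, 0 < r → Tendsto (fun t => expBeta p μ₀ t (fun β => β ^ r)) atTop (𝓝 0) :=
    fun r hr => tendsto_expBeta hp μ₀ (C := 1)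
      (fun β h0 h1 => Real.rpow_le_one h0.le h1 hr.le) (tendsto_rpow_nhdsGT_zero hr)
  have hvt : Tendsto (fun β : ℝ => vBar v (d1 α a₀ v * β ^ c)) (𝓝[>] 0) (𝓝 0) := by
    refine (tendsto_vBar hv0).comp ?_
    simpa using (tendsto_rpow_nhdsGT_zero hc.1).const_mul (d1 α a₀ v)
  have t1 := tendsto_expBeta hp μ₀ (f := fun β => vBar v (d1 α a₀ v * β ^ c))
    (fun β _ _ => vBar_le_bigM hv ha₀ _) hvt
  have t2 := tendsto_expBeta hp μ₀ (f := fun β => vBar v (d1 α a₀ v * β ^ c) ^ 2)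
    (C := bigM a₀ v ^ 2)
    (fun β _ _ => pow_le_pow_left₀ (vBar_nonneg _ _) (vBar_le_bigM hv ha₀ _) 2)
    (by simpa using hvt.pow 2)
  have t5 := tendsto_mckeanMeasure_lt_betaMax hp μ₀
    (m := min d (d ^ (1 / (c * α)))) (by have := hc.1; positivity)
  have hexp : Tendsto (fun t : ℝ => ENNReal.ofReal (Real.exp (-t))) atTop (𝓝 0) := by
    have := ENNReal.tendsto_ofReal (Real.tendsto_exp_neg_atTop_nhds_zero)
    rwa [ENNReal.ofReal_zero] at this
  have hmul : ∀ (K : ℝ) {u : ℝ → ℝ≥0∞}, Tendsto u atTop (𝓝 0) →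
      Tendsto (fun t => ENNReal.ofReal K * u t) atTop (𝓝 0) := fun K u hu => by
    simpa using ENNReal.Tendsto.const_mul hu (Or.inr (ENNReal.ofReal_ne_top (r := K)))
  have t7 := ENNReal.Tendsto.mul_const hexp (Or.inr him)
  rw [zero_mul] at t7
  have := (((((t1.add (hmul (2 * maxM α a₀ η 1) t2)).add
    (hmul (4 / 5 * bigM a₀ v ^ 2 * maxM α a₀ η 1) (hpow α hα))).add
    (hmul (32 / 25 * maxM α a₀ η 3 * bigM a₀ v ^ 4) (hpow (2 * α) (by positivity)))).add
    (hmul (kStar α a₀ v d + 2 / (d * d1 α a₀ v ^ α)) t5)).add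
    (hmul (2 / d1 α a₀ v ^ α) (hpow (α * (1 - c)) (mul_pos hα (sub_pos.2 hc.2))))).add t7
  simpa only [add_zero] using this

end InelasticKac

end

/-! ### Assembly of the theorem -/

theorem theorem2 (p a₀ : ℝ) (hp : 0 < p) (ha₀ : 0 < a₀)
    (μ₀ G : MeasureTheory.Measure ℝ) [MeasureTheory.IsProbabilityMeasure μ₀]
    [MeasureTheory.IsProbabilityMeasure G]
    (hG : InelasticKac.IsSymmStable (2 / (1 + p)) a₀ G)
    (hμ₀ : InelasticKac.InDomainOfNormalAttraction (2 / (1 + p)) μ₀ G)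
    (μ : ℝ → MeasureTheory.Measure ℝ) (hμ : InelasticKac.IsSolution p μ₀ μ) :
    -- `v₀*` is bounded and vanishes in the limit at the origin
    (BddAbove (Set.range fun ξ => |InelasticKac.v0Star (2 / (1 + p)) a₀ μ₀ ξ|) ∧
      Filter.Tendsto (InelasticKac.v0Star (2 / (1 + p)) a₀ μ₀) (nhds 0) (nhds 0)) ∧
    ∀ η : ℝ, η ∈ Set.Ioo 0 a₀ →
      -- admissible `d` exist
      (∃ d : ℝ, InelasticKac.Admissible (2 / (1 + p)) a₀
        (InelasticKac.v0Star (2 / (1 + p)) a₀ μ₀) η d) ∧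
      ∀ d : ℝ, InelasticKac.Admissible (2 / (1 + p)) a₀
          (InelasticKac.v0Star (2 / (1 + p)) a₀ μ₀) η d →
        ∀ c : ℝ, c ∈ Set.Ioo (0 : ℝ) 1 →
          -- the bound
          (∀ t : ℝ, 0 ≤ t →
            InelasticKac.chiDist (2 / (1 + p)) (μ t) G
              ≤ InelasticKac.chiBound p a₀ μ₀ η d c t) ∧
          -- the bound tends to zero, provided that its last term is finite
          ((⨆ ξ : ℝ, ENNReal.ofReal |(InelasticKac.v0 (2 / (1 + p)) a₀ μ₀ ξ).im|) ≠ ⊤ →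
            Filter.Tendsto (fun t => InelasticKac.chiBound p a₀ μ₀ η d c t)
              Filter.atTop (nhds 0)) := by
  have hα : (0 : ℝ) < 2 / (1 + p) := by positivity
  have hα2 : 2 / (1 + p) < 2 := by rw [div_lt_iff₀ (by positivity)]; linarith
  have hv0 := InelasticKac.tendsto_v0Star hα hα2 hG hμ₀
  have hv := InelasticKac.bddAbove_range_abs_v0Star hα hv0
  exact ⟨⟨hv, hv0⟩, fun η hη => ⟨InelasticKac.exists_admissible hα hv0 hη.1, fun d hd c hc =>
    ⟨fun t ht => InelasticKac.chiDist_le_chiBound hp ha₀ hG hv hμ hη.2 hd hc ht,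
      fun him => InelasticKac.tendsto_chiBound hp ha₀ hv hv0 hd.1.1 hc him⟩⟩⟩
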